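/- Let $G$ be a (discrete) group. A family of subgroups of $G$ is a set of subgroups closed under conjugation and under passing to subgroups. A model for the classifying space $E_{\mathcal F}(G)$ of a family $\mathcal F$ is a $G$-CW-complex $X$ all of whose isotropy groups belong to $\mathcal F$ and such that for every $G$-CW-complex $Y$ whose isotropy groups belong to $\mathcal F$ there is precisely one $G$-map $Y \to X$ up to $G$-homotopy. Let $\mathcal F \subseteq \mathcal G$ be families of subgroups of $G$ and let $\sim$ be an equivalence relation on $\mathcal G \setminus \mathcal F$ such that for $H, K \in \mathcal G \setminus \mathcal F$ and $g \in G$: if $H \subseteq K$ then $H \sim K$; and $H \sim K$ if and only if $gHg^{-1} \sim gKg^{-1}$. Write $[H]$ for the equivalence class of $H$ and $[\mathcal G\setminus\mathcal F]$ for the set of equivalence classes, on which $G$ acts by conjugation. Put $N_G[H] = \{g \in G \mid [g^{-1}Hg] = [H]\}$, a subgroup of $G$; let $\mathcal F \cap N_G[H]$ be the family of subgroups of $N_G[H]$ that belong to $\mathcal F$; and let $$\mathcal G[H] = \{K \subseteq N_G[H] \mid K \in \mathcal G\setminus\mathcal F,\ [K]=[H]\} \cup (\mathcal F \cap N_G[H]),$$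 a family of subgroups of $N_G[H]$. Let $I$ be a complete system of representatives $[H]$ of the $G$-orbits in $[\mathcal G \setminus \mathcal F]$. (1) Choose an arbitrary $G$-CW-model $A$ for $E_{\mathcal F}(G)$ and, for every $[H] \in I$, arbitrary $N_G[H]$-CW-models $C_H$ for $E_{\mathcal F\cap N_G[H]}(N_G[H])$ and $B_H$ for $E_{\mathcal G[H]}(N_G[H])$. Let $f_{[H]} \colon C_H \to B_H$ be $N_G[H]$-maps and $i \colon \coprod_{[H]\in I} G\times_{N_G[H]} C_H \to A$ a $G$-map such that either every $f_{[H]}$ is cellular and $i$ is an inclusion of $G$-CW-complexes, or every $f_{[H]}$ is an inclusion of $N_G[H]$-CW-complexes and $i$ is cellular. Let $$\begin{array}{ccc}\coprod_{[H]\in I} G\times_{N_G[H]} C_H & \xrightarrow{\ i\ } & A\\ {\scriptstyle\coprod \mathrm{id}_G\times_{N_G[H]} f_{[H]}}\big\downarrow\ & & \big\downarrow{\scriptstyle a}\\ \coprod_{[H]\in I} G\times_{N_G[H]} B_H & \xrightarrow{\ b\ } & X\end{array}$$ be a pushout of $G$-spaces. Then $X$ has a $G$-CW-structure whose $n$-skeleton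 is, for every $n$, the union of the images under $a$ and $b$ of the $n$-skeleta of $A$ and of $\coprod_{[H]\in I} G\times_{N_G[H]} B_H$, and with it $X$ is a model for $E_{\mathcal G}(G)$. (2) Let $n \ge 0$ be an integer. If there are an $n$-dimensional $G$-CW-model for $E_{\mathcal F}(G)$ and, for every $[H]\in I$, an $(n-1)$-dimensional $N_G[H]$-CW-model for $E_{\mathcal F\cap N_G[H]}(N_G[H])$ and an $n$-dimensional $N_G[H]$-CW-model for $E_{\mathcal G[H]}(N_G[H])$, then there is an $n$-dimensional $G$-CW-model for $E_{\mathcal G}(G)$. This holds both when "$d$-dimensional" means "of dimension exactly $d$" (the empty complex having dimension $-1$) and when it means "of dimension at most $d$". -/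

import Mathlib

open Set Metric Topology
open scoped Pointwise

universe u

/-! ### Families of subgroups -/

/-- A family of subgroups of `G`: a set of subgroups closed under conjugation and under passing
to subgroups. -/
structure SubgroupFamily (G : Type u) [Group G] where
  carrier : Set (Subgroup G)
  conj_mem : ∀ H ∈ carrier, ∀ g : G, MulAut.conj g • H ∈ carrier
  le_mem : ∀ H ∈ carrier, ∀ K : Subgroup G, K ≤ H → K ∈ carrier

namespace SubgroupFamily

variable {G : Type u} [Group G]

instance : Membership (Subgroup G) (SubgroupFamily G) := ⟨fun F H => H ∈ F.carrier⟩

instance : LE (SubgroupFamily G) := ⟨fun F F' => ∀ H : Subgroup G, H ∈ F → H ∈ F'⟩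

theorem conj_mem_iff (F : SubgroupFamily G) (g : G) (H : Subgroup G) :
    MulAut.conj g • H ∈ F ↔ H ∈ F := by
  refine ⟨fun h => ?_, fun h => F.conj_mem H h g⟩
  have h' := F.conj_mem _ h g⁻¹
  rwa [smul_smul, ← map_mul, inv_mul_cancel, map_one, one_smul] at h'

end SubgroupFamily

section Subgroups

variable {G : Type u} [Group G]

theorem map_subtype_conj (N : Subgroup G) (n : N) (K : Subgroup N) :
    (MulAut.conj n • K).map N.subtype = MulAut.conj (n : G) • K.map N.subtype := by
  ext x
  simp only [Subgroup.mem_map, Subgroup.mem_smul_pointwise_iff_exists]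
  constructor
  · rintro ⟨_, ⟨k, hk, rfl⟩, rfl⟩
    exact ⟨k, ⟨k, hk, rfl⟩, by simp⟩
  · rintro ⟨_, ⟨k, hk, rfl⟩, rfl⟩
    exact ⟨_, ⟨k, hk, rfl⟩, by simp⟩

end Subgroups

namespace SubgroupFamily

variable {G : Type u} [Group G]

/-- `F ∩ N`: the family of those subgroups of `N` that belong to `F`. -/
def inter (F : SubgroupFamily G) (N : Subgroup G) : SubgroupFamily N where
  carrier := {K | K.map N.subtype ∈ F}
  conj_mem K hK n := by
    simp only [mem_ofPred_eq, map_subtype_conj] at hK ⊢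
    exact (F.conj_mem_iff _ _).2 hK
  le_mem _ hK _ hL := F.le_mem _ hK _ (Subgroup.map_mono hL)

/-- The set `𝒢 ∖ F`. -/
def Diff (𝒢 F : SubgroupFamily G) : Type u := {H : Subgroup G // H ∈ 𝒢 ∧ H ∉ F}

/-- `G` acts on `𝒢 ∖ F` by conjugation, `g • H = g H g⁻¹`. -/
instance (𝒢 F : SubgroupFamily G) : MulAction G (Diff 𝒢 F) where
  smul g H := ⟨MulAut.conj g • H.1, (𝒢.conj_mem_iff g _).2 H.2.1,
    fun h => H.2.2 ((F.conj_mem_iff g _).1 h)⟩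
  one_smul H := Subtype.ext (by
    change MulAut.conj (1 : G) • H.1 = H.1
    rw [map_one, one_smul])
  mul_smul g h H := Subtype.ext (by
    change MulAut.conj (g * h) • H.1 = MulAut.conj g • MulAut.conj h • H.1
    rw [map_mul, mul_smul])

end SubgroupFamily

open SubgroupFamily

/-- An equivalence relation on `𝒢 ∖ F` which is compatible with inclusions and conjugation. -/
structure CompatibleRel {G : Type u} [Group G] (F 𝒢 : SubgroupFamily G) extends
    Setoid (Diff 𝒢 F) where
  rel_of_le : ∀ H K : Diff 𝒢 F, H.1 ≤ K.1 → r H K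
  rel_conj_iff : ∀ (g : G) (H K : Diff 𝒢 F), r H K ↔ r (g • H) (g • K)

namespace CompatibleRel

variable {G : Type u} [Group G] {F 𝒢 : SubgroupFamily G}

/-- The subgroup `N_G[H] = {g | [g⁻¹ H g] = [H]}`. -/
def normalizer (E : CompatibleRel F 𝒢) (H : Diff 𝒢 F) : Subgroup G where
  carrier := {g | E.r (g⁻¹ • H) H}
  one_mem' := by
    change E.r ((1 : G)⁻¹ • H) H
    rw [inv_one, one_smul]
  mul_mem' {a b} ha hb := by
    change E.r ((a * b)⁻¹ • H) H
    rw [mul_inv_rev, mul_smul]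
    exact E.iseqv.trans ((E.rel_conj_iff b⁻¹ _ _).1 ha) hb
  inv_mem' {a} ha := by
    change E.r (a⁻¹⁻¹ • H) H
    have h := (E.rel_conj_iff a _ _).1 ha
    rw [smul_inv_smul] at h
    rw [inv_inv]; exact E.iseqv.symm h

/-- The family `𝒢[H] = {K ⊆ N_G[H] | K ∈ 𝒢 ∖ F, [K] = [H]} ∪ (F ∩ N_G[H])` of subgroups
of `N_G[H]`. -/
def family (E : CompatibleRel F 𝒢) (H : Diff 𝒢 F) : SubgroupFamily (E.normalizer H) where
  carrier := {K | ∃ K' : Diff 𝒢 F, K'.1 = K.map (E.normalizer H).subtype ∧ E.r K' H} ∪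
    {K | K ∈ F.inter (E.normalizer H)}
  conj_mem := by
    rintro K (⟨K', hK, hr⟩ | hK) n
    · refine Or.inl ⟨(n : G) • K', ?_, ?_⟩
      · rw [map_subtype_conj, ← hK]; rfl
      · have hn : E.r ((n : G)⁻¹ • H) H := n.2
        have h := (E.rel_conj_iff (n : G) _ _).1 hn
        rw [smul_inv_smul] at h
        exact E.iseqv.trans ((E.rel_conj_iff (n : G) _ _).1 hr) (E.iseqv.symm h)
    · exact Or.inr ((F.inter _).conj_mem K hK n)
  le_mem := by
    rintro K (⟨K', hK, hr⟩ | hK) L hL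
    · by_cases hF : L.map (E.normalizer H).subtype ∈ F
      · exact Or.inr hF
      · have hle : L.map (E.normalizer H).subtype ≤ K'.1 := hK ▸ Subgroup.map_mono hL
        have hG : L.map (E.normalizer H).subtype ∈ 𝒢 := 𝒢.le_mem _ K'.2.1 _ hle
        exact Or.inl ⟨⟨_, hG, hF⟩, rfl, E.iseqv.trans (E.rel_of_le _ _ hle) hr⟩
    · exact Or.inr ((F.inter _).le_mem K hK L hL)

/-- `I` is a complete system of representatives of the `G`-orbits in the set of equivalence
classes `[𝒢 ∖ F]`, each class being given by one of its members. -/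
def IsCompleteSystem (E : CompatibleRel F 𝒢) (I : Set (Diff 𝒢 F)) : Prop :=
  ∀ K : Diff 𝒢 F, ∃! H : Diff 𝒢 F, H ∈ I ∧ ∃ g : G, E.r (g • K) H

end CompatibleRel

/-! ### `G`-CW-complexes (for a discrete group `G`) -/

/-- A `G`-CW-structure on the `G`-space `X`, given by equivariant cells `G/H × Dⁿ → X`.
As in Mathlib's `CWComplex`, the disk `Dⁿ` is the closed unit ball of `Fin n → ℝ`. The equivariant
cell `j` with isotropy group `H = stab n j` is given by the restriction `map n j` of its
characteristic map to `{H} × Dⁿ`; the characteristic map is `(gH, y) ↦ g • map n j y`. -/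
structure GCWComplex (G : Type u) [Group G] (X : Type u) [TopologicalSpace X] [MulAction G X]
    [ContinuousConstSMul G X] where
  t2 : T2Space X
  /-- The index type of the equivariant `n`-cells. -/
  cell : ℕ → Type u
  stab : ∀ n, cell n → Subgroup G
  map : ∀ n, cell n → (Fin n → ℝ) → X
  continuousOn : ∀ n j, ContinuousOn (map n j) (closedBall 0 1)
  smul_map : ∀ n j, ∀ h ∈ stab n j, ∀ y ∈ closedBall (0 : Fin n → ℝ) 1, h • map n j y = map n j y
  /-- The open cells cover `X`. -/
  cover : ∀ x : X, ∃ n j, ∃ g : G, ∃ y ∈ ball (0 : Fin n → ℝ) 1, g • map n j y = x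
  /-- Distinct equivariant open cells are disjoint. -/
  disjoint : ∀ n j m k (g : G), ∀ y ∈ ball (0 : Fin n → ℝ) 1, ∀ z ∈ ball (0 : Fin m → ℝ) 1,
    g • map n j y = map m k z → (⟨n, j⟩ : Σ n, cell n) = ⟨m, k⟩
  /-- The characteristic map is injective on `G/H × int Dⁿ`. -/
  inj : ∀ n j (g : G), ∀ y ∈ ball (0 : Fin n → ℝ) 1, ∀ z ∈ ball (0 : Fin n → ℝ) 1,
    g • map n j y = map n j z → g ∈ stab n j ∧ y = z
  /-- The boundary of an `n`-cell lies in a finite union of closed cells of lower dimension. -/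
  frontier : ∀ n j, ∃ s : Finset (G × Σ m, cell m), (∀ c ∈ s, c.2.1 < n) ∧
    ∀ y ∈ sphere (0 : Fin n → ℝ) 1, ∃ c ∈ s, ∃ z ∈ closedBall (0 : Fin c.2.1 → ℝ) 1,
      map n j y = c.1 • map c.2.1 c.2.2 z
  /-- `X` has the weak topology. -/
  weak : ∀ A : Set X,
    (∀ n j (g : G), IsClosed {y | y ∈ closedBall (0 : Fin n → ℝ) 1 ∧ g • map n j y ∈ A}) →
      IsClosed A

namespace GCWComplex

variable {G : Type u} [Group G] {X : Type u} [TopologicalSpace X] [MulAction G X]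
  [ContinuousConstSMul G X] {Y : Type u} [TopologicalSpace Y] [MulAction G Y]
  [ContinuousConstSMul G Y]

/-- The equivariant open cell with index `j`, the image of `G/H × int Dⁿ`. -/
def openCell (S : GCWComplex G X) (n : ℕ) (j : S.cell n) : Set X :=
  {x | ∃ g : G, ∃ y ∈ ball (0 : Fin n → ℝ) 1, g • S.map n j y = x}

/-- The `n`-skeleton. -/
def skeleton (S : GCWComplex G X) (n : ℕ) : Set X :=
  {x | ∃ m ≤ n, ∃ j : S.cell m, x ∈ S.openCell m j}

/-- Cellular `G`-maps. -/
structure IsCellular (S : GCWComplex G X) (T : GCWComplex G Y) (f : X →[G] Y) : Prop where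
  continuous : Continuous f
  mapsTo : ∀ n, MapsTo f (S.skeleton n) (T.skeleton n)

/-- Inclusions of `G`-CW-complexes: `f` identifies `X` with a subcomplex of `Y`, i.e. it is a
closed embedding that carries every equivariant open `n`-cell onto an equivariant open `n`-cell. -/
structure IsInclusion (S : GCWComplex G X) (T : GCWComplex G Y) (f : X →[G] Y) : Prop where
  isClosedEmbedding : IsClosedEmbedding f
  image_openCell : ∀ n (j : S.cell n), ∃ k : T.cell n, f '' S.openCell n j = T.openCell n k

/-- There are no cells of dimension greater than `n`. -/
def DimLE (S : GCWComplex G X) (n : ℤ) : Prop := ∀ k : ℕ, n < k → IsEmpty (S.cell k)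

/-- The dimension is exactly `n`; the empty complex has dimension `-1`. -/
def DimEq (S : GCWComplex G X) (n : ℤ) : Prop := IsLeast {d : ℤ | -1 ≤ d ∧ S.DimLE d} n

end GCWComplex

/-! ### Classifying spaces of families -/

/-- Two `G`-maps are `G`-homotopic. -/
def GHomotopic {G : Type u} [Group G] {X Y : Type u} [TopologicalSpace X] [MulAction G X]
    [TopologicalSpace Y] [MulAction G Y] (f₀ f₁ : X →[G] Y) : Prop :=
  ∃ h : unitInterval → (X →[G] Y),
    Continuous (fun p : unitInterval × X => h p.1 p.2) ∧ h 0 = f₀ ∧ h 1 = f₁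

/-- The `G`-CW-complex `X` is a model for the classifying space `E_F(G)`: its isotropy groups
belong to `F`, and every `G`-CW-complex with isotropy groups in `F` admits precisely one `G`-map
to `X` up to `G`-homotopy. -/
structure GCWComplex.IsModel {G : Type u} [Group G] {X : Type u} [TopologicalSpace X]
    [MulAction G X] [ContinuousConstSMul G X] (_S : GCWComplex G X) (F : SubgroupFamily G) :
    Prop where
  isotropy : ∀ x : X, MulAction.stabilizer G x ∈ F
  exists_map : ∀ (Y : Type u) [TopologicalSpace Y] [MulAction G Y] [ContinuousConstSMul G Y]
    (_T : GCWComplex G Y), (∀ y : Y, MulAction.stabilizer G y ∈ F) →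
      ∃ f : Y →[G] X, Continuous f
  homotopic : ∀ (Y : Type u) [TopologicalSpace Y] [MulAction G Y] [ContinuousConstSMul G Y]
    (_T : GCWComplex G Y), (∀ y : Y, MulAction.stabilizer G y ∈ F) →
      ∀ f₀ f₁ : Y →[G] X, Continuous f₀ → Continuous f₁ → GHomotopic f₀ f₁

/-- There is a model for `E_F(G)` of dimension at most `n`. -/
def HasModelDimLE {G : Type u} [Group G] (F : SubgroupFamily G) (n : ℤ) : Prop :=
  ∃ (X : Type u) (_ : TopologicalSpace X) (_ : MulAction G X) (_ : ContinuousConstSMul G X)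
    (S : GCWComplex G X), S.IsModel F ∧ S.DimLE n

/-- There is a model for `E_F(G)` of dimension exactly `n`. -/
def HasModelDimEq {G : Type u} [Group G] (F : SubgroupFamily G) (n : ℤ) : Prop :=
  ∃ (X : Type u) (_ : TopologicalSpace X) (_ : MulAction G X) (_ : ContinuousConstSMul G X)
    (S : GCWComplex G X), S.IsModel F ∧ S.DimEq n

/-! ### Pushouts of `G`-spaces -/

/-- The commutative square of `G`-spaces with `i : C → A`, `f : C → B`, `a : A → X`, `b : B → X`
is a pushout in the category of `G`-spaces and continuous `G`-maps. -/
structure IsGPushout {G : Type u} [Group G] {A B C X : Type u}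
    [TopologicalSpace A] [MulAction G A] [TopologicalSpace B] [MulAction G B]
    [TopologicalSpace C] [MulAction G C] [TopologicalSpace X] [MulAction G X]
    (i : C →[G] A) (f : C →[G] B) (a : A →[G] X) (b : B →[G] X) : Prop where
  continuous_left : Continuous a
  continuous_right : Continuous b
  comm : ∀ c, a (i c) = b (f c)
  universal : ∀ (Z : Type u) [TopologicalSpace Z] [MulAction G Z] [ContinuousConstSMul G Z]
    (p : A →[G] Z) (q : B →[G] Z), Continuous p → Continuous q → (∀ c, p (i c) = q (f c)) →
      ∃! h : X →[G] Z, Continuous h ∧ (∀ x, h (a x) = p x) ∧ ∀ y, h (b y) = q y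

/-! ### Coproducts of `G`-CW-complexes -/

section Sigma

variable {G : Type u} [Group G] {ι : Type u} {X Y : ι → Type u}
  [∀ i, TopologicalSpace (X i)] [∀ i, MulAction G (X i)] [∀ i, MulAction G (Y i)]

instance sigmaContinuousConstSMul [∀ i, ContinuousConstSMul G (X i)] :
    ContinuousConstSMul G (Σ i, X i) where
  continuous_const_smul g :=
    continuous_sigma fun _ => continuous_sigmaMk.comp (continuous_const_smul g)

/-- The coproduct of `G`-maps. -/
def sigmaMap (f : ∀ i, X i →[G] Y i) : (Σ i, X i) →[G] (Σ i, Y i) where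
  toFun p := ⟨p.1, f p.1 p.2⟩
  map_smul' g p := by
    obtain ⟨i, x⟩ := p
    exact congrArg (Sigma.mk i) ((f i).map_smul g x)

/-- The coproduct of `G`-CW-complexes. -/
def GCWComplex.sigma [∀ i, ContinuousConstSMul G (X i)] (S : ∀ i, GCWComplex G (X i)) :
    GCWComplex G (Σ i, X i) where
  t2 := by
    have := fun i => (S i).t2
    infer_instance
  cell n := Σ i, (S i).cell n
  stab n j := (S j.1).stab n j.2
  map n j y := ⟨j.1, (S j.1).map n j.2 y⟩
  continuousOn n j := continuous_sigmaMk.comp_continuousOn ((S j.1).continuousOn n j.2)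
  smul_map n j h hh y hy := by
    rw [Sigma.smul_mk, (S j.1).smul_map n j.2 h hh y hy]
  cover := by
    rintro ⟨i, x⟩
    obtain ⟨n, j, g, y, hy, rfl⟩ := (S i).cover x
    exact ⟨n, ⟨i, j⟩, g, y, hy, rfl⟩
  disjoint := by
    rintro n ⟨i, j⟩ m ⟨i', k⟩ g y hy z hz h
    obtain rfl : i = i' := congrArg Sigma.fst h
    have h' := (S i).disjoint n j m k g y hy z hz (eq_of_heq (Sigma.mk.inj h).2)
    cases h'
    rfl
  inj := by
    rintro n ⟨i, j⟩ g y hy z hz h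
    exact (S i).inj n j g y hy z hz (eq_of_heq (Sigma.mk.inj h).2)
  frontier := by
    classical
    rintro n ⟨i, j⟩
    obtain ⟨s, hs, h⟩ := (S i).frontier n j
    refine ⟨s.image fun c => (c.1, ⟨c.2.1, ⟨i, c.2.2⟩⟩), ?_, fun y hy => ?_⟩
    · intro c hc
      obtain ⟨d, hd, rfl⟩ := Finset.mem_image.1 hc
      exact hs d hd
    · obtain ⟨c, hc, z, hz, e⟩ := h y hy
      exact ⟨_, Finset.mem_image_of_mem _ hc, z, hz, congrArg (Sigma.mk i) e⟩
  weak A hA := by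
    rw [isClosed_sigma_iff]
    exact fun i => (S i).weak _ fun n j g => hA n ⟨i, j⟩ g

end Sigma

/-! ### Induction: the `G`-space `G ×_N X` for an `N`-space `X` -/

section Induced

variable {G : Type u} [Group G] (N : Subgroup G) (X : Type u) [MulAction N X]

/-- The equivalence relation on `G × X` (with `G` discrete, so that `G × X` is the disjoint union
of copies of `X` indexed by `G`) generated by `(g n, x) ∼ (g, n x)` for `n ∈ N`. -/
def inducedSetoid : Setoid (Σ _ : G, X) where
  r p q := ∃ n : N, p.1 = q.1 * n ∧ q.2 = n • p.2
  iseqv :=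
    { refl := fun p => ⟨1, by simp, by simp⟩
      symm := by
        rintro p q ⟨n, h₁, h₂⟩
        exact ⟨n⁻¹, by simp [h₁], by simp [h₂]⟩
      trans := by
        rintro p q r ⟨n, h₁, h₂⟩ ⟨m, h₃, h₄⟩
        exact ⟨m * n, by simp [h₁, h₃, mul_assoc], by simp [h₂, h₄, mul_smul]⟩ }

/-- The space `G ×_N X`. -/
def Induced : Type u := Quotient (inducedSetoid N X)

variable {X}

/-- The class of `(g, x)` in `G ×_N X`. -/
def Induced.mk (g : G) (x : X) : Induced N X := Quotient.mk (inducedSetoid N X) ⟨g, x⟩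

variable {N}

theorem Induced.mk_eq_iff {g g' : G} {x x' : X} :
    Induced.mk N g x = Induced.mk N g' x' ↔ ∃ n : N, g = g' * n ∧ x' = n • x :=
  Quotient.eq (r := inducedSetoid N X)

theorem Induced.exists_mk (p : Induced N X) : ∃ g x, Induced.mk N g x = p := by
  obtain ⟨⟨g, x⟩, rfl⟩ := Quotient.exists_rep p
  exact ⟨g, x, rfl⟩

instance : MulAction G (Induced N X) where
  smul g := Quotient.map' (s₁ := inducedSetoid N X) (s₂ := inducedSetoid N X)
    (fun p => ⟨g * p.1, p.2⟩) (by
      rintro p q ⟨n, h₁, h₂⟩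
      exact ⟨n, by simp [h₁, mul_assoc], h₂⟩)
  one_smul p := by
    obtain ⟨g, x, rfl⟩ := p.exists_mk
    change Induced.mk N (1 * g) x = _
    rw [one_mul]
  mul_smul a b p := by
    obtain ⟨g, x, rfl⟩ := p.exists_mk
    change Induced.mk N (a * b * g) x = Induced.mk N (a * (b * g)) x
    rw [mul_assoc]

theorem Induced.smul_mk (a g : G) (x : X) : a • Induced.mk N g x = Induced.mk N (a * g) x := rfl

/-- The `G`-map `id_G ×_N f`. -/
def Induced.map {Y : Type u} [MulAction N Y] (f : X →[N] Y) : Induced N X →[G] Induced N Y where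
  toFun := Quotient.map' (s₁ := inducedSetoid N X) (s₂ := inducedSetoid N Y)
    (fun p => ⟨p.1, f p.2⟩) (by
      rintro p q ⟨n, h₁, h₂⟩
      exact ⟨n, h₁, by simp [h₂]⟩)
  map_smul' g p := by
    obtain ⟨g, x, rfl⟩ := p.exists_mk
    rfl

variable [TopologicalSpace X]

instance : TopologicalSpace (Induced N X) :=
  inferInstanceAs (TopologicalSpace (Quotient (inducedSetoid N X)))

theorem Induced.isClosed_iff {A : Set (Induced N X)} :
    IsClosed A ↔ ∀ g : G, IsClosed {x | Induced.mk N g x ∈ A} := by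
  have hq : IsQuotientMap (fun p : Σ _ : G, X => Induced.mk N p.1 p.2) :=
    isQuotientMap_quotient_mk' (s := inducedSetoid N X)
  rw [← hq.isClosed_preimage, isClosed_sigma_iff]
  rfl

theorem Induced.isOpen_iff {A : Set (Induced N X)} :
    IsOpen A ↔ ∀ g : G, IsOpen {x | Induced.mk N g x ∈ A} := by
  have hq : IsQuotientMap (fun p : Σ _ : G, X => Induced.mk N p.1 p.2) :=
    isQuotientMap_quotient_mk' (s := inducedSetoid N X)
  rw [← hq.isOpen_preimage, isOpen_sigma_iff]
  rfl

theorem Induced.continuous_mk (g : G) : Continuous (Induced.mk N g : X → Induced N X) :=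
  continuous_def.2 fun _ hs => Induced.isOpen_iff.1 hs g

instance : ContinuousConstSMul G (Induced N X) where
  continuous_const_smul a := continuous_def.2 fun _ hs =>
    Induced.isOpen_iff.2 fun g => Induced.isOpen_iff.1 hs (a * g)

variable [ContinuousConstSMul N X]

theorem Induced.isOpen_image_mk (g : G) {U : Set X} (hU : IsOpen U) :
    IsOpen (Induced.mk N g '' U) := by
  rw [Induced.isOpen_iff]
  intro g'
  have h : {x | Induced.mk N g' x ∈ Induced.mk N g '' U} =
      ⋃ (n : N) (_ : g = g' * n), (fun x => n⁻¹ • x) ⁻¹' U := by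
    ext x
    simp only [mem_ofPred_eq, mem_image, Induced.mk_eq_iff, mem_iUnion, mem_preimage]
    constructor
    · rintro ⟨y, hy, n, h, rfl⟩
      exact ⟨n, h, by simpa using hy⟩
    · rintro ⟨n, h, hx⟩
      exact ⟨n⁻¹ • x, hx, n, h, by simp⟩
  rw [h]
  exact isOpen_iUnion fun n => isOpen_iUnion fun _ => hU.preimage (continuous_const_smul n⁻¹)

theorem Induced.t2Space [T2Space X] : T2Space (Induced N X) where
  t2 := by
    intro p q hpq
    obtain ⟨g, x, rfl⟩ := p.exists_mk
    obtain ⟨g', x', rfl⟩ := q.exists_mk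
    by_cases h : ∃ n : N, g = g' * n
    · obtain ⟨n, hn⟩ := h
      have e : Induced.mk N g x = Induced.mk N g' (n • x) := Induced.mk_eq_iff.2 ⟨n, hn, rfl⟩
      rw [e] at hpq ⊢
      obtain ⟨U, V, hU, hV, hxU, hxV, hUV⟩ :=
        t2_separation (fun h => hpq (congrArg _ h) : n • x ≠ x')
      refine ⟨_, _, Induced.isOpen_image_mk g' hU, Induced.isOpen_image_mk g' hV,
        mem_image_of_mem _ hxU, mem_image_of_mem _ hxV, ?_⟩
      rw [Set.disjoint_left]
      rintro _ ⟨y, hy, rfl⟩ ⟨z, hz, hzy⟩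
      obtain ⟨m, hm, rfl⟩ := Induced.mk_eq_iff.1 hzy
      have hm1 : m = 1 := by simpa using hm
      subst hm1
      rw [one_smul] at hy
      exact Set.disjoint_left.1 hUV hy hz
    · refine ⟨_, _, Induced.isOpen_image_mk g isOpen_univ, Induced.isOpen_image_mk g' isOpen_univ,
        mem_image_of_mem _ (mem_univ x), mem_image_of_mem _ (mem_univ x'), ?_⟩
      rw [Set.disjoint_left]
      rintro _ ⟨y, -, rfl⟩ ⟨z, -, hzy⟩
      obtain ⟨m, hm, -⟩ := Induced.mk_eq_iff.1 hzy.symm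
      exact h ⟨m, hm⟩

/-- The `G`-CW-complex `G ×_N X` for an `N`-CW-complex `X`: a cell `N/L × Dⁿ` of `X` gives the
cell `G/L × Dⁿ`. -/
def GCWComplex.induced (S : GCWComplex N X) : GCWComplex G (Induced N X) where
  t2 := by
    have := S.t2
    exact Induced.t2Space
  cell := S.cell
  stab n j := (S.stab n j).map N.subtype
  map n j y := Induced.mk N 1 (S.map n j y)
  continuousOn n j := (Induced.continuous_mk 1).comp_continuousOn (S.continuousOn n j)
  smul_map := by
    rintro n j _ ⟨h, hh, rfl⟩ y hy
    rw [Induced.smul_mk, Induced.mk_eq_iff]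
    exact ⟨h, by simp, (S.smul_map n j h hh y hy).symm⟩
  cover p := by
    obtain ⟨g, x, rfl⟩ := p.exists_mk
    obtain ⟨n, j, m, y, hy, rfl⟩ := S.cover x
    refine ⟨n, j, g * m, y, hy, ?_⟩
    rw [Induced.smul_mk, Induced.mk_eq_iff]
    exact ⟨m, by simp, rfl⟩
  disjoint n j m k g y hy z hz h := by
    rw [Induced.smul_mk, Induced.mk_eq_iff] at h
    obtain ⟨a, -, ha⟩ := h
    exact S.disjoint n j m k a y hy z hz ha.symm
  inj n j g y hy z hz h := by
    rw [Induced.smul_mk, Induced.mk_eq_iff] at h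
    obtain ⟨a, hg, ha⟩ := h
    obtain ⟨h₁, h₂⟩ := S.inj n j a y hy z hz ha.symm
    exact ⟨⟨a, h₁, by simpa using hg.symm⟩, h₂⟩
  frontier n j := by
    classical
    obtain ⟨s, hs, h⟩ := S.frontier n j
    refine ⟨s.image fun c => ((c.1 : G), c.2), ?_, fun y hy => ?_⟩
    · intro c hc
      obtain ⟨d, hd, rfl⟩ := Finset.mem_image.1 hc
      exact hs d hd
    · obtain ⟨c, hc, z, hz, e⟩ := h y hy
      refine ⟨_, Finset.mem_image_of_mem _ hc, z, hz, ?_⟩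
      rw [Induced.smul_mk, eq_comm, Induced.mk_eq_iff]
      exact ⟨c.1, by simp, e⟩
  weak A hA := by
    rw [Induced.isClosed_iff]
    refine fun g => S.weak _ fun n j a => ?_
    have h := hA n j (g * a)
    have e : ∀ y, (g * a) • Induced.mk N 1 (S.map n j y) = Induced.mk N g (a • S.map n j y) := by
      intro y
      rw [Induced.smul_mk, Induced.mk_eq_iff]
      exact ⟨a, by simp, rfl⟩
    simp only [e] at h
    exact h

end Induced

/-! Fixed point sets carry the argument. Testing the universal property of a model `Z` for `E_F(G)`
against `G/K × Sⁿ⁻¹` with `K ∈ F` shows that `Z^K` is nonempty and that every map from a sphere to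
`Z^K` extends over the disk (`IsModel.diskExt`). Conversely, this property of `Z^K` is what is
needed to extend equivariant maps and homotopies over cells with isotropy group `K`. All such
extensions go through `exists_equivariant_map`, a Zorn argument over invariant subcomplexes with a
pointwise condition on the map; homotopies are maps to a path space `C(I, Z)`, with their endpoints
as the condition.

Suppose first that the `f_H : C_H → B_H` are inclusions. The fixed sets of `C_H` and `B_H` for
groups in `F ∩ N_G[H]` have the disk extension property, so for each `K ∈ F` the space `∐ G ×_N C_H`
is a `K`-equivariant strong deformation retract of `∐ G ×_N B_H` (`exists_strong_deformation`). The
deformation descends to the pushout `X` and retracts it onto `A`; hence `X^K` has the disk extension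
property for `K ∈ F` (`IsGPushout.diskExt_fixedSet`). Let `Y` have isotropy in `𝒢`. Isotropy groups
only grow from an open cell to its boundary, so the points with isotropy outside `F` form a
subcomplex. Since `∼` contains inclusions and is invariant under conjugation, this subcomplex splits
into the translates of pieces `Y_H`, `H ∈ I`, consisting of the points with isotropy equivalent to
`H`, and `Y_H` is an `N_G[H]`-CW-complex with isotropy in `𝒢[H]`. The universal property of `B_H`
gives maps `Y_H → B_H → X`, and the cells with isotropy in `F` are filled in using `X^K`. For
uniqueness, any `G`-map `Y → X` carries `Y_H` into the part of `B_H` with isotropy outside `F`,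
which is disjoint from `C_H` and embedded as a closed subset of `X`. So two maps lift to `B_H`, are
homotopic there, and the homotopy extends over the other cells (`IsGPushout.isModel`).

If instead `i` is an inclusion, each `B_H` is replaced by the mapping cylinder of `f_H`, again a
model, which contains `C_H` as a subcomplex. The new pushout is a model by the first case. By
homotopy extension along `i` it dominates `X`, and a `G`-CW-complex dominated by a model is a model
(`IsGPushout.isModel_of_cylinder`).

The CW-structure on the pushout of an inclusion `P ← C` and a cellular map `C → Q` has the cells of
`Q` together with the cells of `P` outside the image of `C` (`IsGPushout.gcw`). For the dimension
statement the maps `f_H` and `i` are chosen cellular, by cellular approximation inside fixed point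
sets (`IsModel.exists_isCellular`), and the pushout is formed with mapping cylinders; these have
dimension at most `n` because `C_H` has dimension at most `n - 1`. -/

namespace GCWComplex

/-! ### Closed cells, subcomplexes, skeleta and compact sets -/

variable {G : Type u} [Group G] {X : Type u} [TopologicalSpace X] [MulAction G X]
  [ContinuousConstSMul G X]

/-- A set that contains, with any point of a (non-equivariant) open cell, the whole closed cell. -/
def IsSubcomplex (S : GCWComplex G X) (D : Set X) : Prop :=
  ∀ n (j : S.cell n) (g : G), ∀ y ∈ ball (0 : Fin n → ℝ) 1, g • S.map n j y ∈ D →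
    ∀ z ∈ closedBall (0 : Fin n → ℝ) 1, g • S.map n j z ∈ D

variable (S : GCWComplex G X)

theorem continuousOn_smul_map (n : ℕ) (j : S.cell n) (g : G) :
    ContinuousOn (fun y => g • S.map n j y) (closedBall 0 1) :=
  (S.continuousOn n j).const_smul g

/-- Induction on the dimension: each of the finitely many closed cells that cover the boundary is in
turn covered by finitely many open cells. Open cells are disjoint, so they locate a point where
closed cells do not. -/
theorem exists_finset_closedCell (n : ℕ) (j : S.cell n) :
    ∃ t : Finset (G × Σ m, S.cell m), (∀ c ∈ t, c.2.1 ≤ n) ∧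
      ∀ y ∈ closedBall (0 : Fin n → ℝ) 1, ∃ c ∈ t, ∃ z ∈ ball (0 : Fin c.2.1 → ℝ) 1,
        S.map n j y = c.1 • S.map c.2.1 c.2.2 z := by
  classical
  induction n using Nat.strong_induction_on with
  | _ n ih =>
    obtain ⟨s, hs, h⟩ := S.frontier n j
    have ih' : ∀ c : G × Σ m, S.cell m, c ∈ s → ∃ t : Finset (G × Σ m, S.cell m),
        (∀ d ∈ t, d.2.1 ≤ c.2.1) ∧
        ∀ y ∈ closedBall (0 : Fin c.2.1 → ℝ) 1, ∃ d ∈ t, ∃ z ∈ ball (0 : Fin d.2.1 → ℝ) 1,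
          S.map c.2.1 c.2.2 y = d.1 • S.map d.2.1 d.2.2 z :=
      fun c hc => ih c.2.1 (hs c hc) c.2.2
    choose! t ht ht' using ih'
    refine ⟨insert (1, ⟨n, j⟩) (s.biUnion fun c => (t c).image fun d => (c.1 * d.1, d.2)), ?_, ?_⟩
    · intro c hc
      rcases Finset.mem_insert.1 hc with rfl | hc
      · exact le_rfl
      · obtain ⟨c', hc', hc⟩ := Finset.mem_biUnion.1 hc
        obtain ⟨d, hd, rfl⟩ := Finset.mem_image.1 hc
        exact (ht c' hc' d hd).trans (hs c' hc').le
    · intro y hy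
      by_cases hb : y ∈ ball (0 : Fin n → ℝ) 1
      · exact ⟨_, Finset.mem_insert_self _ _, y, hb, (one_smul _ _).symm⟩
      · have hy' : y ∈ sphere (0 : Fin n → ℝ) 1 := by
          simp only [mem_closedBall, mem_ball, mem_sphere] at *
          linarith
        obtain ⟨c, hc, z, hz, e⟩ := h y hy'
        obtain ⟨d, hd, w, hw, e'⟩ := ht' c hc z hz
        exact ⟨(c.1 * d.1, d.2), Finset.mem_insert_of_mem (Finset.mem_biUnion.2
          ⟨c, hc, Finset.mem_image_of_mem _ hd⟩), w, hw, by rw [e, e', mul_smul]⟩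

theorem isCompact_image_cell (n : ℕ) (j : S.cell n) (g : G) {K : Set (Fin n → ℝ)}
    (hK : IsClosed K) (hK' : K ⊆ closedBall 0 1) :
    IsCompact ((fun y => g • S.map n j y) '' K) :=
  ((isCompact_closedBall _ _).of_isClosed_subset hK hK').image_of_continuousOn
    ((S.continuousOn_smul_map n j g).mono hK')

theorem isClosed_image_cell (n : ℕ) (j : S.cell n) (g : G) {K : Set (Fin n → ℝ)}
    (hK : IsClosed K) (hK' : K ⊆ closedBall 0 1) :
    IsClosed ((fun y => g • S.map n j y) '' K) := by
  have := S.t2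
  exact (S.isCompact_image_cell n j g hK hK').isClosed

theorem isClosed_preimage_cell (n : ℕ) (j : S.cell n) (g : G) {A : Set X} (hA : IsClosed A) :
    IsClosed {y | y ∈ closedBall (0 : Fin n → ℝ) 1 ∧ g • S.map n j y ∈ A} :=
  (S.continuousOn_smul_map n j g).preimage_isClosed_of_isClosed isClosed_closedBall hA

variable {S}

/-- The weak topology of a subcomplex. -/
theorem IsSubcomplex.isClosed_of_subset {D : Set X} (hD : S.IsSubcomplex D) {A : Set X}
    (hAD : A ⊆ D)
    (h : ∀ n (j : S.cell n) (g : G), (∀ y ∈ closedBall (0 : Fin n → ℝ) 1, g • S.map n j y ∈ D) →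
      IsClosed {y | y ∈ closedBall (0 : Fin n → ℝ) 1 ∧ g • S.map n j y ∈ A}) : IsClosed A := by
  refine S.weak A fun n j g => ?_
  obtain ⟨t, -, ht⟩ := S.exists_finset_closedCell n j
  -- `P c` is the trace of `A` on the translated closed cell `c` if this cell lies in `D`, and empty
  -- otherwise. It is closed by hypothesis, and finitely many of the `P c` account for the trace of
  -- `A` on the given cell.
  let P : G × (Σ m, S.cell m) → Set X := fun c =>
    {x | (∀ y ∈ closedBall (0 : Fin c.2.1 → ℝ) 1, (g * c.1) • S.map c.2.1 c.2.2 y ∈ D) ∧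
      x ∈ (fun z => (g * c.1) • S.map c.2.1 c.2.2 z) ''
        {z | z ∈ closedBall (0 : Fin c.2.1 → ℝ) 1 ∧ (g * c.1) • S.map c.2.1 c.2.2 z ∈ A}}
  have hP : ∀ c, IsClosed (P c) := by
    intro c
    by_cases hc : ∀ y ∈ closedBall (0 : Fin c.2.1 → ℝ) 1, (g * c.1) • S.map c.2.1 c.2.2 y ∈ D
    · have := S.isClosed_image_cell c.2.1 c.2.2 (g * c.1) (h _ _ _ hc) fun z hz => hz.1
      convert this using 1
      ext x
      exact and_iff_right hc
    · have : P c = ∅ := by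
        ext x
        simp only [mem_empty_iff_false, iff_false]
        exact fun hx => hc hx.1
      rw [this]
      exact isClosed_empty
  have hU : IsClosed (⋃ c ∈ t, P c) := t.finite_toSet.isClosed_biUnion fun c _ => hP c
  convert S.isClosed_preimage_cell n j g hU using 1
  ext y
  simp only [mem_ofPred_eq, mem_iUnion]
  refine and_congr_right fun hy => ⟨fun hA => ?_, ?_⟩
  · obtain ⟨c, hc, z, hz, e⟩ := ht y hy
    have e' : g • S.map n j y = (g * c.1) • S.map c.2.1 c.2.2 z := by rw [e, mul_smul]
    refine ⟨c, hc, hD _ _ _ z hz (e' ▸ hAD hA), z, ⟨ball_subset_closedBall hz, e' ▸ hA⟩, e'.symm⟩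
  · rintro ⟨c, -, -, z, ⟨-, hz⟩, e⟩
    exact e ▸ hz

theorem IsSubcomplex.isClosed {D : Set X} (hD : S.IsSubcomplex D) : IsClosed D := by
  refine hD.isClosed_of_subset subset_rfl fun n j g h => ?_
  have e : {y | y ∈ closedBall (0 : Fin n → ℝ) 1 ∧ g • S.map n j y ∈ D} = closedBall 0 1 := by
    ext y
    exact and_iff_left_of_imp (h y)
  rw [e]
  exact isClosed_closedBall

/-- Follows from the weak topology of a subcomplex applied to preimages of closed sets: only the
cells contained in `D` need testing. -/
theorem IsSubcomplex.continuousOn {D : Set X} (hD : S.IsSubcomplex D) {W : Type*}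
    [TopologicalSpace W] {f : X → W}
    (h : ∀ n (j : S.cell n) (g : G), (∀ y ∈ closedBall (0 : Fin n → ℝ) 1, g • S.map n j y ∈ D) →
      ContinuousOn (fun y => f (g • S.map n j y)) (closedBall 0 1)) : ContinuousOn f D := by
  rw [continuousOn_iff_isClosed]
  intro t ht
  refine ⟨f ⁻¹' t ∩ D, ?_, by rw [inter_assoc, inter_self]⟩
  refine hD.isClosed_of_subset inter_subset_right fun n j g hc => ?_
  convert (h n j g hc).preimage_isClosed_of_isClosed isClosed_closedBall ht using 1
  ext y
  simp only [mem_ofPred_eq, mem_inter_iff, mem_preimage]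
  exact and_congr_right fun hy => and_iff_left (hc y hy)

theorem isSubcomplex_univ : S.IsSubcomplex univ := fun _ _ _ _ _ _ _ _ => mem_univ _

variable (S) in
theorem continuous_of_cells {W : Type*} [TopologicalSpace W] {f : X → W}
    (h : ∀ n (j : S.cell n) (g : G), ContinuousOn (fun y => f (g • S.map n j y)) (closedBall 0 1)) :
    Continuous f :=
  continuousOn_univ.1 (isSubcomplex_univ.continuousOn fun n j g _ => h n j g)

theorem mem_skeleton_closedCell (n : ℕ) (j : S.cell n) (g : G) {y : Fin n → ℝ}
    (hy : y ∈ closedBall (0 : Fin n → ℝ) 1) : g • S.map n j y ∈ S.skeleton n := by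
  obtain ⟨t, ht, h⟩ := S.exists_finset_closedCell n j
  obtain ⟨c, hc, z, hz, e⟩ := h y hy
  exact ⟨c.2.1, ht c hc, c.2.2, g * c.1, z, hz, by rw [e, mul_smul]⟩

theorem mem_skeleton_sphere (n : ℕ) (j : S.cell n) (g : G) {y : Fin n → ℝ}
    (hy : y ∈ sphere (0 : Fin n → ℝ) 1) : ∃ m < n, g • S.map n j y ∈ S.skeleton m := by
  obtain ⟨s, hs, h⟩ := S.frontier n j
  obtain ⟨c, hc, z, hz, e⟩ := h y hy
  refine ⟨c.2.1, hs c hc, ?_⟩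
  rw [e, ← mul_smul]
  exact mem_skeleton_closedCell _ _ _ hz

theorem skeleton_mono {m n : ℕ} (h : m ≤ n) : S.skeleton m ⊆ S.skeleton n := by
  rintro x ⟨k, hk, j, hx⟩
  exact ⟨k, hk.trans h, j, hx⟩

theorem smul_mem_openCell {n : ℕ} {j : S.cell n} (g : G) {x : X} (hx : x ∈ S.openCell n j) :
    g • x ∈ S.openCell n j := by
  obtain ⟨a, y, hy, rfl⟩ := hx
  exact ⟨g * a, y, hy, mul_smul _ _ _⟩

theorem smul_mem_skeleton {n : ℕ} (g : G) {x : X} (hx : x ∈ S.skeleton n) :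
    g • x ∈ S.skeleton n := by
  obtain ⟨m, hm, j, hx⟩ := hx
  exact ⟨m, hm, j, smul_mem_openCell g hx⟩

theorem openCell_eq_of_mem {n m : ℕ} {j : S.cell n} {k : S.cell m} {x : X}
    (hx : x ∈ S.openCell n j) (hx' : x ∈ S.openCell m k) :
    (⟨n, j⟩ : Σ n, S.cell n) = ⟨m, k⟩ := by
  obtain ⟨g, y, hy, rfl⟩ := hx
  obtain ⟨g', y', hy', e⟩ := hx'
  refine S.disjoint n j m k (g'⁻¹ * g) y hy y' hy' ?_
  rw [mul_smul, ← e, inv_smul_smul]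

theorem mem_openCell_smul_map {n : ℕ} {j : S.cell n} (g : G) {y : Fin n → ℝ}
    (hy : y ∈ ball (0 : Fin n → ℝ) 1) : g • S.map n j y ∈ S.openCell n j := ⟨g, y, hy, rfl⟩

theorem smul_map_mem_skeleton_iff {n k : ℕ} {j : S.cell n} {g : G} {y : Fin n → ℝ}
    (hy : y ∈ ball (0 : Fin n → ℝ) 1) : g • S.map n j y ∈ S.skeleton k ↔ n ≤ k := by
  refine ⟨fun ⟨m, hm, l, hx⟩ => ?_, fun h => ⟨n, h, j, mem_openCell_smul_map g hy⟩⟩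
  have h := openCell_eq_of_mem (mem_openCell_smul_map g hy) hx
  cases h
  exact hm

theorem isSubcomplex_skeleton (k : ℕ) : S.IsSubcomplex (S.skeleton k) := fun n j g _ hy h _ hz =>
  skeleton_mono ((smul_map_mem_skeleton_iff hy).1 h) (mem_skeleton_closedCell n j g hz)

theorem exists_mem_openCell (x : X) : ∃ n, ∃ j : S.cell n, x ∈ S.openCell n j := by
  obtain ⟨n, j, g, y, hy, rfl⟩ := S.cover x
  exact ⟨n, j, g, y, hy, rfl⟩

theorem smul_map_eq_iff {n : ℕ} {j : S.cell n} {g g' : G} {y y' : Fin n → ℝ}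
    (hy : y ∈ ball (0 : Fin n → ℝ) 1) (hy' : y' ∈ ball (0 : Fin n → ℝ) 1) :
    g • S.map n j y = g' • S.map n j y' ↔ g'⁻¹ * g ∈ S.stab n j ∧ y = y' := by
  constructor
  · intro h
    refine S.inj n j _ y hy y' hy' ?_
    rw [mul_smul, h, inv_smul_smul]
  · rintro ⟨h, rfl⟩
    have := S.smul_map n j _ h y (ball_subset_closedBall hy)
    rw [mul_smul, inv_smul_eq_iff] at this
    exact this

theorem zero_mem_unitBall {n : ℕ} : (0 : Fin n → ℝ) ∈ ball (0 : Fin n → ℝ) 1 := by simp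

theorem stabilizer_map {n : ℕ} (j : S.cell n) {y : Fin n → ℝ}
    (hy : y ∈ ball (0 : Fin n → ℝ) 1) : MulAction.stabilizer G (S.map n j y) = S.stab n j := by
  ext g
  rw [MulAction.mem_stabilizer_iff]
  exact ⟨fun h => (S.inj n j g y hy y hy h).1,
    fun h => S.smul_map n j g h y (ball_subset_closedBall hy)⟩

/-- An element that fixes an interior point of a cell lies in the isotropy group of that cell, which
fixes the closed cell pointwise. Hence isotropy can only grow towards the boundary. This produces
the subcomplexes of points with isotropy outside a family, and it keeps fixed sets invariant when
cells are pushed to their boundary. -/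
theorem stabilizer_smul_map_le {n : ℕ} (j : S.cell n) (g : G) {y z : Fin n → ℝ}
    (hy : y ∈ ball (0 : Fin n → ℝ) 1) (hz : z ∈ closedBall (0 : Fin n → ℝ) 1) :
    MulAction.stabilizer G (g • S.map n j y) ≤ MulAction.stabilizer G (g • S.map n j z) := by
  intro a ha
  rw [MulAction.mem_stabilizer_iff, ← mul_smul, smul_map_eq_iff hy hy] at ha
  have := S.smul_map n j _ ha.1 z hz
  rw [mul_smul, inv_smul_eq_iff, mul_smul] at this
  exact this

/-- Choose one point of `K` in each open cell that meets `K`. The chosen points form a closed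
discrete subset of a compact set, hence a finite one. -/
theorem finite_of_isCompact {K : Set X} (hK : IsCompact K) : ∃ t : Finset (G × Σ m, S.cell m),
    ∀ x ∈ K, ∃ c ∈ t, ∃ z ∈ ball (0 : Fin c.2.1 → ℝ) 1, x = c.1 • S.map c.2.1 c.2.2 z := by
  classical
  have := S.t2
  let e : G × (Σ m, S.cell m) → Set X := fun c =>
    {x | ∃ z ∈ ball (0 : Fin c.2.1 → ℝ) 1, x = c.1 • S.map c.2.1 c.2.2 z}
  have he : ∀ c c' : G × (Σ m, S.cell m), ∀ x, x ∈ e c → x ∈ e c' → e c = e c' := by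
    rintro ⟨g, n, j⟩ ⟨g', n', j'⟩ x ⟨z, hz, rfl⟩ ⟨z', hz', h⟩
    have h0 : (⟨n, j⟩ : Σ n, S.cell n) = ⟨n', j'⟩ :=
      openCell_eq_of_mem ⟨g, z, hz, rfl⟩ ⟨g', z', hz', h.symm⟩
    cases h0
    have h1 : g'⁻¹ * g ∈ S.stab n j := ((smul_map_eq_iff hz hz').1 h).1
    ext x
    refine exists_congr fun w => and_congr_right fun hw => ?_
    rw [((smul_map_eq_iff hw hw).2 ⟨h1, rfl⟩ : g • S.map n j w = g' • S.map n j w)]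
  have hcov : ∀ x, ∃ c, x ∈ e c := fun x => by
    obtain ⟨n, j, g, y, hy, rfl⟩ := S.cover x
    exact ⟨(g, ⟨n, j⟩), y, hy, rfl⟩
  choose γ hγ using hcov
  let Q : Set (Set X) := (fun x => e (γ x)) '' K
  have hQ : ∀ q : Q, ∃ x, x ∈ K ∧ e (γ x) = q := fun q => q.2
  choose r hr hr' using hQ
  -- Every set of chosen points is closed: a closed cell meets finitely many open cells, each of
  -- which contains at most one chosen point.
  have hsub : ∀ B : Set X, B ⊆ range r → IsClosed B := by
    intro B hB
    refine S.weak B fun n j g => ?_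
    obtain ⟨t, -, ht⟩ := S.exists_finset_closedCell n j
    have hfin : (B ∩ ⋃ c ∈ t, e (g * c.1, c.2)).Finite := by
      rw [inter_iUnion₂]
      refine t.finite_toSet.biUnion fun c _ => Set.Subsingleton.finite ?_
      rintro x ⟨hx, hxc⟩ y ⟨hy, hyc⟩
      obtain ⟨q, rfl⟩ := hB hx
      obtain ⟨q', rfl⟩ := hB hy
      have h1 := he _ _ _ (hγ (r q)) hxc
      have h2 := he _ _ _ (hγ (r q')) hyc
      have : q = q' := Subtype.ext (by rw [← hr' q, ← hr' q', h1, h2])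
      rw [this]
    convert S.isClosed_preimage_cell n j g hfin.isClosed using 1
    ext y
    simp only [mem_ofPred_eq]
    refine and_congr_right fun hy => ⟨fun h => ⟨h, ?_⟩, fun h => h.1⟩
    obtain ⟨c, hc, z, hz, e'⟩ := ht y hy
    exact mem_iUnion₂.2 ⟨c, hc, z, hz, by rw [e', mul_smul]⟩
  have hfinr : (range r).Finite := by
    refine (hK.of_isClosed_subset (hsub _ subset_rfl) (by rintro _ ⟨q, rfl⟩; exact hr q)).finite ?_
    have : DiscreteTopology (range r) := by
      rw [discreteTopology_iff_isOpen_singleton]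
      intro x
      refine ⟨(range r \ {(x : X)})ᶜ, (hsub _ sdiff_subset).isOpen_compl, ?_⟩
      ext y
      simp only [mem_preimage, mem_compl_iff, mem_sdiff, not_and, not_not, mem_singleton_iff]
      exact ⟨fun h => Subtype.ext (h y.2), fun h _ => h ▸ rfl⟩
    exact ⟨this⟩
  refine ⟨hfinr.toFinset.image γ, fun x hx => ?_⟩
  let q : Q := ⟨e (γ x), x, hx, rfl⟩
  refine ⟨γ (r q), Finset.mem_image_of_mem _ (by simp), ?_⟩
  have : e (γ (r q)) = e (γ x) := hr' q
  have h := hγ x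
  rw [← this] at h
  exact h

end GCWComplex

/-! ### Cell by cell construction of equivariant maps -/

namespace GCWComplex

variable {G : Type u} [Group G] {X : Type u} [TopologicalSpace X] [MulAction G X]
  [ContinuousConstSMul G X]

/-- A partial solution of an equivariant mapping problem: an equivariant map on an invariant
subcomplex, subject to a pointwise condition. -/
structure IsPartialMap (S : GCWComplex G X) {W : Type*} [TopologicalSpace W] [MulAction G W]
    (R : X → W → Prop) (D : Set X) (φ : X → W) : Prop where
  sub : S.IsSubcomplex D
  smul_mem : ∀ (g : G), ∀ x ∈ D, g • x ∈ D
  cont : ContinuousOn φ D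
  map_smul : ∀ (g : G), ∀ x ∈ D, φ (g • x) = g • φ x
  rel : ∀ x ∈ D, R x (φ x)

variable {S : GCWComplex G X} {W : Type*} [TopologicalSpace W] [MulAction G W]
  [ContinuousConstSMul G W]

theorem sphere_union_ball {n : ℕ} {y : Fin n → ℝ} (hy : y ∈ closedBall (0 : Fin n → ℝ) 1) :
    y ∈ ball (0 : Fin n → ℝ) 1 ∨ y ∈ sphere (0 : Fin n → ℝ) 1 := by
  simp only [mem_closedBall, mem_ball, mem_sphere] at *
  exact hy.lt_or_eq

/-- Extension of a partial map over one further equivariant cell. -/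
theorem IsPartialMap.extend_cell {R : X → W → Prop}
    (hR : ∀ (g : G) x w, R x w → R (g • x) (g • w)) {D : Set X} {φ : X → W}
    (h : S.IsPartialMap R D φ) {n : ℕ} (j : S.cell n)
    (hj : ∀ y ∈ ball (0 : Fin n → ℝ) 1, S.map n j y ∉ D)
    (hs : ∀ y ∈ sphere (0 : Fin n → ℝ) 1, S.map n j y ∈ D)
    (e : (Fin n → ℝ) → W) (he : ContinuousOn e (closedBall 0 1))
    (heR : ∀ y ∈ closedBall (0 : Fin n → ℝ) 1, R (S.map n j y) (e y))
    (hes : ∀ g ∈ S.stab n j, ∀ y ∈ closedBall (0 : Fin n → ℝ) 1, g • e y = e y)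
    (hee : ∀ y ∈ sphere (0 : Fin n → ℝ) 1, e y = φ (S.map n j y)) :
    ∃ φ', S.IsPartialMap R (D ∪ S.openCell n j) φ' ∧ EqOn φ' φ D := by
  classical
  have hd : ∀ g : G, ∀ y ∈ ball (0 : Fin n → ℝ) 1, g • S.map n j y ∉ D := fun g y hy hm =>
    hj y hy (by simpa using h.smul_mem g⁻¹ _ hm)
  let φ' : X → W := fun x => if x ∈ D then φ x else
    if hx : ∃ p : G × (Fin n → ℝ), p.2 ∈ ball (0 : Fin n → ℝ) 1 ∧ p.1 • S.map n j p.2 = x then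
      hx.choose.1 • e hx.choose.2 else φ x
  have h1 : EqOn φ' φ D := fun x hx => if_pos hx
  -- Two ways of writing a point of the open cell differ by an element of `S.stab n j`, which fixes
  -- the values of `e`. On the boundary `hee` makes the two definitions agree.
  have h2 : ∀ g : G, ∀ y ∈ closedBall (0 : Fin n → ℝ) 1, φ' (g • S.map n j y) = g • e y := by
    intro g y hy
    rcases sphere_union_ball hy with hb | hb
    · have hx : ∃ p : G × (Fin n → ℝ), p.2 ∈ ball (0 : Fin n → ℝ) 1 ∧
          p.1 • S.map n j p.2 = g • S.map n j y := ⟨(g, y), hb, rfl⟩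
      have e1 : φ' (g • S.map n j y) = hx.choose.1 • e hx.choose.2 := by
        simp only [φ']
        rw [if_neg (hd g y hb), dif_pos hx]
      rw [e1]
      obtain ⟨hc, hc'⟩ := hx.choose_spec
      obtain ⟨h3, h4⟩ := (smul_map_eq_iff hc hb).1 hc'
      rw [h4]
      have := hes _ h3 y hy
      rwa [mul_smul, inv_smul_eq_iff] at this
    · rw [h1 (h.smul_mem g _ (hs y hb)), h.map_smul g _ (hs y hb), hee y hb]
  have hclosed : ∀ g : G, ∀ y ∈ closedBall (0 : Fin n → ℝ) 1,
      g • S.map n j y ∈ D ∪ S.openCell n j := by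
    intro g y hy
    rcases sphere_union_ball hy with hb | hb
    · exact Or.inr ⟨g, y, hb, rfl⟩
    · exact Or.inl (h.smul_mem g _ (hs y hb))
  have hsub : S.IsSubcomplex (D ∪ S.openCell n j) := by
    rintro m k g y hy (hx | hx) z hz
    · exact Or.inl (h.sub m k g y hy hx z hz)
    · have := openCell_eq_of_mem ⟨g, y, hy, rfl⟩ hx
      cases this
      exact hclosed g z hz
  refine ⟨φ', ⟨hsub, ?_, ?_, ?_, ?_⟩, h1⟩
  · rintro g x (hx | hx)
    · exact Or.inl (h.smul_mem g x hx)
    · exact Or.inr (smul_mem_openCell g hx)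
  -- The centre of a closed cell of the enlarged subcomplex decides whether the cell lies in `D` or
  -- is a translate of the new cell.
  · refine hsub.continuousOn fun m k g hmk => ?_
    rcases hmk 0 (by simp) with h0 | h0
    · have hkD := h.sub m k g 0 zero_mem_unitBall h0
      refine (h.cont.comp (S.continuousOn_smul_map m k g) fun y hy => hkD y hy).congr ?_
      exact fun y hy => h1 (hkD y hy)
    · have := openCell_eq_of_mem ⟨g, 0, zero_mem_unitBall, rfl⟩ h0
      cases this
      exact (he.const_smul g).congr fun y hy => h2 g y hy
  · rintro g x (hx | ⟨a, y, hy, rfl⟩)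
    · rw [h1 hx, h1 (h.smul_mem g x hx), h.map_smul g x hx]
    · rw [← mul_smul, h2 _ y (ball_subset_closedBall hy), h2 _ y (ball_subset_closedBall hy),
        mul_smul]
  · rintro x (hx | ⟨a, y, hy, rfl⟩)
    · rw [h1 hx]
      exact h.rel x hx
    · rw [h2 _ y (ball_subset_closedBall hy)]
      exact hR _ _ _ (heR y (ball_subset_closedBall hy))

/-- Cell by cell construction of equivariant maps subject to a pointwise condition. -/
theorem exists_equivariant_map (S : GCWComplex G X) (R : X → W → Prop)
    (hR : ∀ (g : G) x w, R x w → R (g • x) (g • w)) (D₀ : Set X) (φ₀ : X → W)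
    (h₀ : S.IsPartialMap R D₀ φ₀)
    (ext : ∀ n (j : S.cell n), (∀ y ∈ ball (0 : Fin n → ℝ) 1, S.map n j y ∉ D₀) →
      ∀ s : (Fin n → ℝ) → W, ContinuousOn s (sphere 0 1) →
      (∀ y ∈ sphere (0 : Fin n → ℝ) 1, R (S.map n j y) (s y)) →
      (∀ g ∈ S.stab n j, ∀ y ∈ sphere (0 : Fin n → ℝ) 1, g • s y = s y) →
      ∃ e : (Fin n → ℝ) → W, ContinuousOn e (closedBall 0 1) ∧
        (∀ y ∈ closedBall (0 : Fin n → ℝ) 1, R (S.map n j y) (e y)) ∧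
        (∀ g ∈ S.stab n j, ∀ y ∈ closedBall (0 : Fin n → ℝ) 1, g • e y = e y) ∧
        EqOn e s (sphere 0 1)) :
    ∃ φ : X →[G] W, Continuous φ ∧ EqOn φ φ₀ D₀ ∧ ∀ x, R x (φ x) := by
  classical
  -- Zorn's lemma for partial maps that extend `φ₀`, ordered by extension.
  let P := {p : Set X × (X → W) // S.IsPartialMap R p.1 p.2 ∧ D₀ ⊆ p.1 ∧ EqOn p.2 φ₀ D₀}
  let r : P → P → Prop := fun p q => p.1.1 ⊆ q.1.1 ∧ EqOn q.1.2 p.1.2 p.1.1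
  have hr : ∀ p : P, r p p := fun p => ⟨subset_rfl, fun _ _ => rfl⟩
  obtain ⟨⟨⟨D, φ⟩, hφ, hD, hE⟩, hmax⟩ : ∃ m, ∀ a, r m a → r a m := by
    refine exists_maximal_of_chains_bounded (r := r) (fun c hc => ?_) ?_
    · rcases c.eq_empty_or_nonempty with rfl | ⟨p₀, hp₀⟩
      · exact ⟨⟨(D₀, φ₀), h₀, subset_rfl, fun _ _ => rfl⟩, fun a ha => absurd ha (notMem_empty a)⟩
      · have hdir : ∀ p ∈ c, ∀ q ∈ c, ∀ x ∈ p.1.1, x ∈ q.1.1 → p.1.2 x = q.1.2 x := by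
          intro p hp q hq x hx hx'
          rcases eq_or_ne p q with rfl | hne
          · rfl
          · rcases hc hp hq hne with h | h
            · exact (h.2 hx).symm
            · exact h.2 hx'
        let D : Set X := {x | ∃ p ∈ c, x ∈ p.1.1}
        let φ : X → W := fun x => if hx : ∃ p ∈ c, x ∈ p.1.1 then hx.choose.1.2 x else φ₀ x
        have hval : ∀ p ∈ c, EqOn φ p.1.2 p.1.1 := by
          intro p hp x hx
          have hx' : ∃ p ∈ c, x ∈ p.1.1 := ⟨p, hp, hx⟩
          have : φ x = hx'.choose.1.2 x := dif_pos hx'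
          rw [this]
          exact hdir _ hx'.choose_spec.1 _ hp x hx'.choose_spec.2 hx
        have hsub : S.IsSubcomplex D := fun n j g y hy ⟨p, hp, hx⟩ z hz =>
          ⟨p, hp, p.2.1.sub n j g y hy hx z hz⟩
        refine ⟨⟨(D, φ), ⟨hsub, fun g x ⟨p, hp, hx⟩ => ⟨p, hp, p.2.1.smul_mem g x hx⟩, ?_, ?_, ?_⟩,
          fun x hx => ⟨p₀, hp₀, p₀.2.2.1 hx⟩, fun x hx => ?_⟩,
          fun p hp => ⟨fun x hx => ⟨p, hp, hx⟩, hval p hp⟩⟩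
        -- The member of the chain that contains the centre of a closed cell contains the whole
        -- cell, so continuity on the union is inherited.
        · refine hsub.continuousOn fun n j g hj => ?_
          obtain ⟨p, hp, hx⟩ := hj 0 (by simp)
          have h' := p.2.1.sub n j g 0 zero_mem_unitBall hx
          exact (p.2.1.cont.comp (S.continuousOn_smul_map n j g) fun y hy => h' y hy).congr
            fun y hy => hval p hp (h' y hy)
        · rintro g x ⟨p, hp, hx⟩
          change φ (g • x) = g • φ x
          rw [hval p hp hx, hval p hp (p.2.1.smul_mem g x hx), p.2.1.map_smul g x hx]
        · rintro x ⟨p, hp, hx⟩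
          change R x (φ x)
          rw [hval p hp hx]
          exact p.2.1.rel x hx
        · change φ x = φ₀ x
          rw [hval p₀ hp₀ (p₀.2.2.1 hx), p₀.2.2.2 hx]
    · intro a b c hab hbc
      exact ⟨hab.1.trans hbc.1, fun x hx => (hbc.2 (hab.1 hx)).trans (hab.2 hx)⟩
  -- A maximal partial map is total. Otherwise take a missing open cell of least dimension: its
  -- boundary lies in `D`, and `ext` allows one more extension.
  have huniv : ∀ n, ∀ j : S.cell n, S.openCell n j ⊆ D := by
    by_contra! hne
    obtain ⟨n, ⟨j, hj⟩, hmin⟩ : ∃ n, (∃ j : S.cell n, ¬ S.openCell n j ⊆ D) ∧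
        ∀ m < n, ¬ ∃ j : S.cell m, ¬ S.openCell m j ⊆ D :=
      ⟨Nat.find hne, Nat.find_spec hne, fun m hm => Nat.find_min hne hm⟩
    have hlow : ∀ m < n, ∀ k : S.cell m, S.openCell m k ⊆ D := by
      intro m hm k
      have := hmin m hm
      push Not at this
      exact this k
    have hdisj : ∀ y ∈ ball (0 : Fin n → ℝ) 1, S.map n j y ∉ D := by
      intro y hy hm
      refine hj ?_
      rintro _ ⟨g, z, hz, rfl⟩
      exact hφ.smul_mem g _ (by
        simpa using hφ.sub n j 1 y hy (by simpa using hm) z (ball_subset_closedBall hz))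
    have hsph : ∀ y ∈ sphere (0 : Fin n → ℝ) 1, S.map n j y ∈ D := by
      intro y hy
      obtain ⟨m, hm, k, hk, l, hx⟩ := mem_skeleton_sphere n j 1 hy
      rw [one_smul] at hx
      exact hlow k (hk.trans_lt hm) l hx
    obtain ⟨e, he, heR, hes, hee⟩ := ext n j (fun y hy hm => hdisj y hy (hD hm))
      (fun y => φ (S.map n j y))
      (hφ.cont.comp ((S.continuousOn n j).mono sphere_subset_closedBall) hsph)
      (fun y hy => hφ.rel _ (hsph y hy))
      (fun g hg y hy => by
        rw [← hφ.map_smul g _ (hsph y hy), S.smul_map n j g hg y (sphere_subset_closedBall hy)])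
    obtain ⟨φ', hφ', hφφ'⟩ := hφ.extend_cell hR j hdisj hsph e he heR hes hee
    have := hmax ⟨(D ∪ S.openCell n j, φ'), hφ', hD.trans subset_union_left,
      fun x hx => (hφφ' (hD hx)).trans (hE hx)⟩ ⟨subset_union_left, hφφ'⟩
    exact hj (subset_union_right.trans this.1)
  have hmem : ∀ x, x ∈ D := fun x => by
    obtain ⟨n, j, hx⟩ := S.exists_mem_openCell x
    exact huniv n j hx
  refine ⟨⟨φ, fun g x => hφ.map_smul g x (hmem x)⟩, ?_, hE, fun x => hφ.rel x (hmem x)⟩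
  rw [← continuousOn_univ]
  exact hφ.cont.mono fun x _ => hmem x

end GCWComplex

theorem GCWComplex.isPartialMap_empty {G : Type u} [Group G] {X : Type u} [TopologicalSpace X]
    [MulAction G X] [ContinuousConstSMul G X] (S : GCWComplex G X) {W : Type*} [TopologicalSpace W]
    [MulAction G W] (R : X → W → Prop) (φ : X → W) : S.IsPartialMap R ∅ φ where
  sub := fun _ _ _ _ _ h => absurd h (notMem_empty _)
  smul_mem := fun _ _ h => absurd h (notMem_empty _)
  cont := continuousOn_empty _
  map_smul := fun _ _ h => absurd h (notMem_empty _)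
  rel := fun _ h => absurd h (notMem_empty _)

/-! ### Restriction to a subgroup and an invariant subcomplex -/

namespace GCWComplex

variable {G : Type u} [Group G] {X : Type u} [TopologicalSpace X] [MulAction G X]
  [ContinuousConstSMul G X]

/-- Boundary points lie in a lower skeleton, so among the open cells that meet the closed cell only
those of smaller dimension are needed. -/
theorem exists_finset_frontier (S : GCWComplex G X) (n : ℕ) (j : S.cell n) :
    ∃ t : Finset (G × Σ m, S.cell m), (∀ c ∈ t, c.2.1 < n) ∧
      ∀ y ∈ sphere (0 : Fin n → ℝ) 1, ∃ c ∈ t, ∃ z ∈ ball (0 : Fin c.2.1 → ℝ) 1,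
        S.map n j y = c.1 • S.map c.2.1 c.2.2 z := by
  classical
  obtain ⟨t, -, h⟩ := S.exists_finset_closedCell n j
  refine ⟨t.filter fun c => c.2.1 < n, fun c hc => (Finset.mem_filter.1 hc).2, fun y hy => ?_⟩
  obtain ⟨c, hc, z, hz, e⟩ := h y (sphere_subset_closedBall hy)
  refine ⟨c, Finset.mem_filter.2 ⟨hc, ?_⟩, z, hz, e⟩
  obtain ⟨m, hm, hx⟩ := mem_skeleton_sphere n j 1 hy
  rw [one_smul, e, smul_map_mem_skeleton_iff hz] at hx
  exact hx.trans_lt hm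

section Restrict

variable (S : GCWComplex G X) (N : Subgroup G) (D : SubMulAction N X)

instance : ContinuousConstSMul N D where
  continuous_const_smul n := by
    refine Continuous.subtype_mk ?_ _
    exact (continuous_const_smul (n : G)).comp continuous_subtype_val

/-- The translates of a cell that lie in `D`, up to the action of `N`. -/
def restrictSetoid (n : ℕ) (j : S.cell n) : Setoid {g : G // g • S.map n j 0 ∈ D} where
  r g g' := ∃ m : N, ∃ h ∈ S.stab n j, g'.1 = m * g.1 * h
  iseqv :=
    { refl := fun g => ⟨1, 1, one_mem _, by simp⟩
      symm := by
        rintro g g' ⟨m, h, hh, e⟩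
        exact ⟨m⁻¹, h⁻¹, inv_mem hh, by simp [e, mul_assoc]⟩
      trans := by
        rintro g g' g'' ⟨m, h, hh, e⟩ ⟨m', h', hh', e'⟩
        exact ⟨m' * m, h * h', mul_mem hh hh', by simp [e, e', mul_assoc]⟩ }

/-- The cells of the restriction of a `G`-CW-complex to an `N`-invariant subcomplex. -/
structure RestrictCell (n : ℕ) : Type u where
  base : S.cell n
  cls : Quotient (S.restrictSetoid N D n base)

variable {S N D}

/-- The chosen translate of a cell that represents a cell of the restriction. -/
noncomputable def RestrictCell.rep {n : ℕ} (q : S.RestrictCell N D n) : G := q.cls.out.1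

theorem RestrictCell.rep_mem {n : ℕ} (q : S.RestrictCell N D n) :
    q.rep • S.map n q.base 0 ∈ D := q.cls.out.2

/-- The classes are the double cosets of `N` and `S.stab n j`. Since `S.stab n j` fixes the closed
cell pointwise, a translate depends only on its double coset, up to the action of `N`. -/
theorem RestrictCell.exists_rep {n : ℕ} (j : S.cell n) (g : G) (hg : g • S.map n j 0 ∈ D) :
    ∃ q : S.RestrictCell N D n, q.base = j ∧ ∃ m : N, ∀ y ∈ closedBall (0 : Fin n → ℝ) 1,
      g • S.map n j y = m • q.rep • S.map n q.base y := by
  refine ⟨⟨j, Quotient.mk _ ⟨g, hg⟩⟩, rfl, ?_⟩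
  obtain ⟨m, h, hh, e⟩ := Quotient.exact (Quotient.out_eq (Quotient.mk (S.restrictSetoid N D n j)
    ⟨g, hg⟩))
  refine ⟨m, fun y hy => ?_⟩
  change g = m * RestrictCell.rep ⟨j, _⟩ * h at e
  change g • S.map n j y = (m : G) • RestrictCell.rep ⟨j, _⟩ • S.map n j y
  have e' := congrArg (· • S.map n j y) e
  simp only [mul_smul, S.smul_map n j h hh y hy] at e'
  exact e'

open Classical in
/-- The restriction of a `G`-CW-complex to an `N`-invariant subcomplex, as an `N`-CW-complex. -/
noncomputable def restrict (S : GCWComplex G X) (N : Subgroup G) (D : SubMulAction N X)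
    (hD : S.IsSubcomplex (D : Set X)) : GCWComplex N D :=
  -- Outside the closed ball the values do not matter; the centre of the cell is a default point of
  -- `D`.
  let map : ∀ n, S.RestrictCell N D n → (Fin n → ℝ) → D := fun n q y =>
    if h : q.rep • S.map n q.base y ∈ D then ⟨_, h⟩ else ⟨_, q.rep_mem⟩
  have hmap : ∀ n (q : S.RestrictCell N D n), ∀ y ∈ closedBall (0 : Fin n → ℝ) 1,
      (map n q y : X) = q.rep • S.map n q.base y := by
    intro n q y hy
    have h : q.rep • S.map n q.base y ∈ D :=
      hD n q.base q.rep 0 zero_mem_unitBall q.rep_mem y hy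
    simp only [map, dif_pos h]
  { t2 := by
      have := S.t2
      infer_instance
    cell := S.RestrictCell N D
    -- The isotropy group of the translate by `q.rep` is a conjugate of `S.stab n q.base`, here
    -- intersected with `N`.
    stab := fun n q => (S.stab n q.base).comap ((MulAut.conj q.rep⁻¹).toMonoidHom.comp N.subtype)
    map := map
    continuousOn := by
      intro n q
      rw [continuousOn_iff_continuous_domRestrict]
      refine continuous_induced_rng.2 ?_
      have := continuousOn_iff_continuous_domRestrict.1 (S.continuousOn_smul_map n q.base q.rep)
      refine this.congr fun y => (hmap n q y y.2).symm
    smul_map := by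
      intro n q h hh y hy
      have hh' : q.rep⁻¹ * h * q.rep⁻¹⁻¹ ∈ S.stab n q.base := hh
      refine Subtype.ext ?_
      rw [SubMulAction.val_smul, hmap n q y hy]
      have := S.smul_map n q.base _ hh' y hy
      rw [inv_inv, mul_smul, mul_smul, inv_smul_eq_iff] at this
      exact this
    cover := by
      rintro ⟨x, hx⟩
      obtain ⟨n, j, g, y, hy, rfl⟩ := S.cover x
      have h0 : g • S.map n j 0 ∈ D := hD n j g y hy hx 0 (by simp)
      obtain ⟨q, -, m, hm⟩ := RestrictCell.exists_rep j g h0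
      refine ⟨n, q, m, y, hy, Subtype.ext ?_⟩
      rw [SubMulAction.val_smul, hmap n q y (ball_subset_closedBall hy)]
      exact (hm y (ball_subset_closedBall hy)).symm
    disjoint := by
      rintro n ⟨j, q⟩ m ⟨k, q'⟩ g y hy z hz h
      have h' := congrArg Subtype.val h
      rw [SubMulAction.val_smul, hmap _ _ y (ball_subset_closedBall hy),
        hmap _ _ z (ball_subset_closedBall hz), Subgroup.smul_def] at h'
      have h1 : (⟨n, j⟩ : Σ n, S.cell n) = ⟨m, k⟩ :=
        openCell_eq_of_mem ⟨(g : G) * RestrictCell.rep ⟨j, q⟩, y, hy, mul_smul _ _ _⟩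
          ⟨_, z, hz, h'.symm⟩
      cases h1
      rw [← mul_smul, smul_map_eq_iff hy hz] at h'
      have : q = q' := by
        rw [← Quotient.out_eq q, ← Quotient.out_eq q']
        refine Quotient.sound ((S.restrictSetoid N D n j).iseqv.symm ?_)
        refine ⟨g⁻¹, _, h'.1, ?_⟩
        change RestrictCell.rep ⟨j, q⟩ = _ * RestrictCell.rep ⟨j, q'⟩ * _
        simp [mul_assoc]
      rw [this]
    inj := by
      intro n q g y hy z hz h
      have h' := congrArg Subtype.val h
      rw [SubMulAction.val_smul, hmap _ _ y (ball_subset_closedBall hy),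
        hmap _ _ z (ball_subset_closedBall hz), Subgroup.smul_def] at h'
      rw [← mul_smul, smul_map_eq_iff hy hz] at h'
      refine ⟨?_, h'.2⟩
      change q.rep⁻¹ * g * q.rep⁻¹⁻¹ ∈ S.stab n q.base
      rw [inv_inv, mul_assoc]
      exact h'.1
    frontier := by
      intro n q
      obtain ⟨t, ht, h⟩ := S.exists_finset_frontier n q.base
      -- An open cell that meets `D` has its closed cell in `D` and is, up to `N`, a chosen
      -- representative. The other open cells contribute nothing.
      have key : ∀ c : G × Σ m, S.cell m, ∃ s : Finset (N × Σ m, S.RestrictCell N D m),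
          (∀ d ∈ s, d.2.1 = c.2.1) ∧ ∀ z ∈ ball (0 : Fin c.2.1 → ℝ) 1,
            (q.rep * c.1) • S.map c.2.1 c.2.2 z ∈ D → ∃ d ∈ s,
              ∃ w ∈ closedBall (0 : Fin d.2.1 → ℝ) 1,
              (q.rep * c.1) • S.map c.2.1 c.2.2 z = d.1 • (map d.2.1 d.2.2 w : X) := by
        intro c
        by_cases hc : (q.rep * c.1) • S.map c.2.1 c.2.2 0 ∈ D
        · obtain ⟨q', -, m, hm⟩ := RestrictCell.exists_rep c.2.2 _ hc
          refine ⟨{(m, ⟨c.2.1, q'⟩)}, by simp, fun z hz _ => ⟨_, Finset.mem_singleton_self _, z,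
            ball_subset_closedBall hz, ?_⟩⟩
          rw [hm z (ball_subset_closedBall hz), hmap _ _ _ (ball_subset_closedBall hz)]
        · exact ⟨∅, by simp, fun z hz hx => absurd (hD _ _ _ z hz hx 0 (by simp)) hc⟩
      choose s hs hs' using key
      refine ⟨t.biUnion s, ?_, fun y hy => ?_⟩
      · intro d hd
        obtain ⟨c, hc, hd⟩ := Finset.mem_biUnion.1 hd
        rw [hs c d hd]
        exact ht c hc
      · obtain ⟨c, hc, z, hz, e⟩ := h y hy
        have e1 : (map n q y : X) = (q.rep * c.1) • S.map c.2.1 c.2.2 z := by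
          rw [hmap n q y (sphere_subset_closedBall hy), e, mul_smul]
        obtain ⟨d, hd, w, hw, e2⟩ := hs' c z hz (e1 ▸ (map n q y).2)
        exact ⟨d, Finset.mem_biUnion.2 ⟨c, hc, hd⟩, w, hw, Subtype.ext (e1.trans e2)⟩
    weak := by
      intro A hA
      have : IsClosed (Subtype.val '' A : Set X) := by
        refine hD.isClosed_of_subset (by rintro _ ⟨x, -, rfl⟩; exact x.2) fun n j g hj => ?_
        obtain ⟨q, rfl, m, hm⟩ := RestrictCell.exists_rep j g (hj 0 (by simp))
        convert hA n q m using 1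
        ext y
        refine and_congr_right fun hy => ?_
        have : g • S.map n q.base y = (m • map n q y : D) := by
          rw [hm y hy, SubMulAction.val_smul, hmap n q y hy]
        rw [this]
        exact Subtype.val_injective.mem_set_image
      have h' := this.preimage (continuous_subtype_val : Continuous (Subtype.val : D → X))
      rwa [preimage_image_eq _ Subtype.val_injective] at h' }

open Classical in
theorem restrict_map {hD : S.IsSubcomplex (D : Set X)} {n : ℕ} (q : S.RestrictCell N D n)
    {y : Fin n → ℝ} (hy : y ∈ closedBall (0 : Fin n → ℝ) 1) :
    ((S.restrict N D hD).map n q y : X) = q.rep • S.map n q.base y := by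
  have h : q.rep • S.map n q.base y ∈ D := hD n q.base q.rep 0 zero_mem_unitBall q.rep_mem y hy
  change ((dite _ _ _ : D) : X) = _
  rw [dif_pos h]

theorem isSubcomplex_restrict {hD : S.IsSubcomplex (D : Set X)} {E : Set X}
    (hE : S.IsSubcomplex E) : (S.restrict N D hD).IsSubcomplex (Subtype.val ⁻¹' E) := by
  intro n q g y hy h z hz
  change (g : G) • ((S.restrict N D hD).map n q y : X) ∈ E at h
  change (g : G) • ((S.restrict N D hD).map n q z : X) ∈ E
  rw [restrict_map q (ball_subset_closedBall hy), ← mul_smul] at h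
  rw [restrict_map q hz, ← mul_smul]
  exact hE n q.base _ y hy h z hz

end Restrict

/-- Cell by cell construction of maps that are equivariant with respect to a subgroup. -/
theorem exists_equivariant_map_subgroup (S : GCWComplex G X) (N : Subgroup G) {W : Type*}
    [TopologicalSpace W] [MulAction N W] [ContinuousConstSMul N W] (R : X → W → Prop)
    (hR : ∀ (g : N) x w, R x w → R (g • x) (g • w)) (D₀ : Set X) (φ₀ : X → W)
    (hD₀ : S.IsSubcomplex D₀) (hsmul : ∀ (g : N), ∀ x ∈ D₀, g • x ∈ D₀)
    (hcont : ContinuousOn φ₀ D₀) (hmap : ∀ (g : N), ∀ x ∈ D₀, φ₀ (g • x) = g • φ₀ x)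
    (hrel : ∀ x ∈ D₀, R x (φ₀ x))
    (ext : ∀ n (j : S.cell n) (g : G), (∀ y ∈ ball (0 : Fin n → ℝ) 1, g • S.map n j y ∉ D₀) →
      ∀ s : (Fin n → ℝ) → W, ContinuousOn s (sphere 0 1) →
      (∀ y ∈ sphere (0 : Fin n → ℝ) 1, R (g • S.map n j y) (s y)) →
      (∀ h : N, g⁻¹ * h * g ∈ S.stab n j → ∀ y ∈ sphere (0 : Fin n → ℝ) 1, h • s y = s y) →
      ∃ e : (Fin n → ℝ) → W, ContinuousOn e (closedBall 0 1) ∧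
        (∀ y ∈ closedBall (0 : Fin n → ℝ) 1, R (g • S.map n j y) (e y)) ∧
        (∀ h : N, g⁻¹ * h * g ∈ S.stab n j →
          ∀ y ∈ closedBall (0 : Fin n → ℝ) 1, h • e y = e y) ∧
        EqOn e s (sphere 0 1)) :
    ∃ φ : X → W, Continuous φ ∧ (∀ (g : N) x, φ (g • x) = g • φ x) ∧ EqOn φ φ₀ D₀ ∧
      ∀ x, R x (φ x) := by
  -- For `D = univ` the restriction is `X` itself, regarded as an `N`-CW-complex.
  let D : SubMulAction N X := ⟨univ, fun _ _ _ => mem_univ _⟩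
  have hD : S.IsSubcomplex (D : Set X) := isSubcomplex_univ
  obtain ⟨φ, hφ, hφ₀, hφR⟩ := (S.restrict N D hD).exists_equivariant_map
    (fun x w => R x w) (fun g x w h => hR g x w h) (Subtype.val ⁻¹' D₀) (fun x => φ₀ x)
    ⟨isSubcomplex_restrict hD₀, fun g x hx => hsmul g x hx,
      hcont.comp continuous_subtype_val.continuousOn fun x hx => hx,
      fun g x hx => hmap g x hx, fun x hx => hrel x hx⟩ (by
      intro n q hq s hs hsR hsf
      have key : ∀ h : N, q.rep⁻¹ * h * q.rep ∈ S.stab n q.base →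
          h ∈ (S.restrict N D hD).stab n q := by
        intro h hh
        change q.rep⁻¹ * h * q.rep⁻¹⁻¹ ∈ S.stab n q.base
        rwa [inv_inv]
      obtain ⟨e, he, heR, hef, hes⟩ := ext n q.base q.rep (fun y hy hm => hq y hy (by
          change ((S.restrict N D hD).map n q y : X) ∈ D₀
          rwa [restrict_map q (ball_subset_closedBall hy)])) s hs
        (fun y hy => by
          rw [← restrict_map (hD := hD) q (sphere_subset_closedBall hy)]
          exact hsR y hy) (fun h hh => hsf h (key h hh))
      refine ⟨e, he, fun y hy => ?_, fun h hh => hef h ?_, hes⟩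
      · rw [restrict_map q hy]
        exact heR y hy
      · have hh' : q.rep⁻¹ * h * q.rep⁻¹⁻¹ ∈ S.stab n q.base := hh
        rwa [inv_inv] at hh')
  exact ⟨fun x => φ ⟨x, mem_univ x⟩, hφ.comp (continuous_id.subtype_mk _),
    fun g x => φ.map_smul g ⟨x, mem_univ x⟩, fun x hx => @hφ₀ ⟨x, mem_univ x⟩ hx,
    fun x => hφR ⟨x, mem_univ x⟩⟩

/-- Cell by cell construction of maps between `G`-spaces that are equivariant with respect to a
subgroup. -/
theorem exists_equivariant_map_of_subgroup (S : GCWComplex G X) (N : Subgroup G) {W : Type*}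
    [TopologicalSpace W] [MulAction G W] [ContinuousConstSMul G W] (R : X → W → Prop)
    (hR : ∀ g ∈ N, ∀ x w, R x w → R (g • x) (g • w)) (D₀ : Set X) (φ₀ : X → W)
    (hD₀ : S.IsSubcomplex D₀) (hsmul : ∀ g ∈ N, ∀ x ∈ D₀, g • x ∈ D₀)
    (hcont : ContinuousOn φ₀ D₀) (hmap : ∀ g ∈ N, ∀ x ∈ D₀, φ₀ (g • x) = g • φ₀ x)
    (hrel : ∀ x ∈ D₀, R x (φ₀ x))
    (ext : ∀ n (j : S.cell n) (g : G), (∀ y ∈ ball (0 : Fin n → ℝ) 1, g • S.map n j y ∉ D₀) →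
      ∀ s : (Fin n → ℝ) → W, ContinuousOn s (sphere 0 1) →
      (∀ y ∈ sphere (0 : Fin n → ℝ) 1, R (g • S.map n j y) (s y)) →
      (∀ h ∈ N, g⁻¹ * h * g ∈ S.stab n j → ∀ y ∈ sphere (0 : Fin n → ℝ) 1, h • s y = s y) →
      ∃ e : (Fin n → ℝ) → W, ContinuousOn e (closedBall 0 1) ∧
        (∀ y ∈ closedBall (0 : Fin n → ℝ) 1, R (g • S.map n j y) (e y)) ∧
        (∀ h ∈ N, g⁻¹ * h * g ∈ S.stab n j →
          ∀ y ∈ closedBall (0 : Fin n → ℝ) 1, h • e y = e y) ∧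
        EqOn e s (sphere 0 1)) :
    ∃ φ : X → W, Continuous φ ∧ (∀ g ∈ N, ∀ x, φ (g • x) = g • φ x) ∧ EqOn φ φ₀ D₀ ∧
      ∀ x, R x (φ x) := by
  have : ContinuousConstSMul N W := ⟨fun g => continuous_const_smul (g : G)⟩
  obtain ⟨φ, h1, h2, h3⟩ := S.exists_equivariant_map_subgroup N R (fun g x w => hR g g.2 x w) D₀ φ₀
    hD₀ (fun g => hsmul g g.2) hcont (fun g => hmap g g.2) hrel (fun n j g hn s hs hsR hsf => by
      obtain ⟨e, he, heR, hef, hes⟩ := ext n j g hn s hs hsR fun h hh => hsf ⟨h, hh⟩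
      exact ⟨e, he, heR, fun h => hef h h.2, hes⟩)
  exact ⟨φ, h1, fun g hg => h2 ⟨g, hg⟩, h3⟩

end GCWComplex

/-! ### Homotopies and extensions on disks -/

section Disk

open unitInterval

variable {Z : Type*} [TopologicalSpace Z]

/-- Homotopies are handled as maps to the path space `C(I, Z)`, so that they can be constructed cell
by cell exactly like maps. This passes from a function on a product to such a map. -/
theorem exists_curry_continuousOn {E : Type*} [TopologicalSpace E] {A : Set E} {F : E → I → Z}
    (hF : ContinuousOn (fun p : E × I => F p.1 p.2) (A ×ˢ univ)) :
    ∃ Γ : E → C(I, Z), ContinuousOn Γ A ∧ ∀ y ∈ A, ∀ t, Γ y t = F y t := by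
  classical
  let f : C(A × I, Z) := ⟨fun p => F p.1 p.2, hF.comp_continuous
    (f := fun p : A × I => ((p.1 : E), p.2)) (by fun_prop) fun p => ⟨p.1.2, mem_univ _⟩⟩
  refine ⟨fun y => if h : y ∈ A then f.curry ⟨y, h⟩ else ContinuousMap.const _ (F y 0), ?_, ?_⟩
  · rw [continuousOn_iff_continuous_domRestrict]
    refine f.curry.continuous.congr fun y => ?_
    simp [Set.domRestrict]
  · intro y hy t
    simp only [dif_pos hy]
    rfl

theorem ContinuousOn.uncurry_path {E : Type*} [TopologicalSpace E] {A : Set E} {γ : E → C(I, Z)}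
    (hγ : ContinuousOn γ A) : ContinuousOn (fun p : E × I => γ p.1 p.2) (A ×ˢ univ) :=
  ContinuousEval.continuous_eval.comp_continuousOn
    ((hγ.comp continuousOn_fst fun _ hp => hp.1).prodMk continuousOn_snd)

theorem continuous_path_eval (t : I) : Continuous fun γ : C(I, Z) => γ t :=
  ContinuousEvalConst.continuous_eval_const t

theorem norm_inv_smul_mem_sphere {n : ℕ} {y : Fin n → ℝ} (hy : y ≠ 0) :
    ‖y‖⁻¹ • y ∈ sphere (0 : Fin n → ℝ) 1 := by
  rw [mem_sphere_zero_iff_norm, norm_smul, norm_inv, norm_norm,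
    inv_mul_cancel₀ (norm_ne_zero_iff.2 hy)]

/-- The homotopy extension property of a disk and its boundary sphere. -/
theorem exists_disk_homotopy_extension {n : ℕ} {u : (Fin n → ℝ) → Z}
    (hu : ContinuousOn u (closedBall 0 1)) {γ : (Fin n → ℝ) → C(I, Z)}
    (hγ : ContinuousOn γ (sphere 0 1)) (h0 : ∀ y ∈ sphere (0 : Fin n → ℝ) 1, γ y 0 = u y) :
    ∃ Γ : (Fin n → ℝ) → C(I, Z), ContinuousOn Γ (closedBall 0 1) ∧ EqOn Γ γ (sphere 0 1) ∧
      (∀ y ∈ closedBall (0 : Fin n → ℝ) 1, Γ y 0 = u y) ∧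
      ∀ y ∈ closedBall (0 : Fin n → ℝ) 1, ∀ t, (∃ z ∈ closedBall (0 : Fin n → ℝ) 1, Γ y t = u z) ∨
        ∃ z ∈ sphere (0 : Fin n → ℝ) 1, ∃ t', Γ y t = γ z t' := by
  classical
  -- Central projection from the point `(0, 2)` retracts the cylinder over the disk onto its bottom
  -- and its side. The line through `(y, t)` meets the bottom when `2‖y‖ ≤ 2 - t`, at `2y / (2 -
  -- t)`, and otherwise meets the side at height `2 - (2 - t) / ‖y‖`.
  let F : (Fin n → ℝ) → I → Z := fun y t => if 2 * ‖y‖ ≤ 2 - t then u ((2 / (2 - (t : ℝ))) • y)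
    else γ (‖y‖⁻¹ • y) (projIcc 0 1 zero_le_one (2 - (2 - t) / ‖y‖))
  have ht : ∀ t : I, 0 < 2 - (t : ℝ) := fun t => by linarith [t.2.2]
  have m1 : ∀ (y : Fin n → ℝ) (t : I), 2 * ‖y‖ ≤ 2 - t →
      (2 / (2 - (t : ℝ))) • y ∈ closedBall (0 : Fin n → ℝ) 1 := by
    intro y t h
    rw [mem_closedBall_zero_iff, norm_smul, Real.norm_of_nonneg (div_pos two_pos (ht t)).le,
      div_mul_eq_mul_div, div_le_one (ht t)]
    exact h
  have m2 : ∀ (y : Fin n → ℝ) (t : I), 2 - t ≤ 2 * ‖y‖ → y ≠ 0 := by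
    rintro y t h rfl
    have := ht t
    rw [norm_zero, mul_zero] at h
    linarith
  have hFn : ∀ (y : Fin n → ℝ) (t : I), 2 - t ≤ 2 * ‖y‖ →
      F y t = γ (‖y‖⁻¹ • y) (projIcc 0 1 zero_le_one (2 - (2 - t) / ‖y‖)) := by
    intro y t h
    by_cases h' : 2 * ‖y‖ ≤ 2 - t
    · have e : 2 - (t : ℝ) = 2 * ‖y‖ := le_antisymm h h'
      have hy : ‖y‖ ≠ 0 := norm_ne_zero_iff.2 (m2 y t h)
      simp only [F, if_pos h']
      rw [e, mul_div_cancel_right₀ _ hy, sub_self]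
      have e0 : projIcc (0 : ℝ) 1 zero_le_one 0 = 0 := projIcc_left _
      rw [e0, h0 _ (norm_inv_smul_mem_sphere (m2 y t h))]
      congr 2
      field_simp
    · exact if_neg h'
  have hF : ContinuousOn (fun p : (Fin n → ℝ) × I => F p.1 p.2) (closedBall 0 1 ×ˢ univ) := by
    have c1 : ContinuousOn (fun p : (Fin n → ℝ) × I => F p.1 p.2)
        {p | 2 * ‖p.1‖ ≤ 2 - p.2} := by
      refine ContinuousOn.congr (f := fun p : (Fin n → ℝ) × I => u ((2 / (2 - (p.2 : ℝ))) • p.1))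
        (hu.comp (Continuous.continuousOn ?_) fun p hp => m1 p.1 p.2 hp) fun p hp => if_pos hp
      have c : Continuous fun p : (Fin n → ℝ) × I => 2 / (2 - (p.2 : ℝ)) :=
        continuous_const.div (by fun_prop) fun p => (ht p.2).ne'
      exact c.smul continuous_fst
    have c2 : ContinuousOn (fun p : (Fin n → ℝ) × I => F p.1 p.2)
        {p | 2 - p.2 ≤ 2 * ‖p.1‖} := by
      refine ContinuousOn.congr (f := fun p : (Fin n → ℝ) × I => γ (‖p.1‖⁻¹ • p.1)
        (projIcc 0 1 zero_le_one (2 - (2 - p.2) / ‖p.1‖))) ?_ fun p hp => hFn p.1 p.2 hp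
      have hne : ∀ p ∈ {p : (Fin n → ℝ) × I | 2 - p.2 ≤ 2 * ‖p.1‖}, ‖p.1‖ ≠ 0 :=
        fun p hp => norm_ne_zero_iff.2 (m2 p.1 p.2 hp)
      refine hγ.uncurry_path.comp (f := fun p : (Fin n → ℝ) × I => (‖p.1‖⁻¹ • p.1,
        projIcc (0 : ℝ) 1 zero_le_one (2 - (2 - p.2) / ‖p.1‖))) ?_
        fun p hp => ⟨norm_inv_smul_mem_sphere (m2 p.1 p.2 hp), mem_univ _⟩
      refine ContinuousOn.prodMk ?_ (continuous_projIcc.comp_continuousOn ?_)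
      · exact (ContinuousOn.inv₀ (by fun_prop) hne).smul (by fun_prop)
      · exact continuousOn_const.sub (ContinuousOn.div (by fun_prop) (by fun_prop) hne)
    refine (c1.union_of_isClosed c2 ?_ ?_).mono fun p _ => ?_
    · exact isClosed_le (by fun_prop) (by fun_prop)
    · exact isClosed_le (by fun_prop) (by fun_prop)
    · exact le_total (2 * ‖p.1‖) (2 - (p.2 : ℝ))
  obtain ⟨Γ, hΓ, hΓF⟩ := exists_curry_continuousOn hF
  refine ⟨Γ, hΓ, fun y hy => ContinuousMap.ext fun t => ?_, fun y hy => ?_, fun y hy t => ?_⟩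
  · have hy1 : ‖y‖ = 1 := mem_sphere_zero_iff_norm.1 hy
    rw [hΓF y (sphere_subset_closedBall hy), hFn y t (by rw [hy1]; linarith [t.2.1]), hy1, inv_one,
      one_smul, div_one]
    congr 1
    have : (2 - (2 - (t : ℝ))) = t := by ring
    rw [this]
    exact projIcc_val _ t
  · have hy1 : ‖y‖ ≤ 1 := mem_closedBall_zero_iff.1 hy
    have h : 2 * ‖y‖ ≤ 2 - (0 : I) := by simp; linarith
    rw [hΓF y hy]
    simp only [F, if_pos h]
    simp
  · rw [hΓF y hy]
    rcases le_total (2 * ‖y‖) (2 - t) with h | h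
    · exact Or.inl ⟨_, m1 y t h, if_pos h⟩
    · exact Or.inr ⟨_, norm_inv_smul_mem_sphere (m2 y t h), _, hFn y t h⟩

/-- For the supremum norm balls are cubes, so a disk of dimension `n + 1` is literally the product
of an interval and a disk of dimension `n`. -/
theorem mem_closedBall_succ {n : ℕ} {x : Fin (n + 1) → ℝ} :
    x ∈ closedBall (0 : Fin (n + 1) → ℝ) 1 ↔ |x 0| ≤ 1 ∧ Fin.tail x ∈ closedBall (0 : Fin n → ℝ) 1 := by
  rw [mem_closedBall_zero_iff, mem_closedBall_zero_iff, pi_norm_le_iff_of_nonneg zero_le_one,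
    pi_norm_le_iff_of_nonneg zero_le_one, Fin.forall_fin_succ]
  rfl

theorem mem_ball_succ {n : ℕ} {x : Fin (n + 1) → ℝ} :
    x ∈ ball (0 : Fin (n + 1) → ℝ) 1 ↔ |x 0| < 1 ∧ Fin.tail x ∈ ball (0 : Fin n → ℝ) 1 := by
  rw [mem_ball_zero_iff, mem_ball_zero_iff, pi_norm_lt_iff zero_lt_one,
    pi_norm_lt_iff zero_lt_one, Fin.forall_fin_succ]
  rfl

theorem mem_sphere_iff_closedBall {n : ℕ} {x : Fin n → ℝ} :
    x ∈ sphere (0 : Fin n → ℝ) 1 ↔ x ∈ closedBall (0 : Fin n → ℝ) 1 ∧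
      x ∉ ball (0 : Fin n → ℝ) 1 := by
  simp only [mem_sphere, mem_closedBall, mem_ball, not_lt]
  exact le_antisymm_iff

theorem mem_sphere_succ {n : ℕ} {x : Fin (n + 1) → ℝ} :
    x ∈ sphere (0 : Fin (n + 1) → ℝ) 1 ↔
      ((x 0 = -1 ∨ x 0 = 1) ∧ Fin.tail x ∈ closedBall (0 : Fin n → ℝ) 1) ∨
      (|x 0| ≤ 1 ∧ Fin.tail x ∈ sphere (0 : Fin n → ℝ) 1) := by
  rw [mem_sphere_iff_closedBall, mem_closedBall_succ, mem_ball_succ, mem_sphere_iff_closedBall]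
  have h1 : (x 0 = -1 ∨ x 0 = 1) ↔ |x 0| = 1 := by
    rw [abs_eq zero_le_one, or_comm]
  have h2 : |x 0| = 1 ↔ |x 0| ≤ 1 ∧ ¬ |x 0| < 1 := by
    rw [not_lt, le_antisymm_iff]
  rw [h1, h2]
  tauto

/-- `T` is nonempty and every map from a sphere to `T` extends to the disk. -/
def DiskExt (T : Set Z) : Prop :=
  T.Nonempty ∧ ∀ (n : ℕ) (s : (Fin n → ℝ) → Z), ContinuousOn s (sphere 0 1) → MapsTo s (sphere 0 1) T →
    ∃ e : (Fin n → ℝ) → Z, ContinuousOn e (closedBall 0 1) ∧ MapsTo e (closedBall 0 1) T ∧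
      EqOn e s (sphere 0 1)

theorem continuous_finTail {n : ℕ} : Continuous (Fin.tail : (Fin (n + 1) → ℝ) → (Fin n → ℝ)) :=
  continuous_pi fun i => continuous_apply i.succ

/-- Homotopies between maps on a disk exist relative to the boundary. -/
theorem DiskExt.exists_homotopy {T : Set Z} (hT : DiskExt T) {n : ℕ} {u₀ u₁ : (Fin n → ℝ) → Z}
    (hu₀ : ContinuousOn u₀ (closedBall 0 1)) (hu₁ : ContinuousOn u₁ (closedBall 0 1))
    (hT₀ : MapsTo u₀ (closedBall 0 1) T) (hT₁ : MapsTo u₁ (closedBall 0 1) T)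
    {γ : (Fin n → ℝ) → C(I, Z)} (hγ : ContinuousOn γ (sphere 0 1))
    (hγT : ∀ y ∈ sphere (0 : Fin n → ℝ) 1, ∀ t, γ y t ∈ T)
    (h0 : ∀ y ∈ sphere (0 : Fin n → ℝ) 1, γ y 0 = u₀ y)
    (h1 : ∀ y ∈ sphere (0 : Fin n → ℝ) 1, γ y 1 = u₁ y) :
    ∃ Γ : (Fin n → ℝ) → C(I, Z), ContinuousOn Γ (closedBall 0 1) ∧ EqOn Γ γ (sphere 0 1) ∧
      (∀ y ∈ closedBall (0 : Fin n → ℝ) 1, Γ y 0 = u₀ y) ∧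
      (∀ y ∈ closedBall (0 : Fin n → ℝ) 1, Γ y 1 = u₁ y) ∧
      ∀ y ∈ closedBall (0 : Fin n → ℝ) 1, ∀ t, Γ y t ∈ T := by
  classical
  let τ : ℝ → I := fun t => projIcc 0 1 zero_le_one ((t + 1) / 2)
  have hτ : Continuous τ := continuous_projIcc.comp (by fun_prop)
  have hτ0 : τ (-1) = 0 := by
    have : ((-1 : ℝ) + 1) / 2 = 0 := by norm_num
    simp only [τ, this]
    exact projIcc_left _
  have hτ1 : τ 1 = 1 := by
    have : ((1 : ℝ) + 1) / 2 = 1 := by norm_num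
    simp only [τ, this]
    exact projIcc_right _
  have hτt : ∀ t : I, τ (2 * t - 1) = t := by
    intro t
    have : (2 * (t : ℝ) - 1 + 1) / 2 = t := by ring
    simp only [τ, this]
    exact projIcc_val _ t
  -- A homotopy relative to the boundary is a disk of one dimension more. Its boundary values are
  -- `u₀` on the bottom face, `u₁` on the top face and `γ` along the sides, with `τ` rescaling `[-1,
  -- 1]` to the unit interval.
  let s : (Fin (n + 1) → ℝ) → Z := fun x => if x 0 = -1 then u₀ (Fin.tail x) else
    if x 0 = 1 then u₁ (Fin.tail x) else γ (Fin.tail x) (τ (x 0))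
  have s1 : ∀ x, x 0 = -1 → s x = u₀ (Fin.tail x) := fun x hx => if_pos hx
  have s2 : ∀ x, x 0 = 1 → s x = u₁ (Fin.tail x) := fun x hx => by
    have : x 0 ≠ -1 := by rw [hx]; norm_num
    simp only [s, if_neg this, if_pos hx]
  have s3 : ∀ x : Fin (n + 1) → ℝ, Fin.tail x ∈ sphere (0 : Fin n → ℝ) 1 → s x = γ (Fin.tail x) (τ (x 0)) := by
    intro x hx
    by_cases h : x 0 = -1
    · rw [s1 x h, h, hτ0, h0 _ hx]
    · by_cases h' : x 0 = 1
      · rw [s2 x h', h', hτ1, h1 _ hx]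
      · simp only [s, if_neg h, if_neg h']
  have hs : ContinuousOn s (sphere 0 1) := by
    have ct : Continuous (Fin.tail : (Fin (n + 1) → ℝ) → (Fin n → ℝ)) := continuous_finTail
    have c0 : Continuous fun x : Fin (n + 1) → ℝ => x 0 := continuous_apply 0
    have k1 : ContinuousOn s {x | x 0 = -1 ∧ Fin.tail x ∈ closedBall (0 : Fin n → ℝ) 1} :=
      (hu₀.comp ct.continuousOn fun x hx => hx.2).congr fun x hx => s1 x hx.1
    have k2 : ContinuousOn s {x | x 0 = 1 ∧ Fin.tail x ∈ closedBall (0 : Fin n → ℝ) 1} :=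
      (hu₁.comp ct.continuousOn fun x hx => hx.2).congr fun x hx => s2 x hx.1
    have k3 : ContinuousOn s {x | Fin.tail x ∈ sphere (0 : Fin n → ℝ) 1} := by
      refine ContinuousOn.congr ?_ fun x hx => s3 x hx
      exact hγ.uncurry_path.comp (f := fun x : Fin (n + 1) → ℝ => (Fin.tail x, τ (x 0)))
        (ct.prodMk (hτ.comp c0)).continuousOn fun x hx => ⟨hx, mem_univ _⟩
    have i1 : ∀ a : ℝ, IsClosed {x : Fin (n + 1) → ℝ | x 0 = a ∧
        Fin.tail x ∈ closedBall (0 : Fin n → ℝ) 1} := fun a =>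
      (isClosed_eq c0 continuous_const).inter (isClosed_closedBall.preimage ct)
    have i3 : IsClosed {x : Fin (n + 1) → ℝ | Fin.tail x ∈ sphere (0 : Fin n → ℝ) 1} :=
      isClosed_sphere.preimage ct
    refine ((k1.union_of_isClosed k2 (i1 _) (i1 _)).union_of_isClosed k3
      ((i1 _).union (i1 _)) i3).mono fun x hx => ?_
    rcases mem_sphere_succ.1 hx with ⟨h | h, h'⟩ | h
    · exact Or.inl (Or.inl ⟨h, h'⟩)
    · exact Or.inl (Or.inr ⟨h, h'⟩)
    · exact Or.inr h.2
  have hsT : MapsTo s (sphere 0 1) T := by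
    intro x hx
    rcases mem_sphere_succ.1 hx with ⟨h | h, h'⟩ | h
    · rw [s1 x h]; exact hT₀ h'
    · rw [s2 x h]; exact hT₁ h'
    · rw [s3 x h.2]; exact hγT _ h.2 _
  obtain ⟨e, he, heT, hes⟩ := hT.2 (n + 1) s hs hsT
  have hmem : ∀ y ∈ closedBall (0 : Fin n → ℝ) 1, ∀ t : I,
      (Fin.cons (2 * (t : ℝ) - 1) y : Fin (n + 1) → ℝ) ∈ closedBall (0 : Fin (n + 1) → ℝ) 1 := by
    intro y hy t
    rw [mem_closedBall_succ, Fin.tail_cons, Fin.cons_zero, abs_le]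
    exact ⟨⟨by linarith [t.2.1], by linarith [t.2.2]⟩, hy⟩
  have hF : ContinuousOn (fun p : (Fin n → ℝ) × I =>
      e (Fin.cons (2 * (p.2 : ℝ) - 1) p.1 : Fin (n + 1) → ℝ)) (closedBall 0 1 ×ˢ univ) := by
    refine he.comp (Continuous.continuousOn ?_) fun p hp => hmem p.1 hp.1 p.2
    exact Continuous.finCons (by fun_prop) (by fun_prop)
  obtain ⟨Γ, hΓ, hΓF⟩ := exists_curry_continuousOn
    (F := fun y t => e (Fin.cons (2 * (t : ℝ) - 1) y : Fin (n + 1) → ℝ)) hF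
  refine ⟨Γ, hΓ, fun y hy => ContinuousMap.ext fun t => ?_, fun y hy => ?_, fun y hy => ?_,
    fun y hy t => ?_⟩
  · rw [hΓF y (sphere_subset_closedBall hy), hes, s3, Fin.tail_cons, Fin.cons_zero, hτt]
    · rwa [Fin.tail_cons]
    · refine mem_sphere_succ.2 (Or.inr ⟨(mem_closedBall_succ.1
        (hmem y (sphere_subset_closedBall hy) t)).1, by rwa [Fin.tail_cons]⟩)
  · have h : (Fin.cons (2 * ((0 : I) : ℝ) - 1) y : Fin (n + 1) → ℝ) 0 = -1 := by simp
    rw [hΓF y hy, hes, s1 _ h, Fin.tail_cons]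
    exact mem_sphere_succ.2 (Or.inl ⟨Or.inl h, by rwa [Fin.tail_cons]⟩)
  · have h : (Fin.cons (2 * ((1 : I) : ℝ) - 1) y : Fin (n + 1) → ℝ) 0 = 1 := by simp; norm_num
    rw [hΓF y hy, hes, s2 _ h, Fin.tail_cons]
    exact mem_sphere_succ.2 (Or.inl ⟨Or.inr h, by rwa [Fin.tail_cons]⟩)
  · rw [hΓF y hy]
    exact heT (hmem y hy t)

/-- The reversed path. -/
def reversePath (γ : C(I, Z)) : C(I, Z) := γ.comp ⟨unitInterval.symm, by fun_prop⟩

theorem continuous_reversePath : Continuous (reversePath : C(I, Z) → C(I, Z)) :=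
  ContinuousMap.continuous_precomp _

/-- A sphere map that is homotopic in `T` to one which extends to the disk extends to the disk. -/
theorem exists_disk_extension_of_homotopy {T : Set Z} {n : ℕ} {γ : (Fin n → ℝ) → C(I, Z)}
    (hγ : ContinuousOn γ (sphere 0 1)) (hγT : ∀ y ∈ sphere (0 : Fin n → ℝ) 1, ∀ t, γ y t ∈ T)
    {u : (Fin n → ℝ) → Z} (hu : ContinuousOn u (closedBall 0 1)) (huT : MapsTo u (closedBall 0 1) T)
    (h1 : ∀ y ∈ sphere (0 : Fin n → ℝ) 1, γ y 1 = u y) :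
    ∃ e : (Fin n → ℝ) → Z, ContinuousOn e (closedBall 0 1) ∧ MapsTo e (closedBall 0 1) T ∧
      ∀ y ∈ sphere (0 : Fin n → ℝ) 1, e y = γ y 0 := by
  -- Run the homotopy backwards starting from `u` and extend it over the disk; the end of the
  -- extension is the required map. It stays in `T` because every value of the extension is a value
  -- of `u` or of the homotopy.
  obtain ⟨Γ, hΓ, hΓγ, -, hΓm⟩ := exists_disk_homotopy_extension hu
    (continuous_reversePath.comp_continuousOn hγ)
    (fun y hy => by simp [reversePath, h1 y hy])
  refine ⟨fun y => Γ y 1, (continuous_path_eval 1).comp_continuousOn hΓ, fun y hy => ?_,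
    fun y hy => ?_⟩
  · rcases hΓm y hy 1 with ⟨z, hz, e⟩ | ⟨z, hz, t', e⟩
    · change Γ y 1 ∈ T
      rw [e]; exact huT hz
    · change Γ y 1 ∈ T
      rw [e]; exact hγT z hz _
  · simp [hΓγ hy, reversePath]

/-- Relative disks can be compressed along a map between spaces with the disk extension
property. -/
theorem DiskExt.exists_compression {Z' : Type*} [TopologicalSpace Z'] {f : Z' → Z}
    (hf : Continuous f) {T' : Set Z'} {T : Set Z} (hT' : DiskExt T') (hT : DiskExt T)
    (hff : MapsTo f T' T) {n : ℕ} {u : (Fin n → ℝ) → Z} (hu : ContinuousOn u (closedBall 0 1))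
    (huT : MapsTo u (closedBall 0 1) T) {γ : (Fin n → ℝ) → C(I, Z)}
    (hγ : ContinuousOn γ (sphere 0 1)) (hγT : ∀ y ∈ sphere (0 : Fin n → ℝ) 1, ∀ t, γ y t ∈ T)
    (h0 : ∀ y ∈ sphere (0 : Fin n → ℝ) 1, γ y 0 = u y)
    {c : (Fin n → ℝ) → Z'} (hc : ContinuousOn c (sphere 0 1)) (hcT : MapsTo c (sphere 0 1) T')
    (h1 : ∀ y ∈ sphere (0 : Fin n → ℝ) 1, γ y 1 = f (c y)) :
    ∃ Γ : (Fin n → ℝ) → C(I, Z), ContinuousOn Γ (closedBall 0 1) ∧ EqOn Γ γ (sphere 0 1) ∧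
      (∀ y ∈ closedBall (0 : Fin n → ℝ) 1, Γ y 0 = u y) ∧
      (∀ y ∈ closedBall (0 : Fin n → ℝ) 1, Γ y 1 ∈ range f) ∧
      ∀ y ∈ closedBall (0 : Fin n → ℝ) 1, ∀ t, Γ y t ∈ T := by
  obtain ⟨c', hc', hcT', hcc⟩ := hT'.2 n c hc hcT
  obtain ⟨Γ, hΓ, hΓγ, hΓ0, hΓ1, hΓT⟩ := hT.exists_homotopy hu (hf.comp_continuousOn hc') huT
    (fun y hy => hff (hcT' hy)) hγ hγT h0 (fun y hy => by rw [h1 y hy, Function.comp, hcc hy])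
  exact ⟨Γ, hΓ, hΓγ, hΓ0, fun y hy => ⟨c' y, (hΓ1 y hy).symm⟩, hΓT⟩

end Disk

/-! ### The sphere as a CW-complex with the faces of the cube as cells -/

/-- A `k`-dimensional proper face of the cube `[-1, 1]ⁿ`, given by a sign vector. -/
structure SphereFace (n k : ℕ) : Type u where
  sign : Fin n → SignType
  ne : ∃ i, sign i ≠ 0
  card : Fintype.card {i // sign i = 0} = k

namespace SphereFace

variable {n k : ℕ}

theorem sigma_ext {k' : ℕ} {σ : SphereFace.{u} n k} {τ : SphereFace.{u} n k'}
    (h : σ.sign = τ.sign) :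
    (⟨k, σ⟩ : Σ k, SphereFace.{u} n k) = ⟨k', τ⟩ := by
  obtain ⟨s, hs, rfl⟩ := σ
  obtain ⟨t, ht, rfl⟩ := τ
  change s = t at h
  subst h
  rfl

/-- The free coordinates of a face. -/
noncomputable def equiv (σ : SphereFace.{u} n k) : {i // σ.sign i = 0} ≃ Fin k :=
  Fintype.equivFinOfCardEq σ.card

/-- The parametrization of a face. -/
noncomputable def toFun (σ : SphereFace.{u} n k) (y : Fin k → ℝ) : Fin n → ℝ := fun i =>
  if h : σ.sign i = 0 then y (σ.equiv ⟨i, h⟩) else (σ.sign i : ℝ)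

theorem toFun_free (σ : SphereFace.{u} n k) (y : Fin k → ℝ) (j : Fin k) :
    σ.toFun y (σ.equiv.symm j) = y j := by
  simp [toFun, (σ.equiv.symm j).2]

theorem toFun_of_ne (σ : SphereFace.{u} n k) (y : Fin k → ℝ) {i : Fin n} (h : σ.sign i ≠ 0) :
    σ.toFun y i = σ.sign i := dif_neg h

theorem toFun_of_eq (σ : SphereFace.{u} n k) (y : Fin k → ℝ) {i : Fin n} (h : σ.sign i = 0) :
    σ.toFun y i = y (σ.equiv ⟨i, h⟩) := dif_pos h

theorem continuous_toFun (σ : SphereFace.{u} n k) : Continuous σ.toFun := by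
  refine continuous_pi fun i => ?_
  by_cases h : σ.sign i = 0
  · simp only [toFun, dif_pos h]
    exact continuous_apply _
  · simp only [toFun, dif_neg h]
    exact continuous_const

theorem abs_coe_sign {s : SignType} (h : s ≠ 0) : |(s : ℝ)| = 1 := by
  cases s <;> simp at h ⊢

theorem coe_sign_injective {s t : SignType} (h : (s : ℝ) = t) : s = t := by
  cases s <;> cases t <;> first | rfl | (norm_num at h)

theorem toFun_mem_sphere (σ : SphereFace.{u} n k) {y : Fin k → ℝ}
    (hy : y ∈ closedBall (0 : Fin k → ℝ) 1) : σ.toFun y ∈ sphere (0 : Fin n → ℝ) 1 := by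
  rw [mem_closedBall_zero_iff, pi_norm_le_iff_of_nonneg zero_le_one] at hy
  rw [mem_sphere_zero_iff_norm]
  refine le_antisymm ((pi_norm_le_iff_of_nonneg zero_le_one).2 fun i => ?_) ?_
  · by_cases h : σ.sign i = 0
    · rw [toFun_of_eq σ y h]
      exact hy _
    · rw [toFun_of_ne σ y h, Real.norm_eq_abs, abs_coe_sign h]
  · obtain ⟨i, hi⟩ := σ.ne
    have := norm_le_pi_norm (σ.toFun y) i
    rwa [toFun_of_ne σ y hi, Real.norm_eq_abs, abs_coe_sign hi] at this

theorem sign_eq_zero_iff (σ : SphereFace.{u} n k) {y : Fin k → ℝ}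
    (hy : y ∈ ball (0 : Fin k → ℝ) 1) (i : Fin n) : σ.sign i = 0 ↔ |σ.toFun y i| < 1 := by
  rw [mem_ball_zero_iff, pi_norm_lt_iff zero_lt_one] at hy
  constructor
  · intro h
    rw [toFun_of_eq σ y h]
    exact hy _
  · intro h
    by_contra h'
    rw [toFun_of_ne σ y h', abs_coe_sign h'] at h
    exact lt_irrefl _ h

/-- The coordinates equal to `±1` determine the face, and the remaining coordinates are its interior
parameters. -/
theorem exists_face (x : Fin n → ℝ) (hx : x ∈ sphere (0 : Fin n → ℝ) 1) :
    ∃ k, ∃ σ : SphereFace.{u} n k, ∃ y ∈ ball (0 : Fin k → ℝ) 1, σ.toFun y = x := by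
  have hx1 : ‖x‖ = 1 := mem_sphere_zero_iff_norm.1 hx
  have hle : ∀ i, |x i| ≤ 1 := fun i => hx1 ▸ norm_le_pi_norm x i
  have hex : ∃ i, |x i| = 1 := by
    by_contra! h
    have : ‖x‖ < 1 := (pi_norm_lt_iff zero_lt_one).2 fun i => lt_of_le_of_ne (hle i) (h i)
    exact this.ne hx1
  let s : Fin n → SignType := fun i => if x i = 1 then 1 else if x i = -1 then -1 else 0
  have hs : ∀ i, s i = 0 ↔ |x i| < 1 := by
    intro i
    have := hle i
    simp only [s]
    split_ifs with h1 h2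
    · simp [h1]
    · simp [h2]
    · simp only [true_iff]
      refine lt_of_le_of_ne this fun h => ?_
      rcases (abs_eq zero_le_one).1 h with h | h
      · exact h1 h
      · exact h2 h
  have hs' : ∀ i, s i ≠ 0 → (s i : ℝ) = x i := by
    intro i hi
    simp only [s] at hi ⊢
    split_ifs with h1 h2
    · simp [h1]
    · simp [h2]
    · simp [h1, h2] at hi
  obtain ⟨i, hi⟩ := hex
  let σ : SphereFace.{u} n _ := ⟨s, ⟨i, fun h => by rw [hs, hi] at h; exact lt_irrefl _ h⟩, rfl⟩
  refine ⟨_, σ, fun j => x (σ.equiv.symm j), ?_, ?_⟩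
  · rw [mem_ball_zero_iff, pi_norm_lt_iff zero_lt_one]
    exact fun j => (hs _).1 (σ.equiv.symm j).2
  · funext i
    by_cases h : σ.sign i = 0
    · rw [toFun_of_eq _ _ h, Equiv.symm_apply_apply]
    · rw [toFun_of_ne _ _ h]
      exact hs' i h

theorem sign_eq_of_toFun_eq {k' : ℕ} {σ : SphereFace.{u} n k} {τ : SphereFace.{u} n k'}
    {y : Fin k → ℝ} (hy : y ∈ ball (0 : Fin k → ℝ) 1) {z : Fin k' → ℝ}
    (hz : z ∈ ball (0 : Fin k' → ℝ) 1) (h : σ.toFun y = τ.toFun z) : σ.sign = τ.sign := by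
  funext i
  by_cases h0 : σ.sign i = 0
  · have h1 := (σ.sign_eq_zero_iff hy i).1 h0
    rw [h] at h1
    rw [h0, (τ.sign_eq_zero_iff hz i).2 h1]
  · have h1 := mt (σ.sign_eq_zero_iff hy i).2 h0
    rw [h] at h1
    have h2 := mt (τ.sign_eq_zero_iff hz i).1 h1
    have h3 := congrFun h i
    rw [toFun_of_ne _ _ h0, toFun_of_ne _ _ h2] at h3
    exact coe_sign_injective h3

/-- A boundary point of a face has an additional coordinate equal to `±1`, so the open face that
contains it has fewer free coordinates. -/
theorem lt_of_toFun_eq {k' : ℕ} {σ : SphereFace.{u} n k} {τ : SphereFace.{u} n k'}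
    {y : Fin k → ℝ} (hy : y ∈ sphere (0 : Fin k → ℝ) 1) {z : Fin k' → ℝ}
    (hz : z ∈ ball (0 : Fin k' → ℝ) 1) (h : σ.toFun y = τ.toFun z) : k' < k := by
  have hzero : ∀ i, τ.sign i = 0 → σ.sign i = 0 := by
    intro i hi
    by_contra h0
    rw [τ.sign_eq_zero_iff hz, ← h, toFun_of_ne _ _ h0, abs_coe_sign h0] at hi
    exact lt_irrefl _ hi
  have hex : ∃ j, ¬ |y j| < 1 := by
    by_contra! h'
    have : ‖y‖ < 1 := (pi_norm_lt_iff zero_lt_one).2 h'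
    exact this.ne (mem_sphere_zero_iff_norm.1 hy)
  obtain ⟨j, hj⟩ := hex
  rw [← σ.card, ← τ.card]
  refine Fintype.card_lt_of_injective_of_notMem (fun i => ⟨i.1, hzero i.1 i.2⟩)
    (fun a b hab => Subtype.ext (congrArg (fun x => x.1) hab)) (b := σ.equiv.symm j) ?_
  rintro ⟨⟨i, hi⟩, e⟩
  rw [τ.sign_eq_zero_iff hz, ← h] at hi
  have : i = σ.equiv.symm j := congrArg (fun x => x.1) e
  rw [this, toFun_free] at hi
  exact hj hi

instance : Finite (Σ k, SphereFace.{u} n k) :=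
  Finite.of_injective (fun σ => σ.2.sign) fun _ _ h => sigma_ext h

end SphereFace

/-- The unit sphere of `Fin n → ℝ` for the supremum norm. -/
def SphereSpace (n : ℕ) : Type u := ULift.{u} (sphere (0 : Fin n → ℝ) 1)

instance (n : ℕ) : TopologicalSpace (SphereSpace.{u} n) :=
  inferInstanceAs (TopologicalSpace (ULift.{u} (sphere (0 : Fin n → ℝ) 1)))

instance (n : ℕ) : T2Space (SphereSpace.{u} n) :=
  inferInstanceAs (T2Space (ULift.{u} (sphere (0 : Fin n → ℝ) 1)))

namespace SphereSpace

variable {n : ℕ}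

/-- The inclusion of the sphere. -/
def val (x : SphereSpace.{u} n) : Fin n → ℝ := x.down.1

/-- A point of the sphere. -/
def mk (y : Fin n → ℝ) (hy : y ∈ sphere (0 : Fin n → ℝ) 1) : SphereSpace.{u} n := ⟨⟨y, hy⟩⟩

theorem val_mem (x : SphereSpace.{u} n) : x.val ∈ sphere (0 : Fin n → ℝ) 1 := x.down.2

theorem continuous_val : Continuous (val : SphereSpace.{u} n → _) :=
  continuous_subtype_val.comp continuous_uliftDown

theorem val_injective : Function.Injective (val : SphereSpace.{u} n → _) := fun _ _ h =>
  ULift.ext _ _ (Subtype.ext h)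

theorem continuous_mk {E : Type*} [TopologicalSpace E] {f : E → Fin n → ℝ} (hf : Continuous f)
    (h : ∀ x, f x ∈ sphere (0 : Fin n → ℝ) 1) : Continuous fun x => mk.{u} (f x) (h x) :=
  continuous_uliftUp.comp (hf.subtype_mk h)

variable (K : Type u) [Group K]

/-- The trivial action on the sphere. -/
instance : MulAction K (SphereSpace.{u} n) where
  smul _ x := x
  one_smul _ := rfl
  mul_smul _ _ _ := rfl

theorem smul_eq (k : K) (x : SphereSpace.{u} n) : k • x = x := rfl

instance : ContinuousConstSMul K (SphereSpace.{u} n) := ⟨fun _ => continuous_id⟩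

open Classical in
/-- The sphere with trivial action as an equivariant CW-complex. -/
noncomputable def gcw (n : ℕ) : GCWComplex K (SphereSpace.{u} n) :=
  let map : ∀ k, SphereFace.{u} n k → (Fin k → ℝ) → SphereSpace.{u} n := fun _ σ y =>
    if h : σ.toFun y ∈ sphere (0 : Fin n → ℝ) 1 then mk _ h
    else mk _ (σ.toFun_mem_sphere (y := 0) (by simp))
  have hmap : ∀ k (σ : SphereFace.{u} n k), ∀ y ∈ closedBall (0 : Fin k → ℝ) 1,
      (map k σ y).val = σ.toFun y := by
    intro k σ y hy
    simp only [map, dif_pos (σ.toFun_mem_sphere hy)]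
    rfl
  have hcont : ∀ k (σ : SphereFace.{u} n k), ContinuousOn (map k σ) (closedBall 0 1) := by
    intro k σ
    rw [continuousOn_iff_continuous_domRestrict]
    refine (continuous_mk (σ.continuous_toFun.comp continuous_subtype_val)
      fun y => σ.toFun_mem_sphere y.2).congr fun y => val_injective (hmap k σ y y.2).symm
  { t2 := inferInstance
    cell := SphereFace.{u} n
    stab := fun _ _ => ⊤
    map := map
    continuousOn := hcont
    smul_map := fun _ _ _ _ _ _ => rfl
    cover := by
      intro x
      obtain ⟨k, σ, y, hy, e⟩ := SphereFace.exists_face.{u} x.val x.val_mem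
      refine ⟨k, σ, 1, y, hy, val_injective ?_⟩
      rw [one_smul, hmap k σ y (ball_subset_closedBall hy), e]
    disjoint := by
      intro k σ k' τ g y hy z hz h
      have h' := congrArg val h
      rw [smul_eq, hmap k σ y (ball_subset_closedBall hy),
        hmap k' τ z (ball_subset_closedBall hz)] at h'
      exact SphereFace.sigma_ext (SphereFace.sign_eq_of_toFun_eq hy hz h')
    inj := by
      intro k σ g y hy z hz h
      have h' := congrArg val h
      rw [smul_eq, hmap k σ y (ball_subset_closedBall hy),
        hmap k σ z (ball_subset_closedBall hz)] at h'
      refine ⟨Subgroup.mem_top _, funext fun j => ?_⟩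
      rw [← σ.toFun_free y j, h', σ.toFun_free]
    frontier := by
      intro k σ
      have : Fintype (Σ k, SphereFace.{u} n k) := Fintype.ofFinite _
      refine ⟨(Finset.univ.filter fun c : Σ k, SphereFace.{u} n k => c.1 < k).image
        fun c => (1, c), ?_, ?_⟩
      · intro c hc
        obtain ⟨d, hd, rfl⟩ := Finset.mem_image.1 hc
        exact (Finset.mem_filter.1 hd).2
      · intro y hy
        have hy' := sphere_subset_closedBall hy
        obtain ⟨k', τ, z, hz, e⟩ := SphereFace.exists_face.{u} _ (map k σ y).val_mem
        refine ⟨(1, ⟨k', τ⟩), Finset.mem_image_of_mem _ (Finset.mem_filter.2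
          ⟨Finset.mem_univ _, ?_⟩), z, ball_subset_closedBall hz, val_injective ?_⟩
        · rw [hmap k σ y hy'] at e
          exact SphereFace.lt_of_toFun_eq hy hz e.symm
        · rw [one_smul, hmap k' τ z (ball_subset_closedBall hz), e]
    weak := by
      intro A hA
      -- There are finitely many faces, so `A` is a finite union of compact images of its closed
      -- traces.
      have hA' : A = ⋃ c : Σ k, SphereFace.{u} n k, map c.1 c.2 ''
          {y | y ∈ closedBall (0 : Fin c.1 → ℝ) 1 ∧ map c.1 c.2 y ∈ A} := by
        ext x
        simp only [mem_iUnion, mem_image, mem_ofPred_eq]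
        constructor
        · intro hx
          obtain ⟨k, σ, y, hy, e⟩ := SphereFace.exists_face.{u} x.val x.val_mem
          have hxy : map k σ y = x :=
            val_injective (by rw [hmap k σ y (ball_subset_closedBall hy), e])
          exact ⟨⟨k, σ⟩, y, ⟨ball_subset_closedBall hy, hxy.symm ▸ hx⟩, hxy⟩
        · rintro ⟨c, y, ⟨-, hy⟩, rfl⟩
          exact hy
      rw [hA']
      refine isClosed_iUnion_of_finite fun c => IsCompact.isClosed ?_
      refine ((isCompact_closedBall _ _).of_isClosed_subset (hA c.1 c.2 1) fun y hy => hy.1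
        ).image_of_continuousOn ((hcont c.1 c.2).mono fun y hy => hy.1) }

end SphereSpace

/-! ### Maps out of induced spaces -/

section Lift

variable {G : Type u} [Group G] {N : Subgroup G} {X : Type u} [MulAction N X]
  {W : Type*} [MulAction G W]

/-- The `G`-map `G ×_N X → W` induced by an `N`-map `X → W`. -/
def Induced.lift (φ : X →[N] W) : Induced N X →[G] W where
  toFun := Quotient.lift (s := inducedSetoid N X) (fun p => p.1 • φ p.2) (by
    rintro ⟨g, x⟩ ⟨g', x'⟩ ⟨n, h₁, h₂⟩
    change g • φ x = g' • φ x'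
    change g = g' * n at h₁
    change x' = n • x at h₂
    rw [h₁, h₂, map_smul, mul_smul]
    rfl)
  map_smul' a p := by
    obtain ⟨g, x, rfl⟩ := p.exists_mk
    exact mul_smul a g (φ x)

theorem Induced.lift_mk (φ : X →[N] W) (g : G) (x : X) :
    Induced.lift φ (Induced.mk N g x) = g • φ x := rfl

theorem Induced.mk_smul {g : G} {n : N} {x : X} :
    Induced.mk N g (n • x) = Induced.mk N (g * n) x :=
  (Induced.mk_eq_iff.2 ⟨n, rfl, rfl⟩).symm

variable [TopologicalSpace X]

theorem Induced.continuous_of_mk {Z : Type*} [TopologicalSpace Z] {f : Induced N X → Z}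
    (h : ∀ g, Continuous fun x => f (Induced.mk N g x)) : Continuous f :=
  continuous_def.2 fun _ hs => Induced.isOpen_iff.2 fun g => (h g).isOpen_preimage _ hs

theorem Induced.continuous_lift [TopologicalSpace W] [ContinuousConstSMul G W] {φ : X →[N] W}
    (hφ : Continuous φ) : Continuous (Induced.lift φ) :=
  Induced.continuous_of_mk fun g => hφ.const_smul g

end Lift

/-! ### Fixed points of models -/

section Fixed

variable {G : Type u} [Group G] {X : Type u} [MulAction G X]

variable (X) in
/-- The fixed point set of a subgroup. -/
def fixedSet (K : Subgroup G) : Set X := {x | ∀ k ∈ K, k • x = x}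

theorem mem_fixedSet_iff_le {K : Subgroup G} {x : X} :
    x ∈ fixedSet X K ↔ K ≤ MulAction.stabilizer G x := Iff.rfl

open unitInterval in
/-- The fixed point sets of a model for `E_F(G)` have the disk extension property. -/
theorem GCWComplex.IsModel.diskExt [TopologicalSpace X] [ContinuousConstSMul G X] {S : GCWComplex G X}
    {F : SubgroupFamily G} (hS : S.IsModel F) {K : Subgroup G} (hK : K ∈ F) :
    DiskExt (fixedSet X K) := by
  classical
  -- The test complexes `G/K × Sⁿ⁻¹`. Their isotropy groups are contained in conjugates of `K` and
  -- so belong to `F`.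
  let T : ∀ n, GCWComplex G (Induced K (SphereSpace.{u} n)) := fun n =>
    (SphereSpace.gcw K n).induced
  have hmk : ∀ n (k : G) (_ : k ∈ K) (x : SphereSpace.{u} n),
      Induced.mk K k x = Induced.mk K 1 x := fun n k hk x =>
    Induced.mk_eq_iff.2 ⟨⟨k, hk⟩, by simp, rfl⟩
  have hT : ∀ n (y : Induced K (SphereSpace.{u} n)), MulAction.stabilizer G y ∈ F := by
    intro n y
    obtain ⟨g, x, rfl⟩ := y.exists_mk
    refine F.le_mem _ ((F.conj_mem_iff g K).2 hK) _ fun a ha => ?_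
    rw [MulAction.mem_stabilizer_iff, Induced.smul_mk, Induced.mk_eq_iff] at ha
    obtain ⟨m, hm, -⟩ := ha
    rw [Subgroup.mem_pointwise_smul_iff_inv_smul_mem]
    have : (MulAut.conj g)⁻¹ • a = m := by
      rw [← map_inv, MulAut.smul_def, MulAut.conj_apply, inv_inv, mul_assoc, hm]
      simp
    rw [this]
    exact m.2
  -- The sphere `S⁰` has a point, and the coset of `1` in `G/K` is fixed by `K`; its image in `X` is
  -- a fixed point of `K`.
  obtain ⟨x₀, hx₀⟩ : ∃ x₀, x₀ ∈ fixedSet X K := by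
    obtain ⟨f, -⟩ := hS.exists_map _ (T 1) (hT 1)
    have h1 : (fun _ => 1 : Fin 1 → ℝ) ∈ sphere (0 : Fin 1 → ℝ) 1 := by
      rw [mem_sphere_zero_iff_norm, pi_norm_const]
      simp
    refine ⟨f (Induced.mk K 1 (SphereSpace.mk _ h1)), fun k hk => ?_⟩
    rw [← map_smul, Induced.smul_mk, mul_one, hmk _ _ hk]
  refine ⟨⟨x₀, hx₀⟩, fun n s hs hsT => ?_⟩
  -- The given sphere in `X^K` and a constant one induce `G`-maps `G/K × Sⁿ⁻¹ → X`. A `G`-homotopy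
  -- between them, restricted to the coset of `1`, is a nullhomotopy inside `X^K`.
  let φ : SphereSpace.{u} n →[K] X := ⟨fun x => s x.val, fun k x => (hsT x.val_mem k k.2).symm⟩
  let c : SphereSpace.{u} n →[K] X := ⟨fun _ => x₀, fun k _ => (hx₀ k k.2).symm⟩
  have hφ : Continuous φ := hs.comp_continuous SphereSpace.continuous_val fun x => x.val_mem
  obtain ⟨h, hh, hh0, hh1⟩ := hS.homotopic _ (T n) (hT n) (Induced.lift φ) (Induced.lift c)
    (Induced.continuous_lift hφ) (Induced.continuous_lift continuous_const)
  obtain ⟨γ, hγ, hγF⟩ := exists_curry_continuousOn (A := sphere (0 : Fin n → ℝ) 1)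
    (F := fun y t => if hy : y ∈ sphere (0 : Fin n → ℝ) 1 then
      h t (Induced.mk K 1 (SphereSpace.mk y hy)) else x₀) (by
      rw [continuousOn_iff_continuous_domRestrict]
      have : Continuous fun p : (sphere (0 : Fin n → ℝ) 1 ×ˢ univ : Set ((Fin n → ℝ) × I)) =>
          h p.1.2 (Induced.mk K 1 (SphereSpace.mk p.1.1 p.2.1)) :=
        hh.comp ((continuous_snd.comp continuous_subtype_val).prodMk
          ((Induced.continuous_mk 1).comp (SphereSpace.continuous_mk
            (continuous_fst.comp continuous_subtype_val) fun p => p.2.1)))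
      refine this.congr fun p => ?_
      have hp : p.1.1 ∈ sphere (0 : Fin n → ℝ) 1 := p.2.1
      simp only [Set.domRestrict, dif_pos hp])
  obtain ⟨e, he, heT, hes⟩ := exists_disk_extension_of_homotopy (T := fixedSet X K) hγ
    (fun y hy t k hk => by
      rw [hγF y hy, dif_pos hy, ← map_smul, Induced.smul_mk, mul_one, hmk _ _ hk])
    (u := fun _ => x₀) continuousOn_const (fun _ _ => hx₀) (fun y hy => by
      rw [hγF y hy, dif_pos hy, hh1, Induced.lift_mk, one_smul]
      rfl)
  refine ⟨e, he, heT, fun y hy => ?_⟩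
  rw [hes y hy, hγF y hy, dif_pos hy, hh0, Induced.lift_mk, one_smul]
  rfl

end Fixed

/-! ### Existence of pushouts -/

section Construction

variable {G : Type u} [Group G] {A B C : Type u}
  [TopologicalSpace A] [MulAction G A] [TopologicalSpace B] [MulAction G B] [MulAction G C]

/-- The relation that glues `A` and `B` along `C`. -/
inductive GPushoutRel (i : C →[G] A) (f : C →[G] B) : A ⊕ B → A ⊕ B → Prop
  | glue (c : C) : GPushoutRel i f (Sum.inl (i c)) (Sum.inr (f c))

/-- The pushout of `G`-spaces. -/
def GPushout (i : C →[G] A) (f : C →[G] B) : Type u := Quot (GPushoutRel i f)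

variable (i : C →[G] A) (f : C →[G] B)

instance : TopologicalSpace (GPushout i f) :=
  inferInstanceAs (TopologicalSpace (Quot (GPushoutRel i f)))

instance : MulAction G (GPushout i f) where
  smul g := Quot.map (fun x => g • x) (by
    rintro _ _ ⟨c⟩
    have := GPushoutRel.glue (i := i) (f := f) (g • c)
    rw [map_smul, map_smul] at this
    exact this)
  one_smul := by
    rintro ⟨x⟩
    exact congrArg (Quot.mk _) (one_smul G x)
  mul_smul g g' := by
    rintro ⟨x⟩
    exact congrArg (Quot.mk _) (mul_smul g g' x)

/-- The left map into the pushout. -/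
def GPushout.inl : A →[G] GPushout i f := ⟨fun z => Quot.mk _ (Sum.inl z), fun _ _ => rfl⟩

/-- The right map into the pushout. -/
def GPushout.inr : B →[G] GPushout i f := ⟨fun z => Quot.mk _ (Sum.inr z), fun _ _ => rfl⟩

theorem GPushout.continuous_inl : Continuous (GPushout.inl i f) :=
  continuous_quot_mk.comp _root_.continuous_inl

theorem GPushout.continuous_inr : Continuous (GPushout.inr i f) :=
  continuous_quot_mk.comp _root_.continuous_inr

theorem GPushout.isClosed_of {T : Set (GPushout i f)} (hA : IsClosed (GPushout.inl i f ⁻¹' T))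
    (hB : IsClosed (GPushout.inr i f ⁻¹' T)) : IsClosed T := by
  have hq : IsQuotientMap (Quot.mk (GPushoutRel i f)) := isQuotientMap_quot_mk
  exact hq.isClosed_preimage.1 (isClosed_sum_iff.2 ⟨hA, hB⟩)

theorem GPushout.continuous_of {Z : Type*} [TopologicalSpace Z] {k : GPushout i f → Z}
    (h1 : Continuous fun z => k (GPushout.inl i f z))
    (h2 : Continuous fun y => k (GPushout.inr i f y)) : Continuous k :=
  isQuotientMap_quot_mk.continuous_iff.2 (continuous_sumElim.2 ⟨h1, h2⟩ |>.congr (by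
    rintro (z | y) <;> rfl))

instance [ContinuousConstSMul G A] [ContinuousConstSMul G B] :
    ContinuousConstSMul G (GPushout i f) where
  continuous_const_smul g := GPushout.continuous_of i f
    ((GPushout.continuous_inl i f).comp (continuous_const_smul g))
    ((GPushout.continuous_inr i f).comp (continuous_const_smul g))

theorem GPushout.isGPushout [TopologicalSpace C] :
    IsGPushout i f (GPushout.inl i f) (GPushout.inr i f) where
  continuous_left := GPushout.continuous_inl i f
  continuous_right := GPushout.continuous_inr i f
  comm c := Quot.sound ⟨c⟩
  universal Z _ _ _ p q hp hq hpq := by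
    let k : GPushout i f →[G] Z := ⟨Quot.lift (Sum.elim p q) (by rintro _ _ ⟨c⟩; exact hpq c), by
      rintro g ⟨z | y⟩
      · exact map_smul p g z
      · exact map_smul q g y⟩
    refine ⟨k, ⟨GPushout.continuous_of i f hp hq, fun _ => rfl, fun _ => rfl⟩, ?_⟩
    rintro k' ⟨-, h1, h2⟩
    ext ⟨z | y⟩
    · exact h1 z
    · exact h2 y

end Construction

/-! ### Points and topology of an arbitrary pushout -/

namespace IsGPushout

variable {G : Type u} [Group G] {A B C X : Type u}
  [TopologicalSpace A] [MulAction G A] [TopologicalSpace B] [MulAction G B]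
  [TopologicalSpace C] [MulAction G C] [TopologicalSpace X] [MulAction G X]
  {i : C →[G] A} {f : C →[G] B} {a : A →[G] X} {b : B →[G] X}

theorem symm (h : IsGPushout i f a b) : IsGPushout f i b a where
  continuous_left := h.continuous_right
  continuous_right := h.continuous_left
  comm c := (h.comm c).symm
  universal Z _ _ _ p q hp hq hpq := by
    obtain ⟨k, ⟨h1, h2, h3⟩, h4⟩ := h.universal Z q p hq hp fun c => (hpq c).symm
    exact ⟨k, ⟨h1, h3, h2⟩, fun k' hk' => h4 k' ⟨hk'.1, hk'.2.2, hk'.2.1⟩⟩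

/-- The underlying square of `G`-sets is a pushout. -/
theorem existsUnique_map (h : IsGPushout i f a b) {Z : Type u} [MulAction G Z] (p : A →[G] Z)
    (q : B →[G] Z) (hpq : ∀ c, p (i c) = q (f c)) :
    ∃! k : X →[G] Z, (∀ x, k (a x) = p x) ∧ ∀ y, k (b y) = q y := by
  -- Every map to an indiscrete space is continuous, so the universal property becomes one of
  -- `G`-sets.
  let _ : TopologicalSpace Z := ⊤
  have : ContinuousConstSMul G Z := ⟨fun _ => continuous_top⟩
  obtain ⟨k, ⟨-, h2⟩, h4⟩ := h.universal Z p q continuous_top continuous_top hpq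
  exact ⟨k, h2, fun k' hk' => h4 k' ⟨continuous_top, hk'⟩⟩

/-- The constant predicate `True` and the predicate of lying in the image of `a` or `b` are both
`G`-maps to `Prop` with trivial action. They agree on `A` and on `B`, hence everywhere. -/
theorem surjective (h : IsGPushout i f a b) (x : X) : (∃ z, a z = x) ∨ ∃ y, b y = x := by
  let _ : MulAction G (ULift.{u} Prop) :=
    { smul := fun _ z => z, one_smul := fun _ => rfl, mul_smul := fun _ _ _ => rfl }
  have hsm : ∀ (g : G) (z : ULift.{u} Prop), g • z = z := fun _ _ => rfl
  have ha : ∀ (g : G) (x : X), (∃ z, a z = x) → ∃ z, a z = g • x := by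
    rintro g _ ⟨z, rfl⟩
    exact ⟨g • z, map_smul a g z⟩
  have hb : ∀ (g : G) (x : X), (∃ z, b z = x) → ∃ z, b z = g • x := by
    rintro g _ ⟨z, rfl⟩
    exact ⟨g • z, map_smul b g z⟩
  let k₁ : X →[G] ULift.{u} Prop := ⟨fun _ => ⟨True⟩, fun _ _ => rfl⟩
  let k₂ : X →[G] ULift.{u} Prop := ⟨fun x => ⟨(∃ z, a z = x) ∨ ∃ y, b y = x⟩, fun g x => by
    refine congrArg ULift.up (propext ⟨fun hx => ?_, fun hx => ?_⟩)
    · have := hx.imp (ha g⁻¹ _) (hb g⁻¹ _)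
      rwa [inv_smul_smul] at this
    · exact hx.imp (ha g _) (hb g _)⟩
  obtain ⟨k, -, hk⟩ := h.existsUnique_map (Z := ULift.{u} Prop) ⟨fun _ => ⟨True⟩, fun _ _ => rfl⟩
    ⟨fun _ => ⟨True⟩, fun _ _ => rfl⟩ fun _ => rfl
  have e1 : k₁ = k := hk k₁ ⟨fun _ => rfl, fun _ => rfl⟩
  have e2 : k₂ = k := hk k₂ ⟨fun z => congrArg ULift.up (eq_true (Or.inl ⟨z, rfl⟩)),
    fun z => congrArg ULift.up (eq_true (Or.inr ⟨z, rfl⟩))⟩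
  have e3 : k₁ x = k₂ x := by rw [e1, e2]
  exact (congrArg ULift.down e3).mp trivial

/-- The identity of `X` factors continuously through the explicit pushout, whose topology is final
by construction. -/
theorem isClosed_iff [ContinuousConstSMul G A] [ContinuousConstSMul G B] [ContinuousConstSMul G X]
    (h : IsGPushout i f a b) {T : Set X} : IsClosed T ↔ IsClosed (a ⁻¹' T) ∧ IsClosed (b ⁻¹' T) := by
  refine ⟨fun hT => ⟨hT.preimage h.continuous_left, hT.preimage h.continuous_right⟩,
    fun ⟨hA, hB⟩ => ?_⟩
  obtain ⟨k, ⟨hk, hka, hkb⟩, -⟩ := h.universal (GPushout i f) (GPushout.inl i f)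
    (GPushout.inr i f) (GPushout.continuous_inl i f) (GPushout.continuous_inr i f)
    (GPushout.isGPushout i f).comm
  obtain ⟨k', ⟨-, hka', hkb'⟩, -⟩ := (GPushout.isGPushout i f).universal X a b h.continuous_left
    h.continuous_right h.comm
  have hid : ∀ x, k' (k x) = x := by
    intro x
    rcases h.surjective x with ⟨z, rfl⟩ | ⟨z, rfl⟩
    · rw [hka, hka']
    · rw [hkb, hkb']
  have hT : IsClosed (k' ⁻¹' T) := by
    refine GPushout.isClosed_of i f ?_ ?_
    · simpa only [preimage_preimage, hka'] using hA
    · simpa only [preimage_preimage, hkb'] using hB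
  have := hT.preimage hk
  simpa only [preimage_preimage, hid, preimage_id'] using this

theorem continuous_iff [ContinuousConstSMul G A] [ContinuousConstSMul G B]
    [ContinuousConstSMul G X] (h : IsGPushout i f a b) {Z : Type*} [TopologicalSpace Z]
    {k : X → Z} : Continuous k ↔ (Continuous fun z => k (a z)) ∧ Continuous fun y => k (b y) := by
  refine ⟨fun hk => ⟨hk.comp h.continuous_left, hk.comp h.continuous_right⟩, fun ⟨h1, h2⟩ => ?_⟩
  refine continuous_iff_isClosed.2 fun T hT => h.isClosed_iff.2 ⟨hT.preimage h1, hT.preimage h2⟩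

/-- The square is tested against `B ⊕ A`: a point of `A` in the range of `i` goes to `B` along `f`,
any other point of `A` stays where it is. This target separates everything that the gluing does not
identify. -/
theorem map_eq_of_injective (h : IsGPushout i f a b) (hi : Function.Injective i) :
    Function.Injective b ∧ (∀ z y, a z = b y → ∃ c, i c = z ∧ f c = y) ∧
      ∀ z z', a z = a z' → z = z' ∨ z ∈ range i := by
  classical
  let p : A →[G] (B ⊕ A) := ⟨fun z => if hz : ∃ c, i c = z then Sum.inl (f hz.choose) else Sum.inr z,
    fun g z => by
      by_cases hz : ∃ c, i c = z
      · obtain ⟨c, rfl⟩ := hz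
        have h1 : ∃ c', i c' = i c := ⟨c, rfl⟩
        have h2 : ∃ c', i c' = g • i c := ⟨g • c, map_smul i g c⟩
        have e1 : h1.choose = c := hi h1.choose_spec
        have e2 : h2.choose = g • c := hi (h2.choose_spec.trans (map_smul i g c).symm)
        simp only [dif_pos h1, dif_pos h2, e1, e2, map_smul, id]
        rfl
      · have h2 : ¬ ∃ c', i c' = g • z := by
          rintro ⟨c, hc⟩
          exact hz ⟨g⁻¹ • c, by rw [map_smul, hc, inv_smul_smul]⟩
        simp only [dif_neg hz, dif_neg h2, id]
        rfl⟩
  let q : B →[G] (B ⊕ A) := ⟨Sum.inl, fun _ _ => rfl⟩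
  have hpi : ∀ c, p (i c) = Sum.inl (f c) := by
    intro c
    have h1 : ∃ c', i c' = i c := ⟨c, rfl⟩
    have e1 : h1.choose = c := hi h1.choose_spec
    change dite _ _ _ = _
    rw [dif_pos h1, e1]
  have hpn : ∀ z, z ∉ range i → p z = Sum.inr z := fun z hz => dif_neg hz
  obtain ⟨k, ⟨hka, hkb⟩, -⟩ := h.existsUnique_map p q hpi
  refine ⟨fun y y' hy => ?_, fun z y hzy => ?_, fun z z' hz => ?_⟩
  · have := congrArg k hy
    rw [hkb, hkb] at this
    exact Sum.inl_injective this
  · have := congrArg k hzy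
    rw [hka, hkb] at this
    by_cases hz : z ∈ range i
    · obtain ⟨c, rfl⟩ := hz
      rw [hpi] at this
      exact ⟨c, rfl, Sum.inl_injective this⟩
    · rw [hpn z hz] at this
      exact absurd this Sum.inr_ne_inl
  · by_contra! hne
    have := congrArg k hz
    rw [hka, hka, hpn z hne.2] at this
    by_cases hz' : z' ∈ range i
    · obtain ⟨c, rfl⟩ := hz'
      rw [hpi] at this
      exact Sum.inr_ne_inl this
    · rw [hpn z' hz'] at this
      exact hne.1 (Sum.inr_injective this)

/-- Functions on a pushout, not necessarily equivariant. -/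
theorem exists_function (h : IsGPushout i f a b) (hi : Function.Injective i) {Z : Type*}
    (p : A → Z) (q : B → Z) (hpq : ∀ c, p (i c) = q (f c)) :
    ∃ k : X → Z, (∀ z, k (a z) = p z) ∧ ∀ y, k (b y) = q y := by
  classical
  obtain ⟨hb, hab, haa⟩ := h.map_eq_of_injective hi
  by_cases hne : Nonempty Z
  · obtain ⟨z₀⟩ := hne
    let k : X → Z := fun x => if hx : ∃ y, b y = x then q hx.choose else
      if hx : ∃ z, a z = x then p hx.choose else z₀
    have hkb : ∀ y, k (b y) = q y := by
      intro y
      have hy : ∃ y', b y' = b y := ⟨y, rfl⟩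
      have e : hy.choose = y := hb hy.choose_spec
      simp only [k]
      rw [dif_pos hy, e]
    refine ⟨k, fun z => ?_, hkb⟩
    by_cases hz : ∃ y, b y = a z
    · obtain ⟨y, hy⟩ := hz
      obtain ⟨c, rfl, rfl⟩ := hab z y hy.symm
      rw [← hy, hkb, hpq]
    · have hz' : ∃ z', a z' = a z := ⟨z, rfl⟩
      have e : hz'.choose = z := by
        refine ((haa _ _ hz'.choose_spec.symm).resolve_right ?_).symm
        rintro ⟨c, rfl⟩
        exact hz ⟨f c, (h.comm c).symm⟩
      simp only [k]
      rw [dif_neg hz, dif_pos hz', e]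
  · have hx : X → False := fun x => by
      rcases h.surjective x with ⟨z, -⟩ | ⟨y, -⟩
      · exact hne ⟨p z⟩
      · exact hne ⟨q y⟩
    exact ⟨fun x => (hx x).elim, fun z => (hx (a z)).elim, fun y => (hx (b y)).elim⟩

section Closed

variable [ContinuousConstSMul G A] [ContinuousConstSMul G B] [ContinuousConstSMul G X]

/-- Away from the range of `i` nothing is glued, so the preimage of `a '' T` in `A` is `T` and its
preimage in `B` is empty. -/
theorem isClosed_image_left (h : IsGPushout i f a b) (hi : Function.Injective i) {T : Set A}
    (hT : IsClosed T) (hTi : Disjoint T (range i)) : IsClosed (a '' T) := by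
  obtain ⟨-, hab, haa⟩ := h.map_eq_of_injective hi
  rw [Set.disjoint_left] at hTi
  refine h.isClosed_iff.2 ⟨?_, ?_⟩
  · have : a ⁻¹' (a '' T) = T := by
      refine Subset.antisymm ?_ (subset_preimage_image _ _)
      rintro z ⟨z', hz', e⟩
      rw [← (haa z' z e).resolve_right (hTi hz')]
      exact hz'
    rwa [this]
  · have : b ⁻¹' (a '' T) = ∅ := by
      rw [eq_empty_iff_forall_notMem]
      rintro y ⟨z, hz, e⟩
      obtain ⟨c, rfl, -⟩ := hab z y e
      exact hTi hz ⟨c, rfl⟩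
    rw [this]
    exact isClosed_empty

/-- The preimage of `b '' T` in `A` is `i '' (f ⁻¹' T)`, which is closed because `i` is a closed
map. -/
theorem isClosedEmbedding_right (h : IsGPushout i f a b) (hi : IsClosedEmbedding i)
    (hf : Continuous f) : IsClosedEmbedding b := by
  obtain ⟨hb, hab, -⟩ := h.map_eq_of_injective hi.injective
  refine .of_continuous_injective_isClosedMap h.continuous_right hb fun T hT => ?_
  refine h.isClosed_iff.2 ⟨?_, ?_⟩
  · have : a ⁻¹' (b '' T) = i '' (f ⁻¹' T) := by
      ext z
      constructor
      · rintro ⟨y, hy, e⟩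
        obtain ⟨c, rfl, rfl⟩ := hab z y e.symm
        exact ⟨c, hy, rfl⟩
      · rintro ⟨c, hc, rfl⟩
        exact ⟨f c, hc, (h.comm c).symm⟩
    rw [this]
    exact hi.isClosedMap _ (hT.preimage hf)
  · rwa [preimage_image_eq _ hb]

end Closed

end IsGPushout

/-! ### Real functions on complexes; inclusions as subcomplexes -/

namespace GCWComplex

variable {G : Type u} [Group G] {X : Type u} [TopologicalSpace X] [MulAction G X]
  [ContinuousConstSMul G X] {Y : Type u} [TopologicalSpace Y] [MulAction G Y]
  [ContinuousConstSMul G Y]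

/-- Real functions on a subcomplex extend, with finitely many prescribed values. -/
theorem exists_real_extension (S : GCWComplex G X) {D₀ : Set X} (hD₀ : S.IsSubcomplex D₀)
    {φ₀ : X → ℝ} (hφ₀ : ContinuousOn φ₀ D₀) {F : Set X} (hF : F.Finite) (ψ : X → ℝ)
    (h : ∀ x ∈ D₀, x ∈ F → φ₀ x = ψ x) :
    ∃ φ : X → ℝ, Continuous φ ∧ EqOn φ φ₀ D₀ ∧ EqOn φ ψ F := by
  classical
  -- Equivariance under the trivial subgroup is no condition, so the equivariant construction yields
  -- arbitrary functions.
  let _ : MulAction (⊥ : Subgroup G) ℝ :=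
    { smul := fun _ z => z, one_smul := fun _ => rfl, mul_smul := fun _ _ _ => rfl }
  have hsm : ∀ (g : (⊥ : Subgroup G)) (z : ℝ), g • z = z := fun _ _ => rfl
  have : ContinuousConstSMul (⊥ : Subgroup G) ℝ := ⟨fun _ => continuous_id⟩
  have hg : ∀ (g : (⊥ : Subgroup G)) (x : X), g • x = x := by
    intro g x
    rw [Subsingleton.elim g 1, one_smul]
  obtain ⟨φ, hφ, -, hφ0, hφF⟩ := S.exists_equivariant_map_subgroup (⊥ : Subgroup G)
    (fun x (w : ℝ) => x ∈ F → w = ψ x) (fun g x w hw => by rwa [hg, hsm]) D₀ φ₀ hD₀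
    (fun g x hx => by rwa [hg]) hφ₀ (fun g x _ => by rw [hg, hsm]) h (by
      intro n j g _ s hs hsF _
      -- Finitely many interior points of the cell have prescribed values. Together with the sphere
      -- they form a closed set, from which Tietze's theorem extends.
      let M : Set (Fin n → ℝ) := {y | y ∈ ball (0 : Fin n → ℝ) 1 ∧ g • S.map n j y ∈ F}
      have hM : M.Finite := Set.Finite.of_injOn (f := fun y => g • S.map n j y)
        (fun y hy => hy.2) (fun y hy z hz e => ((smul_map_eq_iff hy.1 hz.1).1 e).2) hF
      let q : (Fin n → ℝ) → ℝ := fun y => if y ∈ sphere (0 : Fin n → ℝ) 1 then s y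
        else ψ (g • S.map n j y)
      have hq : ContinuousOn q (sphere 0 1 ∪ M) := by
        refine ContinuousOn.union_of_isClosed ?_ (hM.continuousOn q) isClosed_sphere hM.isClosed
        exact hs.congr fun y hy => if_pos hy
      obtain ⟨e, he⟩ := ContinuousMap.exists_restrict_eq (isClosed_sphere.union hM.isClosed)
        (⟨_, continuousOn_iff_continuous_domRestrict.1 hq⟩ :
          C((sphere (0 : Fin n → ℝ) 1 ∪ M : Set (Fin n → ℝ)), ℝ))
      have he' : ∀ y ∈ sphere (0 : Fin n → ℝ) 1 ∪ M, e y = q y := fun y hy =>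
        congrArg (fun k => k ⟨y, hy⟩) he
      refine ⟨e, e.continuous.continuousOn, fun y hy hyF => ?_, fun _ _ _ _ => rfl, fun y hy => ?_⟩
      · rcases sphere_union_ball hy with hb | hb
        · rw [he' y (Or.inr ⟨hb, hyF⟩)]
          refine if_neg fun hs => ?_
          exact (mem_sphere_iff_closedBall.1 hs).2 hb
        · rw [he' y (Or.inl hb)]
          exact (if_pos hb).trans (hsF y hb hyF)
      · rw [he' y (Or.inl hy)]
        exact if_pos hy)
  exact ⟨φ, hφ, hφ0, hφF⟩

namespace IsInclusion

variable {S : GCWComplex G X} {T : GCWComplex G Y} {f : X →[G] Y}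

theorem subset_range_or_disjoint (hf : S.IsInclusion T f) {n : ℕ} (k : T.cell n) :
    (∃ j : S.cell n, f '' S.openCell n j = T.openCell n k) ∨
      Disjoint (T.openCell n k) (range f) := by
  by_cases h : Disjoint (T.openCell n k) (range f)
  · exact Or.inr h
  · rw [Set.not_disjoint_iff] at h
    obtain ⟨_, hx, x, rfl⟩ := h
    obtain ⟨m, j, hj⟩ := S.exists_mem_openCell x
    obtain ⟨l, hl⟩ := hf.image_openCell m j
    have : f x ∈ T.openCell m l := hl ▸ mem_image_of_mem f hj
    have := openCell_eq_of_mem hx this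
    cases this
    exact Or.inl ⟨j, hl⟩

/-- The range is closed and contains the open cell, and the closed ball is the closure of the open
ball. -/
theorem closedCell_subset_range (hf : S.IsInclusion T f) {n : ℕ} {k : T.cell n} {j : S.cell n}
    (h : f '' S.openCell n j = T.openCell n k) (g : G) {z : Fin n → ℝ}
    (hz : z ∈ closedBall (0 : Fin n → ℝ) 1) : g • T.map n k z ∈ range f := by
  have hcl := T.isClosed_preimage_cell n k g hf.isClosedEmbedding.isClosed_range
  have hb : ball (0 : Fin n → ℝ) 1 ⊆
      {y | y ∈ closedBall (0 : Fin n → ℝ) 1 ∧ g • T.map n k y ∈ range f} := by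
    intro y hy
    refine ⟨ball_subset_closedBall hy, ?_⟩
    have : g • T.map n k y ∈ f '' S.openCell n j := h ▸ ⟨g, y, hy, rfl⟩
    exact image_subset_range _ _ this
  rw [← closure_ball (0 : Fin n → ℝ) one_ne_zero] at hz
  exact (closure_minimal hb hcl hz).2

theorem isSubcomplex_range (hf : S.IsInclusion T f) : T.IsSubcomplex (range f) := by
  intro n k g y hy h z hz
  rcases hf.subset_range_or_disjoint k with ⟨j, hj⟩ | hd
  · exact hf.closedCell_subset_range hj g hz
  · exact absurd h (Set.disjoint_left.1 hd ⟨g, y, hy, rfl⟩)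

theorem map_mem_skeleton_iff (hf : S.IsInclusion T f) {n : ℕ} {x : X} :
    f x ∈ T.skeleton n ↔ x ∈ S.skeleton n := by
  obtain ⟨m, j, hj⟩ := S.exists_mem_openCell x
  obtain ⟨l, hl⟩ := hf.image_openCell m j
  have hfx : f x ∈ T.openCell m l := hl ▸ mem_image_of_mem f hj
  constructor
  · rintro ⟨m', hm', l', h'⟩
    have := openCell_eq_of_mem hfx h'
    cases this
    exact ⟨m, hm', j, hj⟩
  · rintro ⟨m', hm', j', h'⟩
    have := openCell_eq_of_mem hj h'
    cases this
    exact ⟨m, hm', l, hfx⟩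

theorem isCellular (hf : S.IsInclusion T f) : S.IsCellular T f :=
  ⟨hf.isClosedEmbedding.continuous, fun _ _ hx => hf.map_mem_skeleton_iff.2 hx⟩

end IsInclusion

end GCWComplex

/-! ### The CW-structure of a pushout -/

namespace IsGPushout

variable {G : Type u} [Group G] {P Q C X : Type u}
  [TopologicalSpace P] [MulAction G P] [ContinuousConstSMul G P]
  [TopologicalSpace Q] [MulAction G Q] [ContinuousConstSMul G Q]
  [TopologicalSpace C] [MulAction G C] [ContinuousConstSMul G C]
  [TopologicalSpace X] [MulAction G X] [ContinuousConstSMul G X]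
  {j : C →[G] P} {k : C →[G] Q} {p : P →[G] X} {q : Q →[G] X}
  {SP : GCWComplex G P} {SQ : GCWComplex G Q} {SC : GCWComplex G C}

/-- A continuous real function separates the two points. It is built on `Q` with prescribed values
over both points, transported along `k` to the subcomplex `range j`, and extended to `P` with
prescribed values at the other preimages. These are finite in number since `q` is injective and `p`
is injective off `range j`. -/
theorem t2Space (h : IsGPushout j k p q) (hj : SC.IsInclusion SP j) (hk : Continuous k)
    (SQ : GCWComplex G Q) : T2Space X := by
  classical
  obtain ⟨hq, hpq, hpp⟩ := h.map_eq_of_injective hj.isClosedEmbedding.injective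
  refine ⟨fun x x' hne => ?_⟩
  let χ : X → ℝ := fun z => if z = x then 1 else 0
  have hfinQ : {y | q y = x ∨ q y = x'}.Finite :=
    (Set.Subsingleton.finite fun a ha b hb => hq (ha.trans hb.symm)).union
      (Set.Subsingleton.finite fun a ha b hb => hq (ha.trans hb.symm))
  obtain ⟨φQ, hφQ, -, hφQF⟩ := SQ.exists_real_extension (D₀ := ∅)
    (fun _ _ _ _ _ h => absurd h (notMem_empty _)) (φ₀ := fun _ => 0) (continuousOn_empty _) hfinQ
    (fun y => χ (q y)) (fun x hx => absurd hx (notMem_empty _))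
  obtain ⟨φ₀, hφ₀⟩ : ∃ φ₀ : P → ℝ, ∀ c, φ₀ (j c) = φQ (k c) :=
    ⟨fun z => if hz : ∃ c, j c = z then φQ (k hz.choose) else 0, fun c => by
      have hz : ∃ c', j c' = j c := ⟨c, rfl⟩
      have e : hz.choose = c := hj.isClosedEmbedding.injective hz.choose_spec
      simp only [dif_pos hz, e]⟩
  have hφ₀c : ContinuousOn φ₀ (range j) := by
    rw [continuousOn_iff_isClosed]
    refine fun t ht => ⟨j '' ((fun c => φQ (k c)) ⁻¹' t), hj.isClosedEmbedding.isClosedMap _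
      (ht.preimage (hφQ.comp hk)), ?_⟩
    ext z
    constructor
    · rintro ⟨hz, c, rfl⟩
      refine ⟨⟨c, ?_, rfl⟩, c, rfl⟩
      change φQ (k c) ∈ t
      rw [← hφ₀]
      exact hz
    · rintro ⟨⟨c, hc, rfl⟩, -⟩
      refine ⟨?_, c, rfl⟩
      change φ₀ (j c) ∈ t
      rw [hφ₀]
      exact hc
  have hfinP : {z | z ∉ range j ∧ (p z = x ∨ p z = x')}.Finite := by
    have hs : ∀ w, {z | z ∉ range j ∧ p z = w}.Finite := fun w =>
      Set.Subsingleton.finite fun a ha b hb =>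
        (hpp a b (ha.2.trans hb.2.symm)).resolve_right ha.1
    refine ((hs x).union (hs x')).subset ?_
    rintro z ⟨h1, h2 | h2⟩
    · exact Or.inl ⟨h1, h2⟩
    · exact Or.inr ⟨h1, h2⟩
  obtain ⟨φP, hφP, hφPj, hφPF⟩ := SP.exists_real_extension hj.isSubcomplex_range hφ₀c hfinP
    (fun z => χ (p z)) (fun z hz hz' => absurd hz hz'.1)
  obtain ⟨φ, hφp, hφq⟩ := h.exists_function hj.isClosedEmbedding.injective φP φQ fun c => by
    rw [hφPj ⟨c, rfl⟩, hφ₀]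
  have hφ : Continuous φ := h.continuous_iff.2
    ⟨hφP.congr fun z => (hφp z).symm, hφQ.congr fun y => (hφq y).symm⟩
  have hval : ∀ w, w = x ∨ w = x' → φ w = χ w := by
    intro w hw
    have hwq : ∀ y, q y = w → φ w = χ w := by
      rintro y rfl
      rw [hφq]
      exact hφQF hw
    rcases h.surjective w with ⟨z, rfl⟩ | ⟨y, hy⟩
    · by_cases hz : z ∈ range j
      · obtain ⟨c, rfl⟩ := hz
        exact hwq (k c) (h.comm c).symm
      · rw [hφp]
        exact hφPF ⟨hz, hw⟩
    · exact hwq y hy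
  refine separated_by_continuous hφ ?_
  rw [hval x (Or.inl rfl), hval x' (Or.inr rfl)]
  simp only [χ, if_pos, if_neg hne.symm]
  exact one_ne_zero

/-- The CW-structure on the pushout of an inclusion and a cellular map. -/
noncomputable def gcw (h : IsGPushout j k p q) (hj : SC.IsInclusion SP j)
    (hk : SC.IsCellular SQ k) : GCWComplex G X where
  t2 := h.t2Space hj hk.continuous SQ
  cell n := SQ.cell n ⊕ {d : SP.cell n // Disjoint (SP.openCell n d) (range j)}
  stab n c := c.elim (SQ.stab n) fun d => SP.stab n d.1
  map n c y := c.elim (fun d => q (SQ.map n d y)) fun d => p (SP.map n d.1 y)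
  continuousOn := by
    rintro n (d | d)
    · exact h.continuous_right.comp_continuousOn (SQ.continuousOn n d)
    · exact h.continuous_left.comp_continuousOn (SP.continuousOn n d.1)
  smul_map := by
    rintro n (d | d) g hg y hy
    · exact (map_smul q g _).symm.trans (congrArg q (SQ.smul_map n d g hg y hy))
    · exact (map_smul p g _).symm.trans (congrArg p (SP.smul_map n d.1 g hg y hy))
  cover := by
    have hQ : ∀ y : Q, ∃ n, ∃ c : SQ.cell n ⊕ {d : SP.cell n // Disjoint (SP.openCell n d) (range j)},
        ∃ g : G, ∃ z ∈ ball (0 : Fin n → ℝ) 1, g • (c.elim (fun d => q (SQ.map n d z))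
          fun d => p (SP.map n d.1 z)) = q y := by
      intro y
      obtain ⟨n, d, g, z, hz, rfl⟩ := SQ.cover y
      exact ⟨n, Sum.inl d, g, z, hz, (map_smul q g _).symm⟩
    intro x
    rcases h.surjective x with ⟨z, rfl⟩ | ⟨y, rfl⟩
    · obtain ⟨n, d, g, w, hw, hz⟩ := SP.cover z
      rcases hj.subset_range_or_disjoint d with ⟨l, hl⟩ | hd
      · have : z ∈ j '' SC.openCell n l := hl ▸ ⟨g, w, hw, hz⟩
        obtain ⟨c, -, rfl⟩ := this
        obtain ⟨n', c', g', z', hz', e⟩ := hQ (k c)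
        exact ⟨n', c', g', z', hz', e.trans (h.comm c).symm⟩
      · subst hz
        exact ⟨n, Sum.inr ⟨d, hd⟩, g, w, hw, (map_smul p g _).symm⟩
    · exact hQ y
  disjoint := by
    obtain ⟨hq, hpq, hpp⟩ := h.map_eq_of_injective hj.isClosedEmbedding.injective
    rintro n (d | ⟨d, hd⟩) m (c | ⟨c, hc⟩) g y hy z hz e
    · have e' : q (g • SQ.map n d y) = q (SQ.map m c z) := (map_smul q g _).trans e
      have := SQ.disjoint n d m c g y hy z hz (hq e')
      cases this
      rfl
    · have e' : q (g • SQ.map n d y) = p (SP.map m c z) := (map_smul q g _).trans e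
      obtain ⟨x, hx, -⟩ := hpq _ _ e'.symm
      exact absurd ⟨x, hx⟩ (Set.disjoint_left.1 hc ⟨1, z, hz, one_smul _ _⟩)
    · have e' : p (g • SP.map n d y) = q (SQ.map m c z) := (map_smul p g _).trans e
      obtain ⟨x, hx, -⟩ := hpq _ _ e'
      exact absurd ⟨x, hx⟩ (Set.disjoint_left.1 hd ⟨g, y, hy, rfl⟩)
    · have e' : p (g • SP.map n d y) = p (SP.map m c z) := (map_smul p g _).trans e
      rcases hpp _ _ e' with e'' | hr
      · have := SP.disjoint n d m c g y hy z hz e''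
        cases this
        rfl
      · exact absurd hr (Set.disjoint_left.1 hd ⟨g, y, hy, rfl⟩)
  inj := by
    obtain ⟨hq, hpq, hpp⟩ := h.map_eq_of_injective hj.isClosedEmbedding.injective
    rintro n (d | ⟨d, hd⟩) g y hy z hz e
    · have e' : q (g • SQ.map n d y) = q (SQ.map n d z) := (map_smul q g _).trans e
      exact SQ.inj n d g y hy z hz (hq e')
    · have e' : p (g • SP.map n d y) = p (SP.map n d z) := (map_smul p g _).trans e
      rcases hpp _ _ e' with e'' | hr
      · exact SP.inj n d g y hy z hz e''
      · exact absurd hr (Set.disjoint_left.1 hd ⟨g, y, hy, rfl⟩)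
  frontier := by
    classical
    rintro n (d | ⟨d, hd⟩)
    · obtain ⟨s, hs, hs'⟩ := SQ.frontier n d
      refine ⟨s.image fun c => (c.1, ⟨c.2.1, Sum.inl c.2.2⟩), ?_, fun y hy => ?_⟩
      · intro c hc
        obtain ⟨c', hc', rfl⟩ := Finset.mem_image.1 hc
        exact hs c' hc'
      · obtain ⟨c, hc, z, hz, e⟩ := hs' y hy
        exact ⟨_, Finset.mem_image_of_mem _ hc, z, hz, (congrArg q e).trans (map_smul q _ _)⟩
    · obtain ⟨t, ht, ht'⟩ := SP.exists_finset_frontier n d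
      -- A cell of `P` in the range of `j` is not a cell of the pushout. Its image comes from a
      -- compact subset of `Q`, which meets only finitely many open cells.
      have key : ∀ c : G × Σ m, SP.cell m, ∃ s : Finset (G × Σ m, (SQ.cell m ⊕
          {d : SP.cell m // Disjoint (SP.openCell m d) (range j)})),
          (∀ c' ∈ s, c'.2.1 ≤ c.2.1) ∧ ∀ z ∈ ball (0 : Fin c.2.1 → ℝ) 1,
            ∃ c' ∈ s, ∃ w ∈ closedBall (0 : Fin c'.2.1 → ℝ) 1,
              p (c.1 • SP.map c.2.1 c.2.2 z) = c'.1 • (c'.2.2.elim (fun d => q (SQ.map _ d w))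
                fun d => p (SP.map _ d.1 w)) := by
        rintro ⟨g, m, c⟩
        rcases hj.subset_range_or_disjoint c with ⟨l, hl⟩ | hc
        · have hK : IsCompact (k '' (j ⁻¹' ((fun y => g • SP.map m c y) '' closedBall 0 1))) :=
            (hj.isClosedEmbedding.isCompact_preimage
              (SP.isCompact_image_cell m c g isClosed_closedBall subset_rfl)).image hk.continuous
          obtain ⟨s, hs⟩ := GCWComplex.finite_of_isCompact (S := SQ) hK
          refine ⟨(s.filter fun c' => c'.2.1 ≤ m).image fun c => (c.1, ⟨c.2.1, Sum.inl c.2.2⟩),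
            ?_, fun z hz => ?_⟩
          · intro c hc
            obtain ⟨c', hc', rfl⟩ := Finset.mem_image.1 hc
            exact (Finset.mem_filter.1 hc').2
          · obtain ⟨x, hx⟩ := hj.closedCell_subset_range hl g (ball_subset_closedBall hz)
            obtain ⟨c', hc', w, hw, e⟩ := hs (k x) ⟨x, ⟨z, ball_subset_closedBall hz, hx.symm⟩, rfl⟩
            -- Cellularity of `k` bounds the dimension of the cells of `Q` that are met.
            have hsk : k x ∈ SQ.skeleton m := by
              refine hk.mapsTo m (hj.map_mem_skeleton_iff.1 ?_)
              rw [hx]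
              exact GCWComplex.mem_skeleton_closedCell m c g (ball_subset_closedBall hz)
            rw [e, GCWComplex.smul_map_mem_skeleton_iff hw] at hsk
            refine ⟨_, Finset.mem_image_of_mem _ (Finset.mem_filter.2 ⟨hc', hsk⟩), w,
              ball_subset_closedBall hw, ?_⟩
            change p (g • SP.map m c z) = c'.1 • q (SQ.map _ c'.2.2 w)
            rw [← hx, h.comm, e, map_smul]
        · exact ⟨{(g, ⟨m, Sum.inr ⟨c, hc⟩⟩)}, by simp, fun z hz => ⟨_, Finset.mem_singleton_self _,
            z, ball_subset_closedBall hz, map_smul p _ _⟩⟩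
      choose s hs hs' using key
      refine ⟨t.biUnion s, ?_, fun y hy => ?_⟩
      · intro c hc
        obtain ⟨c', hc', hc⟩ := Finset.mem_biUnion.1 hc
        exact (hs c' c hc).trans_lt (ht c' hc')
      · obtain ⟨c, hc, z, hz, e⟩ := ht' y hy
        obtain ⟨c', hc', w, hw, e'⟩ := hs' c z hz
        exact ⟨c', Finset.mem_biUnion.2 ⟨c, hc, hc'⟩, w, hw, (congrArg p e).trans e'⟩
  weak := by
    intro A hA
    have hAQ : IsClosed (q ⁻¹' A) := by
      refine SQ.weak _ fun n d g => ?_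
      have := hA n (Sum.inl d) g
      simp only [Sum.elim_inl, ← map_smul] at this
      exact this
    refine h.isClosed_iff.2 ⟨SP.weak _ fun n d g => ?_, hAQ⟩
    rcases hj.subset_range_or_disjoint d with ⟨l, hl⟩ | hd
    -- On a cell inside the range of `j` the condition is a consequence of closedness in `Q`.
    · have hcl : IsClosed (j '' (k ⁻¹' (q ⁻¹' A))) :=
        hj.isClosedEmbedding.isClosedMap _ (hAQ.preimage hk.continuous)
      have := SP.isClosed_preimage_cell n d g hcl
      have e : {y | y ∈ closedBall (0 : Fin n → ℝ) 1 ∧ g • SP.map n d y ∈ p ⁻¹' A} =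
          {y | y ∈ closedBall (0 : Fin n → ℝ) 1 ∧ g • SP.map n d y ∈ j '' (k ⁻¹' (q ⁻¹' A))} := by
        ext y
        refine and_congr_right fun hy => ?_
        obtain ⟨x, hx⟩ := hj.closedCell_subset_range hl g hy
        rw [← hx, hj.isClosedEmbedding.injective.mem_set_image, mem_preimage, mem_preimage,
          mem_preimage, h.comm]
      rwa [e]
    · have := hA n (Sum.inr ⟨d, hd⟩) g
      simp only [Sum.elim_inr, ← map_smul] at this
      exact this

variable (h : IsGPushout j k p q) (hj : SC.IsInclusion SP j) (hk : SC.IsCellular SQ k)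

theorem openCell_gcw_inl {n : ℕ} (d : SQ.cell n) :
    (h.gcw hj hk).openCell n (Sum.inl d) = q '' SQ.openCell n d := by
  ext x
  constructor
  · rintro ⟨g, y, hy, rfl⟩
    exact ⟨_, ⟨g, y, hy, rfl⟩, map_smul q _ _⟩
  · rintro ⟨_, ⟨g, y, hy, rfl⟩, rfl⟩
    exact ⟨g, y, hy, (map_smul q _ _).symm⟩

theorem openCell_gcw_inr {n : ℕ} (d : {d : SP.cell n // Disjoint (SP.openCell n d) (range j)}) :
    (h.gcw hj hk).openCell n (Sum.inr d) = p '' SP.openCell n d.1 := by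
  ext x
  constructor
  · rintro ⟨g, y, hy, rfl⟩
    exact ⟨_, ⟨g, y, hy, rfl⟩, map_smul p _ _⟩
  · rintro ⟨_, ⟨g, y, hy, rfl⟩, rfl⟩
    exact ⟨g, y, hy, (map_smul p _ _).symm⟩

theorem skeleton_gcw (n : ℕ) :
    (h.gcw hj hk).skeleton n = p '' SP.skeleton n ∪ q '' SQ.skeleton n := by
  ext x
  constructor
  · rintro ⟨m, hm, d | d, hx⟩
    · rw [h.openCell_gcw_inl hj hk d] at hx
      obtain ⟨y, hy, rfl⟩ := hx
      exact Or.inr ⟨y, ⟨m, hm, d, hy⟩, rfl⟩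
    · rw [h.openCell_gcw_inr hj hk d] at hx
      obtain ⟨y, hy, rfl⟩ := hx
      exact Or.inl ⟨y, ⟨m, hm, d.1, hy⟩, rfl⟩
  · have hQ : q '' SQ.skeleton n ⊆ (h.gcw hj hk).skeleton n := by
      rintro _ ⟨y, ⟨m, hm, d, hy⟩, rfl⟩
      exact ⟨m, hm, Sum.inl d, by rw [h.openCell_gcw_inl hj hk d]; exact mem_image_of_mem q hy⟩
    rintro (⟨y, hy, rfl⟩ | hx)
    · by_cases hr : y ∈ range j
      · obtain ⟨c, rfl⟩ := hr
        rw [h.comm]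
        exact hQ (mem_image_of_mem q (hk.mapsTo n (hj.map_mem_skeleton_iff.1 hy)))
      · obtain ⟨m, hm, d, hy⟩ := hy
        rcases hj.subset_range_or_disjoint d with ⟨l, hl⟩ | hd
        · rw [← hl] at hy
          exact absurd (image_subset_range _ _ hy) hr
        · exact ⟨m, hm, Sum.inr ⟨d, hd⟩, by
            rw [h.openCell_gcw_inr hj hk ⟨d, hd⟩]; exact mem_image_of_mem p hy⟩
    · exact hQ hx

theorem dimLE_gcw {n : ℤ} (hP : SP.DimLE n) (hQ : SQ.DimLE n) : (h.gcw hj hk).DimLE n := by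
  intro m hm
  have h1 := hP m hm
  have h2 := hQ m hm
  exact ⟨fun c => c.elim (fun d => h2.false d) fun d => h1.false d.1⟩

end IsGPushout

/-! ### Cylinders -/

section Cylinders

open unitInterval

/-- The cylinder over a `G`-space, with trivial action on the interval. -/
def Cyl (X : Type u) : Type u := X × I

namespace Cyl

variable {G : Type u} [Group G] {X : Type u} [MulAction G X]

instance : MulAction G (Cyl X) where
  smul g p := (g • p.1, p.2)
  one_smul p := Prod.ext (one_smul G p.1) rfl
  mul_smul g g' p := Prod.ext (mul_smul g g' p.1) rfl

/-- The inclusion of a level of the cylinder. -/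
def level (G : Type u) [Group G] [MulAction G X] (t : I) : X →[G] Cyl X :=
  ⟨fun x => (x, t), fun _ _ => rfl⟩

variable [TopologicalSpace X]

instance : TopologicalSpace (Cyl X) := inferInstanceAs (TopologicalSpace (X × I))

instance [ContinuousConstSMul G X] : ContinuousConstSMul G (Cyl X) where
  continuous_const_smul g := ((continuous_const_smul g).comp continuous_fst).prodMk continuous_snd

theorem isClosedEmbedding_level (t : I) : IsClosedEmbedding (level G t : X → Cyl X) := by
  refine .of_continuous_injective_isClosedMap (continuous_id.prodMk continuous_const)
    (fun x y h => congrArg Prod.fst h) fun T hT => ?_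
  have : level G t '' T = T ×ˢ {t} := by
    ext ⟨x, s⟩
    constructor
    · rintro ⟨y, hy, e⟩
      obtain ⟨rfl, rfl⟩ := Prod.mk.inj e
      exact ⟨hy, rfl⟩
    · rintro ⟨hx, rfl⟩
      exact ⟨x, hx, rfl⟩
  rw [this]
  exact hT.prod isClosed_singleton

/-- The affine map from `[-1, 1]` to the unit interval. -/
noncomputable def param (t : ℝ) : I := projIcc 0 1 zero_le_one ((t + 1) / 2)

theorem continuous_param : Continuous param := continuous_projIcc.comp (by fun_prop)

theorem coe_param {t : ℝ} (ht : |t| ≤ 1) : (param t : ℝ) = (t + 1) / 2 := by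
  rw [abs_le] at ht
  rw [param, projIcc_of_mem zero_le_one (⟨by linarith, by linarith⟩ : (t + 1) / 2 ∈ Icc (0 : ℝ) 1)]

theorem param_coe (t : I) : param (2 * t - 1) = t := by
  have : (2 * (t : ℝ) - 1 + 1) / 2 = t := by ring
  rw [param, this]
  exact projIcc_val _ t

theorem param_neg_one : param (-1) = 0 := Subtype.ext (by rw [coe_param (by simp)]; simp)

theorem param_one : param 1 = 1 := Subtype.ext (by rw [coe_param (by simp)]; norm_num)

theorem param_ne_zero {t : ℝ} (ht : |t| < 1) : param t ≠ 0 := fun h => by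
  have h' := congrArg Subtype.val h
  rw [coe_param ht.le] at h'
  change (t + 1) / 2 = 0 at h'
  rw [abs_lt] at ht
  linarith

theorem param_ne_one {t : ℝ} (ht : |t| < 1) : param t ≠ 1 := fun h => by
  have h' := congrArg Subtype.val h
  rw [coe_param ht.le] at h'
  change (t + 1) / 2 = 1 at h'
  rw [abs_lt] at ht
  linarith

theorem param_injOn {s t : ℝ} (hs : |s| < 1) (ht : |t| < 1) (h : param s = param t) : s = t := by
  have h' := congrArg Subtype.val h
  rw [coe_param hs.le, coe_param ht.le] at h'
  linarith

/-- The cells of a cylinder. -/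
inductive Cell (c : ℕ → Type u) : ℕ → Type u
  | bot {n : ℕ} (j : c n) : Cell c n
  | top {n : ℕ} (j : c n) : Cell c n
  | mid {n : ℕ} (j : c n) : Cell c (n + 1)

variable [ContinuousConstSMul G X] (S : GCWComplex G X)

/-- The isotropy groups of the cells of a cylinder. -/
def cellStab : ∀ n, Cell S.cell n → Subgroup G
  | _, .bot j => S.stab _ j
  | _, .top j => S.stab _ j
  | _, .mid j => S.stab _ j

/-- The characteristic maps of the cells of a cylinder. -/
noncomputable def cellMap : ∀ n, Cell S.cell n → (Fin n → ℝ) → Cyl X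
  | _, .bot j => fun y => (S.map _ j y, 0)
  | _, .top j => fun y => (S.map _ j y, 1)
  | _, .mid j => fun y => (S.map _ j (Fin.tail y), param (y 0))

/-- The product topology on `X × I` is the weak one because `I` is locally compact. The complement
of `A` is read as a map to the Sierpiński space `Prop` and curried to a map from `X` to `C(I,
Prop)`. Its continuity can be checked on the cells of `X`, and joint continuity of evaluation leads
back to the product. -/
theorem isClosed_of_cellMap {A : Set (Cyl X)} (hA : ∀ n (j : Cell S.cell n) (g : G),
    IsClosed {y | y ∈ closedBall (0 : Fin n → ℝ) 1 ∧ g • cellMap S n j y ∈ A}) : IsClosed A := by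
  have hmem : ∀ n (y : Fin n → ℝ) (t : I),
      (Fin.cons (2 * (t : ℝ) - 1) y : Fin (n + 1) → ℝ) ∈ closedBall (0 : Fin (n + 1) → ℝ) 1 ↔
        y ∈ closedBall (0 : Fin n → ℝ) 1 := by
    intro n y t
    rw [mem_closedBall_succ, Fin.tail_cons, Fin.cons_zero, abs_le]
    exact and_iff_right ⟨by linarith [t.2.1], by linarith [t.2.2]⟩
  have hV : ∀ n (j : S.cell n) (g : G), IsClosed {p : (Fin n → ℝ) × I |
      p.1 ∈ closedBall (0 : Fin n → ℝ) 1 ∧ ((g • S.map n j p.1, p.2) : Cyl X) ∈ A} := by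
    intro n j g
    have hc : Continuous fun p : (Fin n → ℝ) × I =>
        (Fin.cons (2 * (p.2 : ℝ) - 1) p.1 : Fin (n + 1) → ℝ) :=
      Continuous.finCons (by fun_prop) (by fun_prop)
    convert (hA (n + 1) (.mid j) g).preimage hc using 1
    ext p
    rw [mem_preimage, mem_ofPred_eq, mem_ofPred_eq, hmem]
    simp only [cellMap, Fin.tail_cons, Fin.cons_zero, param_coe]
    rfl
  have hfib : ∀ x, IsOpen {t : I | ((x, t) : Cyl X) ∉ A} := by
    intro x
    obtain ⟨n, j, g, y, hy, rfl⟩ := S.cover x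
    have := (hV n j g).preimage (f := fun t : I => (y, t)) (by fun_prop)
    convert this.isOpen_compl using 1
    ext t
    simp [ball_subset_closedBall hy, -mem_closedBall]
  let f : X → C(I, Prop) := fun x => ⟨fun t => ((x, t) : Cyl X) ∉ A,
    isOpen_iff_continuous_mem.1 (hfib x)⟩
  have hf : Continuous f := by
    refine S.continuous_of_cells fun n j g => ?_
    have hF : ContinuousOn (fun p : (Fin n → ℝ) × I => ((g • S.map n j p.1, p.2) : Cyl X) ∉ A)
        (closedBall 0 1 ×ˢ univ) := by
      refine (isOpen_iff_continuous_mem.1 (hV n j g).isOpen_compl).continuousOn.congr fun p hp => ?_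
      exact propext ⟨fun h h' => h h'.2, fun h h' => h ⟨hp.1, h'⟩⟩
    obtain ⟨Γ, hΓ, hΓF⟩ := exists_curry_continuousOn
      (F := fun y t => ((g • S.map n j y, t) : Cyl X) ∉ A) hF
    exact hΓ.congr fun y hy => ContinuousMap.ext fun t => (hΓF y hy t).symm
  rw [← isOpen_compl_iff, isOpen_iff_continuous_mem]
  exact ContinuousEval.continuous_eval.comp ((hf.comp continuous_fst).prodMk continuous_snd)

/-- The cylinder over a `G`-CW-complex. -/
noncomputable def gcw : GCWComplex G (Cyl X) where
  t2 := by
    have := S.t2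
    exact inferInstanceAs (T2Space (X × I))
  cell := Cell S.cell
  stab := cellStab S
  map := cellMap S
  continuousOn := by
    rintro _ (j | j | j)
    · exact (S.continuousOn _ j).prodMk continuousOn_const
    · exact (S.continuousOn _ j).prodMk continuousOn_const
    · exact ((S.continuousOn _ j).comp continuous_finTail.continuousOn fun y hy =>
        (mem_closedBall_succ.1 hy).2).prodMk (continuous_param.comp (continuous_apply 0)).continuousOn
  smul_map := by
    rintro _ (j | j | j) g hg y hy
    · exact Prod.ext (S.smul_map _ j g hg y hy) rfl
    · exact Prod.ext (S.smul_map _ j g hg y hy) rfl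
    · exact Prod.ext (S.smul_map _ j g hg _ (mem_closedBall_succ.1 hy).2) rfl
  cover := by
    rintro ⟨x, t⟩
    obtain ⟨n, j, g, y, hy, rfl⟩ := S.cover x
    by_cases h0 : t = 0
    · exact ⟨n, .bot j, g, y, hy, by rw [h0]; rfl⟩
    · by_cases h1 : t = 1
      · exact ⟨n, .top j, g, y, hy, by rw [h1]; rfl⟩
      · refine ⟨n + 1, .mid j, g, Fin.cons (2 * (t : ℝ) - 1) y, ?_, ?_⟩
        · rw [mem_ball_succ, Fin.tail_cons, Fin.cons_zero, abs_lt]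
          have h0' := unitInterval.pos_iff_ne_zero.2 h0
          have h1' := unitInterval.lt_one_iff_ne_one.2 h1
          have h0'' : (0 : ℝ) < t := h0'
          have h1'' : (t : ℝ) < 1 := h1'
          exact ⟨⟨by linarith, by linarith⟩, hy⟩
        · simp only [cellMap, Fin.tail_cons, Fin.cons_zero, param_coe]
          rfl
  disjoint := by
    have aux : ∀ {n m} {j : S.cell n} {k : S.cell m} {g : G} {y : Fin n → ℝ} {z : Fin m → ℝ}
        {t t' : I}, y ∈ ball (0 : Fin n → ℝ) 1 → z ∈ ball (0 : Fin m → ℝ) 1 →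
        g • level G t (S.map n j y) = level G t' (S.map m k z) →
        (⟨n, j⟩ : Σ n, S.cell n) = ⟨m, k⟩ ∧ t = t' := fun hy hz h =>
      ⟨S.disjoint _ _ _ _ _ _ hy _ hz (congrArg Prod.fst h), congrArg Prod.snd h⟩
    rintro _ (j | j | j) _ (k | k | k) g y hy z hz h
    · cases (aux hy hz h).1
      rfl
    · exact absurd (aux hy hz h).2 zero_ne_one
    · exact absurd (aux hy (mem_ball_succ.1 hz).2 h).2.symm (param_ne_zero (mem_ball_succ.1 hz).1)
    · exact absurd (aux hy hz h).2 one_ne_zero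
    · cases (aux hy hz h).1
      rfl
    · exact absurd (aux hy (mem_ball_succ.1 hz).2 h).2.symm (param_ne_one (mem_ball_succ.1 hz).1)
    · exact absurd (aux (mem_ball_succ.1 hy).2 hz h).2 (param_ne_zero (mem_ball_succ.1 hy).1)
    · exact absurd (aux (mem_ball_succ.1 hy).2 hz h).2 (param_ne_one (mem_ball_succ.1 hy).1)
    · cases (aux (mem_ball_succ.1 hy).2 (mem_ball_succ.1 hz).2 h).1
      rfl
  inj := by
    rintro _ (j | j | j) g y hy z hz h
    · exact S.inj _ j g y hy z hz (congrArg Prod.fst h)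
    · exact S.inj _ j g y hy z hz (congrArg Prod.fst h)
    · have hy' := mem_ball_succ.1 hy
      have hz' := mem_ball_succ.1 hz
      obtain ⟨h1, h2⟩ := S.inj _ j g _ hy'.2 _ hz'.2 (congrArg Prod.fst h)
      refine ⟨h1, ?_⟩
      rw [← Fin.cons_self_tail y, ← Fin.cons_self_tail z, h2,
        param_injOn hy'.1 hz'.1 (congrArg Prod.snd h)]
  frontier := by
    classical
    rintro _ (j | j | j)
    · obtain ⟨s, hs, h⟩ := S.frontier _ j
      refine ⟨s.image fun c => (c.1, ⟨c.2.1, .bot c.2.2⟩), ?_, fun y hy => ?_⟩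
      · intro c hc
        obtain ⟨d, hd, rfl⟩ := Finset.mem_image.1 hc
        exact hs d hd
      · obtain ⟨c, hc, z, hz, e⟩ := h y hy
        exact ⟨_, Finset.mem_image_of_mem _ hc, z, hz, Prod.ext e rfl⟩
    · obtain ⟨s, hs, h⟩ := S.frontier _ j
      refine ⟨s.image fun c => (c.1, ⟨c.2.1, .top c.2.2⟩), ?_, fun y hy => ?_⟩
      · intro c hc
        obtain ⟨d, hd, rfl⟩ := Finset.mem_image.1 hc
        exact hs d hd
      · obtain ⟨c, hc, z, hz, e⟩ := h y hy
        exact ⟨_, Finset.mem_image_of_mem _ hc, z, hz, Prod.ext e rfl⟩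
    · obtain ⟨s, hs, h⟩ := S.frontier _ j
      -- The boundary of a prism consists of its bottom, its top and the prisms over the boundary of
      -- the base.
      refine ⟨{(1, ⟨_, .bot j⟩), (1, ⟨_, .top j⟩)} ∪
        s.image fun c => (c.1, ⟨c.2.1 + 1, .mid c.2.2⟩), ?_, fun y hy => ?_⟩
      · intro c hc
        rcases Finset.mem_union.1 hc with hc | hc
        · rcases Finset.mem_insert.1 hc with rfl | hc
          · exact Nat.lt_succ_self _
          · rw [Finset.mem_singleton.1 hc]
            exact Nat.lt_succ_self _
        · obtain ⟨d, hd, rfl⟩ := Finset.mem_image.1 hc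
          exact Nat.succ_lt_succ (hs d hd)
      · rcases mem_sphere_succ.1 hy with ⟨h1 | h1, h2⟩ | ⟨h1, h2⟩
        · refine ⟨(1, ⟨_, .bot j⟩), by simp, Fin.tail y, h2, ?_⟩
          rw [one_smul]
          exact Prod.ext rfl (by simp only [cellMap, h1, param_neg_one])
        · refine ⟨(1, ⟨_, .top j⟩), by simp, Fin.tail y, h2, ?_⟩
          rw [one_smul]
          exact Prod.ext rfl (by simp only [cellMap, h1, param_one])
        · obtain ⟨c, hc, z, hz, e⟩ := h _ h2
          refine ⟨(c.1, ⟨c.2.1 + 1, .mid c.2.2⟩), Finset.mem_union_right _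
            (Finset.mem_image_of_mem (fun c : G × Σ m, S.cell m => ((c.1, ⟨c.2.1 + 1, .mid c.2.2⟩) :
              G × Σ m, Cell S.cell m)) hc), Fin.cons (y 0) z, ?_, ?_⟩
          · exact mem_closedBall_succ.2 ⟨h1, by rwa [Fin.tail_cons]⟩
          · simp only [cellMap, Fin.tail_cons, Fin.cons_zero, e]
            rfl
  weak _ hA := isClosed_of_cellMap S hA

theorem openCell_bot {n : ℕ} (j : S.cell n) :
    (gcw S).openCell n (.bot j) = level G 0 '' S.openCell n j := by
  ext x
  constructor
  · rintro ⟨g, y, hy, rfl⟩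
    exact ⟨_, ⟨g, y, hy, rfl⟩, rfl⟩
  · rintro ⟨_, ⟨g, y, hy, rfl⟩, rfl⟩
    exact ⟨g, y, hy, rfl⟩

theorem openCell_top {n : ℕ} (j : S.cell n) :
    (gcw S).openCell n (.top j) = level G 1 '' S.openCell n j := by
  ext x
  constructor
  · rintro ⟨g, y, hy, rfl⟩
    exact ⟨_, ⟨g, y, hy, rfl⟩, rfl⟩
  · rintro ⟨_, ⟨g, y, hy, rfl⟩, rfl⟩
    exact ⟨g, y, hy, rfl⟩

theorem isInclusion_top : S.IsInclusion (gcw S) (level G 1) :=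
  ⟨isClosedEmbedding_level 1, fun _ j => ⟨.top j, (openCell_top S j).symm⟩⟩

theorem dimLE_gcw {n : ℤ} (h : S.DimLE (n - 1)) : (gcw S).DimLE n := by
  intro m hm
  refine ⟨fun c => ?_⟩
  cases c with
  | bot j => exact (h m (by omega)).false j
  | top j => exact (h m (by omega)).false j
  | @mid k j => exact (h k (by push_cast at hm; omega)).false j

end Cyl

/-! ### Mapping cylinders -/

/-- The mapping cylinder of a `G`-map. -/
def MapCyl {G : Type u} [Group G] {C B : Type u} [TopologicalSpace C] [MulAction G C]
    [TopologicalSpace B] [MulAction G B] (f : C →[G] B) : Type u :=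
  GPushout (Cyl.level G (1 : I)) f

namespace MapCyl

variable {G : Type u} [Group G] {C B : Type u} [TopologicalSpace C] [MulAction G C]
  [TopologicalSpace B] [MulAction G B] (f : C →[G] B)

instance : TopologicalSpace (MapCyl f) :=
  inferInstanceAs (TopologicalSpace (GPushout (Cyl.level G (1 : I)) f))

instance : MulAction G (MapCyl f) :=
  inferInstanceAs (MulAction G (GPushout (Cyl.level G (1 : I)) f))

instance [ContinuousConstSMul G C] [ContinuousConstSMul G B] : ContinuousConstSMul G (MapCyl f) :=
  inferInstanceAs (ContinuousConstSMul G (GPushout (Cyl.level G (1 : I)) f))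

/-- The map from the cylinder to the mapping cylinder. -/
def cyl : Cyl C →[G] MapCyl f := GPushout.inl (Cyl.level G (1 : I)) f

/-- The inclusion of the target into the mapping cylinder. -/
def target : B →[G] MapCyl f := GPushout.inr (Cyl.level G (1 : I)) f

theorem isGPushout : IsGPushout (Cyl.level G (1 : I)) f (cyl f) (target f) :=
  GPushout.isGPushout _ _

/-- The inclusion of the source into the mapping cylinder. -/
def source : C →[G] MapCyl f := (cyl f).comp (Cyl.level G 0)

theorem cyl_one (c : C) : cyl f (c, 1) = target f (f c) := (isGPushout f).comm c

variable {f}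

theorem exists_retraction [ContinuousConstSMul G B] (hf : Continuous f) :
    ∃ ρ : MapCyl f →[G] B, Continuous ρ ∧ (∀ p, ρ (cyl f p) = f p.1) ∧ ∀ y, ρ (target f y) = y := by
  obtain ⟨ρ, h, -⟩ := (isGPushout f).universal B ⟨fun p => f p.1, fun g p => map_smul f g p.1⟩
    ⟨id, fun _ _ => rfl⟩ (hf.comp continuous_fst) continuous_id fun _ => rfl
  exact ⟨ρ, h⟩

variable [ContinuousConstSMul G C] [ContinuousConstSMul G B]

/-- The paths in the mapping cylinder from the source to the target. -/
theorem exists_path : ∃ γ : C →[G] C(I, MapCyl f), Continuous γ ∧ ∀ c t, γ c t = cyl f (c, t) := by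
  have hc : Continuous fun p : C × I => cyl f p := (isGPushout f).continuous_left
  exact ⟨⟨fun c => (⟨_, hc⟩ : C(C × I, MapCyl f)).curry c,
    fun g c => ContinuousMap.ext fun t => map_smul (cyl f) g (Cyl.level G t c)⟩,
    (ContinuousMap.curry _).continuous, fun _ _ => rfl⟩

/-- Sliding along the cylinder coordinate deforms the mapping cylinder into its target, which stays
fixed. This makes the mapping cylinder of a map to a model dominated by that model. -/
theorem exists_deformation :
    ∃ H : MapCyl f →[G] C(I, MapCyl f), Continuous H ∧ (∀ x, H x 0 = x) ∧
      (∀ c t, H (cyl f (c, t)) 1 = target f (f c)) ∧ ∀ y s, H (target f y) s = target f y := by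
  -- `m t s = 1 - (1 - t)(1 - s)` moves the level `t` to `1` as `s` runs from `0` to `1` and fixes
  -- the level `1`, so it is compatible with the gluing.
  let m : I → I → I := fun t s => σ (σ t * σ s)
  have hm : Continuous fun p : I × I => m p.1 p.2 := by fun_prop
  have hc : Continuous fun q : Cyl C × I => cyl f (q.1.1, m q.1.2 q.2) :=
    (isGPushout f).continuous_left.comp
      (((continuous_fst : Continuous (Prod.fst : C × I → C)).comp continuous_fst).prodMk
        (hm.comp (((continuous_snd : Continuous (Prod.snd : C × I → I)).comp continuous_fst).prodMk
          continuous_snd)))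
  obtain ⟨H, ⟨hH, h1, h2⟩, -⟩ := (isGPushout f).universal C(I, MapCyl f)
    ⟨fun q => (⟨_, hc⟩ : C(Cyl C × I, MapCyl f)).curry q,
      fun g q => ContinuousMap.ext fun s => map_smul (cyl f) g (Cyl.level G (m q.2 s) q.1)⟩
    ⟨fun y => ContinuousMap.const _ (target f y),
      fun g y => ContinuousMap.ext fun s => map_smul (target f) g y⟩
    (ContinuousMap.curry _).continuous
    (ContinuousMap.continuous_const'.comp (isGPushout f).continuous_right)
    (fun c => ContinuousMap.ext fun s => by
      change cyl f (c, m 1 s) = target f (f c)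
      rw [← cyl_one]
      simp [m])
  have h1' : ∀ c t s, H (cyl f (c, t)) s = cyl f (c, m t s) := fun c t s =>
    congrArg (fun k : C(I, MapCyl f) => k s) (h1 (c, t))
  have h2' : ∀ y s, H (target f y) s = target f y := fun y s =>
    congrArg (fun k : C(I, MapCyl f) => k s) (h2 y)
  refine ⟨H, hH, fun x => ?_, fun c t => ?_, h2'⟩
  · rcases (isGPushout f).surjective x with ⟨⟨c, t⟩, rfl⟩ | ⟨y, rfl⟩
    · rw [h1']
      simp [m]
    · rw [h2']
  · rw [h1', ← cyl_one]
    simp [m]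

/-- The CW-structure of the mapping cylinder of a cellular map. -/
noncomputable def gcw {SC : GCWComplex G C} {SB : GCWComplex G B} (hf : SC.IsCellular SB f) :
    GCWComplex G (MapCyl f) :=
  (isGPushout f).gcw (Cyl.isInclusion_top SC) hf

/-- The bottom of the cylinder is disjoint from the glued top, so it survives unchanged in the
pushout, together with its cells. -/
theorem isInclusion_source {SC : GCWComplex G C} {SB : GCWComplex G B}
    (hf : SC.IsCellular SB f) : SC.IsInclusion (gcw hf) (source f) := by
  have hi := Cyl.isClosedEmbedding_level (G := G) (X := C) (1 : I)
  have hd : ∀ T : Set C, Disjoint (Cyl.level G (0 : I) '' T) (range (Cyl.level G (1 : I) : C → _)) := by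
    intro T
    rw [Set.disjoint_left]
    rintro _ ⟨c, -, rfl⟩ ⟨c', h⟩
    exact one_ne_zero (congrArg Prod.snd h)
  obtain ⟨-, -, hpp⟩ := (isGPushout f).map_eq_of_injective hi.injective
  refine ⟨.of_continuous_injective_isClosedMap ((isGPushout f).continuous_left.comp
    (Cyl.isClosedEmbedding_level 0).continuous) (fun c c' h => ?_) fun T hT => ?_, fun n j => ?_⟩
  · refine (Cyl.isClosedEmbedding_level (G := G) (0 : I)).injective ((hpp _ _ h).resolve_right ?_)
    exact Set.disjoint_left.1 (hd univ) ⟨c, mem_univ _, rfl⟩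
  · have := (isGPushout f).isClosed_image_left hi.injective
      ((Cyl.isClosedEmbedding_level (G := G) (0 : I)).isClosedMap T hT) (hd T)
    rwa [image_image] at this
  · have hdis : Disjoint ((Cyl.gcw SC).openCell n (.bot j)) (range (Cyl.level G (1 : I) : C → _)) := by
      rw [Cyl.openCell_bot]
      exact hd _
    refine ⟨Sum.inr ⟨.bot j, hdis⟩, ?_⟩
    have := (isGPushout f).openCell_gcw_inr (Cyl.isInclusion_top SC) hf ⟨.bot j, hdis⟩
    rw [Cyl.openCell_bot, image_image] at this
    exact this.symm

/-- The prism over a cell of `C` has one dimension more than the cell; this is the source of the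
bound `n - 1`. -/
theorem dimLE_gcw {SC : GCWComplex G C} {SB : GCWComplex G B} (hf : SC.IsCellular SB f) {n : ℤ}
    (hC : SC.DimLE (n - 1)) (hB : SB.DimLE n) : (gcw hf).DimLE n :=
  (isGPushout f).dimLE_gcw _ _ (Cyl.dimLE_gcw SC hC) hB

end MapCyl

end Cylinders

/-! ### Coproducts and induction -/

section SigmaMaps

variable {G : Type u} [Group G] {ι : Type u} {X Y : ι → Type u}
  [∀ i, TopologicalSpace (X i)] [∀ i, MulAction G (X i)]
  [∀ i, TopologicalSpace (Y i)] [∀ i, MulAction G (Y i)]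

/-- The `G`-map out of a coproduct given by `G`-maps on the summands. -/
def sigmaLift {X : ι → Type u} [∀ i, MulAction G (X i)] {W : Type*} [MulAction G W]
    (φ : ∀ i, X i →[G] W) : (Σ i, X i) →[G] W where
  toFun p := φ p.1 p.2
  map_smul' g p := map_smul (φ p.1) g p.2

theorem continuous_sigmaLift {W : Type*} [MulAction G W] [TopologicalSpace W]
    {φ : ∀ i, X i →[G] W} (hφ : ∀ i, Continuous (φ i)) : Continuous (sigmaLift φ) :=
  continuous_sigma hφ

theorem isClosedEmbedding_sigmaMap {f : ∀ i, X i →[G] Y i} (hf : ∀ i, IsClosedEmbedding (f i)) :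
    IsClosedEmbedding (sigmaMap f) := by
  refine .of_continuous_injective_isClosedMap
    (continuous_sigma fun i => continuous_sigmaMk.comp (hf i).continuous) ?_ fun T hT => ?_
  · rintro ⟨i, x⟩ ⟨i', x'⟩ h
    obtain ⟨rfl, h⟩ := Sigma.mk.inj h
    exact congrArg (Sigma.mk i) ((hf i).injective (eq_of_heq h))
  · rw [isClosed_sigma_iff] at hT ⊢
    intro i
    have : Sigma.mk i ⁻¹' (sigmaMap f '' T) = f i '' (Sigma.mk i ⁻¹' T) := by
      ext y
      constructor
      · rintro ⟨⟨i', x⟩, hx, h⟩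
        obtain ⟨rfl, h⟩ := Sigma.mk.inj h
        exact ⟨x, hx, eq_of_heq h⟩
      · rintro ⟨x, hx, rfl⟩
        exact ⟨⟨i, x⟩, hx, rfl⟩
    rw [this]
    exact (hf i).isClosedMap _ (hT i)

variable [∀ i, ContinuousConstSMul G (X i)] [∀ i, ContinuousConstSMul G (Y i)]
  {S : ∀ i, GCWComplex G (X i)} {T : ∀ i, GCWComplex G (Y i)}

theorem GCWComplex.openCell_sigma {n : ℕ} (i : ι) (j : (S i).cell n) :
    (GCWComplex.sigma S).openCell n ⟨i, j⟩ = Sigma.mk i '' (S i).openCell n j := by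
  ext x
  constructor
  · rintro ⟨g, y, hy, rfl⟩
    exact ⟨_, ⟨g, y, hy, rfl⟩, rfl⟩
  · rintro ⟨_, ⟨g, y, hy, rfl⟩, rfl⟩
    exact ⟨g, y, hy, rfl⟩

theorem GCWComplex.mem_skeleton_sigma {n : ℕ} {i : ι} {x : X i} :
    (⟨i, x⟩ : Σ i, X i) ∈ (GCWComplex.sigma S).skeleton n ↔ x ∈ (S i).skeleton n := by
  constructor
  · rintro ⟨m, hm, ⟨i', j⟩, hx⟩
    rw [GCWComplex.openCell_sigma] at hx
    obtain ⟨x', hx', h⟩ := hx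
    obtain ⟨rfl, h⟩ := Sigma.mk.inj h
    exact ⟨m, hm, j, eq_of_heq h ▸ hx'⟩
  · rintro ⟨m, hm, j, hx⟩
    exact ⟨m, hm, ⟨i, j⟩, by rw [GCWComplex.openCell_sigma]; exact mem_image_of_mem _ hx⟩

theorem GCWComplex.IsCellular.sigma {f : ∀ i, X i →[G] Y i}
    (hf : ∀ i, (S i).IsCellular (T i) (f i)) :
    (GCWComplex.sigma S).IsCellular (GCWComplex.sigma T) (sigmaMap f) :=
  ⟨continuous_sigma fun i => continuous_sigmaMk.comp (hf i).continuous, fun n ⟨i, x⟩ hx => by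
    change (⟨i, f i x⟩ : Σ i, Y i) ∈ _
    rw [GCWComplex.mem_skeleton_sigma] at hx ⊢
    exact (hf i).mapsTo n hx⟩

theorem GCWComplex.IsInclusion.sigma {f : ∀ i, X i →[G] Y i}
    (hf : ∀ i, (S i).IsInclusion (T i) (f i)) :
    (GCWComplex.sigma S).IsInclusion (GCWComplex.sigma T) (sigmaMap f) := by
  refine ⟨isClosedEmbedding_sigmaMap fun i => (hf i).isClosedEmbedding, fun n ⟨i, j⟩ => ?_⟩
  obtain ⟨k, hk⟩ := (hf i).image_openCell n j
  refine ⟨⟨i, k⟩, ?_⟩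
  rw [GCWComplex.openCell_sigma, GCWComplex.openCell_sigma, ← hk, image_image, image_image]
  rfl

theorem GCWComplex.dimLE_sigma {n : ℤ} (h : ∀ i, (S i).DimLE n) :
    (GCWComplex.sigma S).DimLE n :=
  fun m hm => ⟨fun c => (h c.1 m hm).false c.2⟩

end SigmaMaps

/-! ### Isotropy, maps and cells of induced spaces -/

section InducedMaps

variable {G : Type u} [Group G] {N : Subgroup G} {X Y : Type u} [MulAction N X] [MulAction N Y]

theorem Induced.map_mk (f : X →[N] Y) (g : G) (x : X) :
    Induced.map f (Induced.mk N g x) = Induced.mk N g (f x) := rfl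

theorem Induced.mk_injective (g : G) : Function.Injective (Induced.mk N g : X → Induced N X) := by
  intro x x' h
  obtain ⟨n, h1, h2⟩ := Induced.mk_eq_iff.1 h
  have : n = 1 := by simpa using h1
  rw [h2, this, one_smul]

theorem Induced.stabilizer_mk (g : G) (x : X) :
    MulAction.stabilizer G (Induced.mk N g x) =
      MulAut.conj g • (MulAction.stabilizer N x).map N.subtype := by
  ext a
  rw [MulAction.mem_stabilizer_iff, Induced.smul_mk, Induced.mk_eq_iff,
    Subgroup.mem_pointwise_smul_iff_inv_smul_mem, Subgroup.mem_map]
  have : (MulAut.conj g)⁻¹ • a = g⁻¹ * a * g := by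
    rw [← map_inv, MulAut.smul_def, MulAut.conj_apply, inv_inv]
  rw [this]
  constructor
  · rintro ⟨n, h1, h2⟩
    exact ⟨n, h2.symm, by rw [mul_assoc, h1]; simp⟩
  · rintro ⟨n, h1, h2⟩
    exact ⟨n, by change (n : G) = _ at h2; rw [h2]; simp [mul_assoc], h1.symm⟩

theorem SubgroupFamily.stabilizer_mk_mem (F : SubgroupFamily G) (g : G) {x : X} :
    MulAction.stabilizer G (Induced.mk N g x) ∈ F ↔ MulAction.stabilizer N x ∈ F.inter N := by
  rw [Induced.stabilizer_mk, F.conj_mem_iff]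
  rfl

theorem stabilizer_le_map {Z W : Type*} [MulAction G Z] [MulAction G W] (f : Z →[G] W) (z : Z) :
    MulAction.stabilizer G z ≤ MulAction.stabilizer G (f z) := fun g hg => by
  rw [MulAction.mem_stabilizer_iff] at hg ⊢
  rw [← map_smul, hg]

theorem stabilizer_eq_map {Z W : Type*} [MulAction G Z] [MulAction G W] {f : Z →[G] W} {z : Z}
    (hf : ∀ z', f z = f z' → z = z') :
    MulAction.stabilizer G (f z) = MulAction.stabilizer G z := by
  refine le_antisymm (fun g hg => ?_) (stabilizer_le_map f z)
  rw [MulAction.mem_stabilizer_iff, ← map_smul] at hg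
  exact (hf _ hg.symm).symm

theorem stabilizer_sigma_mk {ι : Type u} {X : ι → Type u} [∀ i, MulAction G (X i)] (i : ι)
    (x : X i) : MulAction.stabilizer G (⟨i, x⟩ : Σ i, X i) = MulAction.stabilizer G x := by
  ext g
  rw [MulAction.mem_stabilizer_iff, MulAction.mem_stabilizer_iff, Sigma.smul_mk]
  exact ⟨fun h => eq_of_heq (Sigma.mk.inj h).2, fun h => by rw [h]⟩

variable [TopologicalSpace X] [TopologicalSpace Y]

theorem Induced.continuous_map {f : X →[N] Y} (hf : Continuous f) : Continuous (Induced.map f) :=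
  Induced.continuous_of_mk fun g => (Induced.continuous_mk g).comp hf

theorem Induced.isClosedEmbedding_map {f : X →[N] Y} (hf : IsClosedEmbedding f) :
    IsClosedEmbedding (Induced.map f) := by
  refine .of_continuous_injective_isClosedMap (Induced.continuous_map hf.continuous) ?_
    fun T hT => ?_
  · intro p p' h
    obtain ⟨g, x, rfl⟩ := p.exists_mk
    obtain ⟨g', x', rfl⟩ := p'.exists_mk
    rw [Induced.map_mk, Induced.map_mk, Induced.mk_eq_iff] at h
    obtain ⟨n, h1, h2⟩ := h
    rw [← map_smul] at h2
    exact Induced.mk_eq_iff.2 ⟨n, h1, hf.injective h2⟩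
  · rw [Induced.isClosed_iff] at hT ⊢
    intro g
    have : {y | Induced.mk N g y ∈ Induced.map f '' T} = f '' {x | Induced.mk N g x ∈ T} := by
      ext y
      constructor
      · rintro ⟨p, hp, h⟩
        obtain ⟨g', x, rfl⟩ := p.exists_mk
        rw [Induced.map_mk, Induced.mk_eq_iff] at h
        obtain ⟨n, rfl, rfl⟩ := h
        refine ⟨n • x, ?_, map_smul f n x⟩
        change Induced.mk N g (n • x) ∈ T
        rwa [Induced.mk_smul]
      · rintro ⟨x, hx, rfl⟩
        exact ⟨_, hx, rfl⟩
    rw [this]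
    exact hf.isClosedMap _ (hT g)

variable [ContinuousConstSMul N X] [ContinuousConstSMul N Y]
  {S : GCWComplex N X} {T : GCWComplex N Y}

theorem GCWComplex.mem_openCell_induced {n : ℕ} {j : S.cell n} {g : G} {x : X} :
    Induced.mk N g x ∈ (S.induced : GCWComplex G _).openCell n j ↔ x ∈ S.openCell n j := by
  constructor
  · rintro ⟨a, y, hy, h⟩
    change a • Induced.mk N 1 (S.map n j y) = _ at h
    rw [Induced.smul_mk, Induced.mk_eq_iff] at h
    obtain ⟨m, -, rfl⟩ := h
    exact ⟨m, y, hy, rfl⟩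
  · rintro ⟨m, y, hy, rfl⟩
    refine ⟨g * m, y, hy, ?_⟩
    change (g * m : G) • Induced.mk N 1 (S.map n j y) = _
    rw [Induced.smul_mk, mul_one, Induced.mk_smul]

theorem GCWComplex.mem_skeleton_induced {n : ℕ} {g : G} {x : X} :
    Induced.mk N g x ∈ (S.induced : GCWComplex G _).skeleton n ↔ x ∈ S.skeleton n :=
  exists_congr fun _ => and_congr_right fun _ => exists_congr fun _ =>
    GCWComplex.mem_openCell_induced

theorem GCWComplex.IsCellular.induced {f : X →[N] Y} (hf : S.IsCellular T f) :
    (S.induced : GCWComplex G _).IsCellular T.induced (Induced.map f) :=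
  ⟨Induced.continuous_map hf.continuous, fun n p hp => by
    obtain ⟨g, x, rfl⟩ := p.exists_mk
    rw [Induced.map_mk]
    rw [GCWComplex.mem_skeleton_induced] at hp ⊢
    exact hf.mapsTo n hp⟩

theorem GCWComplex.IsInclusion.induced {f : X →[N] Y} (hf : S.IsInclusion T f) :
    (S.induced : GCWComplex G _).IsInclusion T.induced (Induced.map f) := by
  refine ⟨Induced.isClosedEmbedding_map hf.isClosedEmbedding, fun n j => ?_⟩
  obtain ⟨k, hk⟩ := hf.image_openCell n j
  refine ⟨k, ?_⟩
  ext p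
  obtain ⟨g, y, rfl⟩ := p.exists_mk
  rw [GCWComplex.mem_openCell_induced, ← hk]
  constructor
  · rintro ⟨p, hp, h⟩
    obtain ⟨g', x, rfl⟩ := p.exists_mk
    replace hp := GCWComplex.mem_openCell_induced.1 hp
    rw [Induced.map_mk, Induced.mk_eq_iff] at h
    obtain ⟨m, -, rfl⟩ := h
    exact ⟨m • x, GCWComplex.smul_mem_openCell m hp, map_smul f m x⟩
  · rintro ⟨x, hx, rfl⟩
    exact ⟨Induced.mk N g x, GCWComplex.mem_openCell_induced.2 hx, rfl⟩

theorem GCWComplex.dimLE_induced {n : ℤ} (h : S.DimLE n) :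
    (S.induced : GCWComplex G _).DimLE n := h

end InducedMaps

/-! ### Slices of a coproduct of induced spaces and their deformation -/

section Slices

variable {G : Type u} [Group G] {ι : Type u} {N : ι → Subgroup G} {B : ι → Type u}
  [∀ i, MulAction (N i) (B i)]

/-- The inclusion of a slice `{i} × g N × B i` into the coproduct of the induced spaces. -/
def sliceMap (i : ι) (g : G) (x : B i) : Σ i, Induced (N i) (B i) := ⟨i, Induced.mk (N i) g x⟩

theorem smul_sliceMap (i : ι) (a g : G) (x : B i) :
    a • (sliceMap i g x : Σ i, Induced (N i) (B i)) = sliceMap i (a * g) x := rfl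

theorem sliceMap_smul (i : ι) (g : G) (n : N i) (x : B i) :
    (sliceMap i g (n • x) : Σ i, Induced (N i) (B i)) = sliceMap i (g * n) x :=
  congrArg (Sigma.mk i) Induced.mk_smul

theorem exists_sliceMap_eq (p : Σ i, Induced (N i) (B i)) : ∃ i g x, sliceMap i g x = p := by
  obtain ⟨i, p⟩ := p
  obtain ⟨g, x, rfl⟩ := p.exists_mk
  exact ⟨i, g, x, rfl⟩

theorem sigmaMap_sliceMap {C : ι → Type u} [∀ i, MulAction (N i) (C i)] (f : ∀ i, C i →[N i] B i)
    (i : ι) (g : G) (x : C i) :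
    sigmaMap (fun i => Induced.map (f i)) (sliceMap i g x) = sliceMap i g (f i x) := rfl

theorem stabilizer_sliceMap_mem (F : SubgroupFamily G) (i : ι) (g : G) {x : B i} :
    MulAction.stabilizer G (sliceMap i g x : Σ i, Induced (N i) (B i)) ∈ F ↔
      MulAction.stabilizer (N i) x ∈ F.inter (N i) := by
  rw [sliceMap, stabilizer_sigma_mk]
  exact F.stabilizer_mk_mem g

variable [∀ i, TopologicalSpace (B i)] [∀ i, ContinuousConstSMul (N i) (B i)]

theorem isClosedEmbedding_sliceMap (i : ι) (g : G) :
    IsClosedEmbedding (sliceMap i g : B i → Σ i, Induced (N i) (B i)) := by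
  have hi := IsClosedEmbedding.sigmaMk (σ := fun i => Induced (N i) (B i)) (i := i)
  refine hi.comp ?_
  refine .of_continuous_injective_isClosedMap (Induced.continuous_mk g) (Induced.mk_injective g)
    fun T hT => Induced.isClosed_iff.2 fun g' => ?_
  by_cases h : ∃ n : N i, g = g' * n
  · obtain ⟨n, rfl⟩ := h
    have : {x | Induced.mk (N i) g' x ∈ Induced.mk (N i) (g' * n) '' T} = (fun x => n⁻¹ • x) ⁻¹' T := by
      ext x
      rw [mem_preimage, mem_ofPred_eq]
      constructor
      · rintro ⟨z, hz, e⟩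
        rw [← Induced.mk_smul] at e
        rwa [← Induced.mk_injective g' e, inv_smul_smul]
      · intro hx
        exact ⟨_, hx, by rw [← Induced.mk_smul, smul_inv_smul]⟩
    rw [this]
    exact hT.preimage (continuous_const_smul _)
  · have : {x | Induced.mk (N i) g' x ∈ Induced.mk (N i) g '' T} = ∅ := by
      rw [eq_empty_iff_forall_notMem]
      rintro x ⟨z, -, e⟩
      obtain ⟨n, hn, -⟩ := Induced.mk_eq_iff.1 e
      exact h ⟨n, hn⟩
    rw [this]
    exact isClosed_empty

/-- Together with `isClosedEmbedding_sliceMap` this makes slices open and closed, so that a path in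
the coproduct never leaves its slice. -/
theorem isOpen_range_sliceMap (i : ι) (g : G) :
    IsOpen (range (sliceMap i g : B i → Σ i, Induced (N i) (B i))) := by
  have h := isOpenMap_sigmaMk (σ := fun i => Induced (N i) (B i)) (i := i) _
    (Induced.isOpen_image_mk (N := N i) (X := B i) g isOpen_univ)
  rwa [image_image, image_univ] at h

open unitInterval

variable {C : ι → Type u}
  [∀ i, TopologicalSpace (C i)] [∀ i, MulAction (N i) (C i)] [∀ i, ContinuousConstSMul (N i) (C i)]

/-- If the fixed point sets of `C i` and `B i` have the disk extension property for subgroups in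
`F` then the coproduct of the `G ×_N C i` is, equivariantly for each subgroup in `F`, a strong
deformation retract of the coproduct of the `G ×_N B i`. -/
theorem exists_strong_deformation (F : SubgroupFamily G) {SC : ∀ i, GCWComplex (N i) (C i)}
    {SB : ∀ i, GCWComplex (N i) (B i)} {f : ∀ i, C i →[N i] B i}
    (hf : ∀ i, (SC i).IsInclusion (SB i) (f i))
    (hC : ∀ i, ∀ L ∈ F.inter (N i), DiskExt (fixedSet (C i) L))
    (hB : ∀ i, ∀ L ∈ F.inter (N i), DiskExt (fixedSet (B i) L)) {K : Subgroup G} (hK : K ∈ F) :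
    ∃ Δ : (Σ i, Induced (N i) (B i)) → C(I, Σ i, Induced (N i) (B i)), Continuous Δ ∧
      (∀ k ∈ K, ∀ p, Δ (k • p) = k • Δ p) ∧ (∀ p, Δ p 0 = p) ∧
      (∀ p, Δ p 1 ∈ range (sigmaMap fun i => Induced.map (f i))) ∧
      ∀ p ∈ range (sigmaMap fun i => Induced.map (f i)), ∀ t, Δ p t = p := by
  have hf' := GCWComplex.IsInclusion.sigma fun i => (hf i).induced (G := G)
  set f' := sigmaMap fun i => Induced.map (f i) with hf'def
  -- A strong deformation retraction as a map to the path space: the condition says that the path of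
  -- a point starts there, ends in the subcomplex, and is constant if the point lies in the
  -- subcomplex.
  obtain ⟨Δ, hΔ, hΔK, -, hΔR⟩ :=
    (GCWComplex.sigma fun i => (SB i).induced (G := G)).exists_equivariant_map_of_subgroup K
    (fun p (γ : C(I, Σ i, Induced (N i) (B i))) => γ 0 = p ∧ γ 1 ∈ range f' ∧
      (p ∈ range f' → ∀ t, γ t = p)) (by
      rintro k - p γ ⟨h1, ⟨c, h2⟩, h3⟩
      refine ⟨?_, ⟨k • c, ?_⟩, ?_⟩
      · rw [ContinuousMap.smul_apply, h1]
      · rw [map_smul, h2]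
        rfl
      · rintro ⟨c, hc⟩ t
        rw [ContinuousMap.smul_apply, h3 ⟨k⁻¹ • c, ?_⟩]
        rw [map_smul, hc]
        exact inv_smul_smul k p)
    (range f') (fun p => ContinuousMap.const I p) hf'.isSubcomplex_range
    (by
      rintro k - _ ⟨c, rfl⟩
      exact ⟨k • c, map_smul f' _ _⟩)
    ContinuousMap.continuous_const'.continuousOn (fun k _ p _ => rfl)
    (fun p hp => ⟨rfl, hp, fun _ _ => rfl⟩) (by
      rintro n ⟨i, j⟩ g hnot s hs hsR hsK
      have hmap : ∀ y, g • (GCWComplex.sigma fun i => (SB i).induced (G := G)).map n ⟨i, j⟩ y =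
          sliceMap i g ((SB i).map n j y) := fun y =>
        congrArg (fun a => (sliceMap i a ((SB i).map n j y) : Σ i, Induced (N i) (B i))) (mul_one g)
      simp only [hmap] at hnot hsR ⊢
      -- `L` collects the elements of the isotropy group of the cell that act through `K`. It is
      -- subconjugate to `K`, hence in `F`, even if the full isotropy group of the cell is not.
      let L : Subgroup (N i) := (SB i).stab n j ⊓
        K.comap ((MulAut.conj g).toMonoidHom.comp (N i).subtype)
      have hL : ∀ m : N i, m ∈ L ↔ m ∈ (SB i).stab n j ∧ g * m * g⁻¹ ∈ K := fun m => Iff.rfl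
      have hLF : L ∈ F.inter (N i) := by
        refine F.le_mem _ ((F.conj_mem_iff g⁻¹ K).2 hK) _ ?_
        rintro _ ⟨m, hm, rfl⟩
        rw [Subgroup.mem_pointwise_smul_iff_inv_smul_mem, ← map_inv, inv_inv]
        exact ((hL m).1 hm).2
      -- The paths start in the clopen slice that contains the cell, so they can be lifted to `B i`.
      have hpath : ∀ y ∈ sphere (0 : Fin n → ℝ) 1, ∀ t,
          s y t ∈ range (sliceMap i g : B i → Σ i, Induced (N i) (B i)) := by
        intro y hy t
        have hcl : IsClopen (s y ⁻¹' range (sliceMap i g : B i → Σ i, Induced (N i) (B i))) :=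
          ⟨(isClosedEmbedding_sliceMap i g).isClosed_range.preimage (s y).continuous,
            (isOpen_range_sliceMap i g).preimage (s y).continuous⟩
        have := hcl.eq_univ ⟨0, by rw [mem_preimage, (hsR y hy).1]; exact mem_range_self _⟩
        have h : t ∈ s y ⁻¹' range (sliceMap i g) := by rw [this]; trivial
        exact h
      have hslice := isClosedEmbedding_sliceMap (N := N) (B := B) i g
      let pc : C(I, B i) → C(I, Σ i, Induced (N i) (B i)) := fun γ =>
        (⟨sliceMap i g, hslice.continuous⟩ : C(B i, Σ i, Induced (N i) (B i))).comp γ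
      have hpc : IsEmbedding pc := ContinuousMap.isEmbedding_postcomp (⟨sliceMap i g, hslice.continuous⟩ : C(B i, Σ i, Induced (N i) (B i))) hslice.isEmbedding
      have hlift : ∀ y ∈ sphere (0 : Fin n → ℝ) 1, ∃ γ, pc γ = s y := by
        intro y hy
        choose γ hγ using hpath y hy
        refine ⟨⟨γ, ?_⟩, ContinuousMap.ext hγ⟩
        rw [hslice.isEmbedding.continuous_iff]
        exact (s y).continuous.congr fun t => (hγ t).symm
      have hne : ∀ y, ∃ γ : C(I, B i), y ∈ sphere (0 : Fin n → ℝ) 1 → pc γ = s y := fun y => by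
        by_cases hy : y ∈ sphere (0 : Fin n → ℝ) 1
        · obtain ⟨γ, hγ⟩ := hlift y hy
          exact ⟨γ, fun _ => hγ⟩
        · exact ⟨ContinuousMap.const _ ((SB i).map n j 0), fun h => absurd h hy⟩
      choose γ hγ using hne
      have hγc : ContinuousOn γ (sphere 0 1) := by
        rw [hpc.continuousOn_iff]
        exact hs.congr fun y hy => hγ y hy
      have hγt : ∀ y ∈ sphere (0 : Fin n → ℝ) 1, ∀ t, sliceMap i g (γ y t) = s y t := fun y hy t =>
        congrArg (fun k : C(I, Σ i, Induced (N i) (B i)) => k t) (hγ y hy)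
      have hLfix : ∀ m ∈ L, ∀ z : B i, (g * m * g⁻¹) • (sliceMap i g z : Σ i, Induced (N i) (B i)) =
          sliceMap i g (m • z) := by
        intro m _ z
        rw [smul_sliceMap, sliceMap_smul, inv_mul_cancel_right]
      have hstab : ∀ m ∈ L, g⁻¹ * (g * m * g⁻¹) * g ∈
          (GCWComplex.sigma fun i => (SB i).induced (G := G)).stab n ⟨i, j⟩ := by
        intro m hm
        refine ⟨m, ((hL m).1 hm).1, ?_⟩
        simp [mul_assoc]
      have hγT : ∀ y ∈ sphere (0 : Fin n → ℝ) 1, ∀ t, γ y t ∈ fixedSet (B i) L := by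
        intro y hy t m hm
        refine hslice.injective ?_
        rw [← hLfix m hm, hγt y hy]
        have := hsK (g * m * g⁻¹) ((hL m).1 hm).2 (hstab m hm) y hy
        exact congrArg (fun k : C(I, Σ i, Induced (N i) (B i)) => k t) this
      have hc : ∀ y ∈ sphere (0 : Fin n → ℝ) 1, ∃ c, f i c = γ y 1 := by
        intro y hy
        obtain ⟨c, hc⟩ := (hsR y hy).2.1
        obtain ⟨i', g', c, rfl⟩ := exists_sliceMap_eq c
        rw [hf'def, sigmaMap_sliceMap, ← hγt y hy] at hc
        obtain ⟨rfl, hc⟩ := Sigma.mk.inj hc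
        obtain ⟨m, -, hm⟩ := Induced.mk_eq_iff.1 (eq_of_heq hc)
        exact ⟨m • c, (map_smul (f i') m c).trans hm.symm⟩
      have hne' : ∀ y, ∃ c : C i, y ∈ sphere (0 : Fin n → ℝ) 1 → f i c = γ y 1 := fun y => by
        by_cases hy : y ∈ sphere (0 : Fin n → ℝ) 1
        · obtain ⟨c, hc⟩ := hc y hy
          exact ⟨c, fun _ => hc⟩
        · obtain ⟨c, -⟩ := (hC i L hLF).1
          exact ⟨c, fun h => absurd h hy⟩
      choose c hcγ using hne'
      have hcc : ContinuousOn c (sphere 0 1) := by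
        rw [(hf i).isClosedEmbedding.isEmbedding.continuousOn_iff]
        exact ((continuous_path_eval 1).comp_continuousOn hγc).congr fun y hy => hcγ y hy
      -- Inside the slice the problem is to compress a disk in the `L`-fixed points of `B i` into `C
      -- i`, relative to a given compression of its boundary.
      obtain ⟨Γ, hΓ, hΓγ, hΓ0, hΓ1, hΓL⟩ := DiskExt.exists_compression
        (hf i).isClosedEmbedding.continuous (hC i L hLF) (hB i L hLF)
        (fun x hx m hm => by rw [← map_smul, hx m hm]) ((SB i).continuousOn n j)
        (fun y hy m hm => (SB i).smul_map n j m ((hL m).1 hm).1 y hy) hγc hγT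
        (fun y hy => hslice.injective (by rw [hγt y hy, (hsR y hy).1])) hcc
        (fun y hy m hm => (hf i).isClosedEmbedding.injective (by
          rw [map_smul, hcγ y hy, hγT y hy 1 m hm]))
        (fun y hy => (hcγ y hy).symm)
      refine ⟨fun y => pc (Γ y), hpc.continuous.comp_continuousOn hΓ, fun y hy => ⟨?_, ?_, ?_⟩,
        ?_, fun y hy => ?_⟩
      · exact congrArg (sliceMap i g) (hΓ0 y hy)
      · obtain ⟨c, hc⟩ := hΓ1 y hy
        exact ⟨sliceMap i g c, congrArg (sliceMap i g) hc⟩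
      -- The open cell is disjoint from the subcomplex, so constancy is a condition on the boundary
      -- only.
      · intro hy' t
        by_cases hyb : y ∈ ball (0 : Fin n → ℝ) 1
        · exact absurd hy' (hnot y hyb)
        · have hys : y ∈ sphere (0 : Fin n → ℝ) 1 := mem_sphere_iff_closedBall.2 ⟨hy, hyb⟩
          rw [← (hsR y hys).2.2 hy' t, ← hγt y hys t, ← hΓγ hys]
          rfl
      · rintro h hh ⟨m, hm, hmh⟩ y hy
        have hmL : m ∈ L := by
          refine (hL m).2 ⟨hm, ?_⟩
          change (m : G) = _ at hmh
          rw [hmh]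
          simpa [mul_assoc] using hh
        have hhm : h = g * m * g⁻¹ := by
          change (m : G) = _ at hmh
          rw [hmh]
          simp [mul_assoc]
        refine ContinuousMap.ext fun t => ?_
        change h • sliceMap i g (Γ y t) = sliceMap i g (Γ y t)
        rw [hhm, hLfix m hmL, hΓL y hy t m hmL]
      · change pc (Γ y) = s y
        rw [hΓγ hy, hγ y hy])
  exact ⟨Δ, hΔ, hΔK, fun p => (hΔR p).1, fun p => (hΔR p).2.1, fun p => (hΔR p).2.2⟩

end Slices

/-! ### Points of a `G`-CW-complex by isotropy class -/

section Pieces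

variable {G : Type u} [Group G]

theorem stabilizer_smul_mem_iff (F : SubgroupFamily G) {Z : Type*} [MulAction G Z] (g : G) (z : Z) :
    MulAction.stabilizer G (g • z) ∈ F ↔ MulAction.stabilizer G z ∈ F := by
  rw [MulAction.stabilizer_smul_eq_stabilizer_map_conj]
  exact F.conj_mem_iff g _

variable {F 𝒢 : SubgroupFamily G}

namespace CompatibleRel

theorem mem_normalizer_iff (E : CompatibleRel F 𝒢) {H : Diff 𝒢 F} {g : G} :
    g ∈ E.normalizer H ↔ E.r (g • H) H := by
  rw [← inv_mem_iff]
  change E.r (g⁻¹⁻¹ • H) H ↔ _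
  rw [inv_inv]

/-- Conjugation by an element of `K` fixes `K`, hence preserves its class, which is that of `H`. -/
theorem le_normalizer (E : CompatibleRel F 𝒢) {H K : Diff 𝒢 F} (h : E.r K H) :
    K.1 ≤ E.normalizer H := by
  intro k hk
  have hK : k • K = K := by
    refine Subtype.ext ?_
    exact Subgroup.conj_smul_eq_self_of_mem hk
  have := (E.rel_conj_iff k _ _).1 h
  rw [hK] at this
  exact E.mem_normalizer_iff.2 (E.iseqv.trans (E.iseqv.symm this) h)

theorem exists_rel (E : CompatibleRel F 𝒢) {H : Diff 𝒢 F} {K : Subgroup (E.normalizer H)}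
    (hK : K ∈ E.family H) (hKF : K ∉ F.inter (E.normalizer H)) :
    ∃ K' : Diff 𝒢 F, K'.1 = K.map (E.normalizer H).subtype ∧ E.r K' H :=
  hK.resolve_right hKF

theorem map_mem_of_mem_family (E : CompatibleRel F 𝒢) (hF𝒢 : F ≤ 𝒢) {H : Diff 𝒢 F}
    {K : Subgroup (E.normalizer H)} (hK : K ∈ E.family H) : K.map (E.normalizer H).subtype ∈ 𝒢 := by
  rcases hK with ⟨K', h, -⟩ | h
  · rw [← h]
    exact K'.2.1
  · exact hF𝒢 _ h

variable {I : Set (Diff 𝒢 F)} {E : CompatibleRel F 𝒢}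

theorem IsCompleteSystem.eq_of_rel (hI : E.IsCompleteSystem I) {H H' : Diff 𝒢 F} (hH : H ∈ I)
    (hH' : H' ∈ I) {g : G} (h : E.r (g • H) H') : H = H' := by
  exact (hI H).unique ⟨hH, 1, by rw [one_smul]⟩ ⟨hH', g, h⟩

end CompatibleRel

variable (Y : Type u) [MulAction G Y]

/-- The points whose isotropy group is equivalent to `H`. -/
def CompatibleRel.piece (E : CompatibleRel F 𝒢) (H : Diff 𝒢 F) :
    SubMulAction (E.normalizer H) Y where
  carrier := {y | ∃ K : Diff 𝒢 F, K.1 = MulAction.stabilizer G y ∧ E.r K H}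
  smul_mem' := by
    rintro n y ⟨K, hK, hr⟩
    refine ⟨(n : G) • K, ?_, E.iseqv.trans ((E.rel_conj_iff n _ _).1 hr)
      (E.mem_normalizer_iff.1 n.2)⟩
    rw [Subgroup.smul_def, MulAction.stabilizer_smul_eq_stabilizer_map_conj, ← hK]
    rfl

variable {Y}

theorem CompatibleRel.stabilizer_notMem {E : CompatibleRel F 𝒢} {H : Diff 𝒢 F} {y : Y}
    (hy : y ∈ E.piece Y H) : MulAction.stabilizer G y ∉ F := by
  obtain ⟨K, hK, -⟩ := hy
  rw [← hK]
  exact K.2.2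

/-- By `le_normalizer` the full isotropy group in `G` already lies in `N_G[H]`, so nothing is lost
by restricting the action. -/
theorem CompatibleRel.stabilizer_piece_mem {E : CompatibleRel F 𝒢} {H : Diff 𝒢 F}
    (y : E.piece Y H) : MulAction.stabilizer (E.normalizer H) y ∈ E.family H := by
  obtain ⟨y, K, hK, hr⟩ := y
  refine Or.inl ⟨K, ?_, hr⟩
  ext g
  rw [Subgroup.mem_map]
  constructor
  · intro hg
    refine ⟨⟨g, E.le_normalizer hr hg⟩, Subtype.ext ?_, rfl⟩
    exact (hK ▸ hg : g ∈ MulAction.stabilizer G y)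
  · rintro ⟨n, hn, rfl⟩
    have h : (n : G) ∈ MulAction.stabilizer G y := congrArg Subtype.val hn
    rwa [← hK] at h

variable [TopologicalSpace Y] [ContinuousConstSMul G Y] {T : GCWComplex G Y}

namespace GCWComplex

theorem isSubcomplex_stabilizer_notMem (F : SubgroupFamily G) :
    T.IsSubcomplex {y | MulAction.stabilizer G y ∉ F} :=
  fun _ j g _ hy hm _ hz h => hm (F.le_mem _ h _ (stabilizer_smul_map_le j g hy hz))

/-- On a closed cell the isotropy contains that of an interior point. It stays outside `F`, and it
stays in the same class because inclusions are contained in the relation. -/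
theorem isSubcomplex_piece {E : CompatibleRel F 𝒢} {H : Diff 𝒢 F}
    (hT : ∀ y : Y, MulAction.stabilizer G y ∈ 𝒢) : T.IsSubcomplex (E.piece Y H : Set Y) := by
  rintro n j g y hy ⟨K, hK, hr⟩ z hz
  have hle := stabilizer_smul_map_le j g hy hz
  let K' : Diff 𝒢 F := ⟨MulAction.stabilizer G (g • T.map n j z), hT _, fun h =>
    K.2.2 (hK ▸ F.le_mem _ h _ hle)⟩
  exact ⟨K', rfl, E.iseqv.trans (E.iseqv.symm (E.rel_of_le K K' (hK ▸ hle))) hr⟩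

/-- A `G`-map on the points with isotropy outside `F` is determined by its restrictions to the
pieces. -/
theorem exists_map_of_pieces (T : GCWComplex G Y) {E : CompatibleRel F 𝒢} {I : Set (Diff 𝒢 F)}
    (hI : E.IsCompleteSystem I) (hT : ∀ y : Y, MulAction.stabilizer G y ∈ 𝒢) {W : Type*}
    [TopologicalSpace W] [MulAction G W] [ContinuousConstSMul G W]
    (hW : ∀ y : Y, MulAction.stabilizer G y ∈ F → Nonempty W) (ψ : ∀ H : I, E.piece Y H.1 → W)
    (hψ : ∀ H, Continuous (ψ H))
    (hψN : ∀ (H : I) (n : E.normalizer H.1) (y : E.piece Y H.1), ψ H (n • y) = (n : G) • ψ H y) :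
    ∃ φ : Y → W, ContinuousOn φ {y | MulAction.stabilizer G y ∉ F} ∧
      (∀ (g : G), ∀ y, MulAction.stabilizer G y ∉ F → φ (g • y) = g • φ y) ∧
      ∀ (H : I) (y : E.piece Y H.1), φ y = ψ H y := by
  classical
  have hex : ∀ y : Y, MulAction.stabilizer G y ∉ F → ∃ (H : I) (g : G), g • y ∈ E.piece Y H.1 := by
    intro y hy
    obtain ⟨H, ⟨hH, g, hg⟩, -⟩ := hI ⟨_, hT y, hy⟩
    refine ⟨⟨H, hH⟩, g, _, ?_, hg⟩
    rw [MulAction.stabilizer_smul_eq_stabilizer_map_conj]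
    rfl
  -- Two translates of `y` into pieces differ by an element that carries the class of `H` to that of
  -- `H'`. Completeness of `I` forces `H = H'`; the element then lies in `N_G[H]`, and equivariance
  -- of `ψ H` applies.
  have hwd : ∀ (y : Y) (H H' : I) (g g' : G) (h : g • y ∈ E.piece Y H.1)
      (h' : g' • y ∈ E.piece Y H'.1), g⁻¹ • ψ H ⟨_, h⟩ = g'⁻¹ • ψ H' ⟨_, h'⟩ := by
    rintro y ⟨H, hH⟩ ⟨H', hH'⟩ g g' h h'
    obtain ⟨K, hK, hr⟩ := id h
    obtain ⟨K', hK', hr'⟩ := id h'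
    have hKK : (g' * g⁻¹) • K = K' := by
      refine Subtype.ext ?_
      have : g' • y = (g' * g⁻¹) • g • y := by rw [smul_smul, inv_mul_cancel_right]
      rw [hK', this, MulAction.stabilizer_smul_eq_stabilizer_map_conj, ← hK]
      rfl
    have hr2 : E.r ((g' * g⁻¹) • H) H' :=
      E.iseqv.trans (E.iseqv.symm ((E.rel_conj_iff _ _ _).1 hr)) (hKK ▸ hr')
    obtain rfl := hI.eq_of_rel hH hH' hr2
    have := hψN ⟨H, hH⟩ ⟨g' * g⁻¹, E.mem_normalizer_iff.2 hr2⟩ ⟨_, h⟩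
    have e : (⟨g' * g⁻¹, E.mem_normalizer_iff.2 hr2⟩ : E.normalizer H) • (⟨g • y, h⟩ : E.piece Y H) =
        ⟨g' • y, h'⟩ := Subtype.ext (by
      rw [SubMulAction.val_smul, Subgroup.smul_def, smul_smul, inv_mul_cancel_right])
    rw [e] at this
    rw [this, smul_smul, inv_mul_cancel_left]
  have hφ : ∀ y : Y, ∃ w : W, ∀ (H : I) (g : G) (h : g • y ∈ E.piece Y H.1),
      w = g⁻¹ • ψ H ⟨_, h⟩ := by
    intro y
    by_cases hy : MulAction.stabilizer G y ∈ F
    · obtain ⟨w⟩ := hW y hy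
      exact ⟨w, fun H g h => absurd ((stabilizer_smul_mem_iff F g y).2 hy)
        (CompatibleRel.stabilizer_notMem h)⟩
    · obtain ⟨H, g, h⟩ := hex y hy
      exact ⟨g⁻¹ • ψ H ⟨_, h⟩, fun H' g' h' => hwd y _ _ _ _ _ _⟩
  choose φ hφ using hφ
  refine ⟨φ, ?_, fun g y hy => ?_, fun H y => ?_⟩
  · refine (isSubcomplex_stabilizer_notMem (T := T) F).continuousOn fun n j g hj => ?_
    -- A closed cell lies in a single translated piece, namely the one that contains its centre.
    obtain ⟨H, g', h⟩ := hex _ (hj 0 (by simp))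
    have hm : ∀ y ∈ closedBall (0 : Fin n → ℝ) 1, g' • g • T.map n j y ∈ E.piece Y H.1 := by
      intro y hy
      rw [smul_smul] at h ⊢
      exact isSubcomplex_piece hT n j _ 0 zero_mem_unitBall h y hy
    rw [continuousOn_iff_continuous_domRestrict]
    have hc := continuousOn_iff_continuous_domRestrict.1 (T.continuousOn_smul_map n j g)
    have : Continuous fun y : closedBall (0 : Fin n → ℝ) 1 =>
        g'⁻¹ • ψ H ⟨g' • g • T.map n j y, hm y y.2⟩ :=
      ((hψ H).comp ((hc.const_smul g').subtype_mk _)).const_smul _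
    exact this.congr fun y => (hφ _ H g' (hm y y.2)).symm
  · obtain ⟨H, g', h⟩ := hex y hy
    have h' : (g' * g⁻¹) • g • y ∈ E.piece Y H.1 := by
      rwa [smul_smul, inv_mul_cancel_right]
    rw [hφ y H g' h, hφ _ H _ h', mul_inv_rev, inv_inv, mul_smul]
    congr 4
    rw [smul_smul, inv_mul_cancel_right]
  · have h : (1 : G) • (y : Y) ∈ E.piece Y H.1 := by
      rw [one_smul]
      exact y.2
    rw [hφ y H 1 h, inv_one, one_smul]
    congr 1
    exact Subtype.ext (one_smul _ _)

end GCWComplex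

end Pieces

/-! ### Pushouts of models -/

section PushoutFixed

open unitInterval

variable {G : Type u} [Group G] {ι : Type u} {N : ι → Subgroup G} {A X : Type u} {B C : ι → Type u}
  [TopologicalSpace A] [MulAction G A] [ContinuousConstSMul G A]
  [TopologicalSpace X] [MulAction G X] [ContinuousConstSMul G X]
  [∀ i, TopologicalSpace (B i)] [∀ i, MulAction (N i) (B i)] [∀ i, ContinuousConstSMul (N i) (B i)]
  [∀ i, TopologicalSpace (C i)] [∀ i, MulAction (N i) (C i)] [∀ i, ContinuousConstSMul (N i) (C i)]
  {SC : ∀ i, GCWComplex (N i) (C i)} {SB : ∀ i, GCWComplex (N i) (B i)} {f : ∀ i, C i →[N i] B i}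
  {i : (Σ i, Induced (N i) (C i)) →[G] A} {a : A →[G] X} {b : (Σ i, Induced (N i) (B i)) →[G] X}

/-- If the fixed point sets of `A`, `C i` and `B i` have the disk extension property for subgroups
in `F` then so do those of the pushout. -/
theorem IsGPushout.diskExt_fixedSet
    (h : IsGPushout i (sigmaMap fun i => Induced.map (f i)) a b) (hi : Continuous i)
    (hf : ∀ i, (SC i).IsInclusion (SB i) (f i)) {F : SubgroupFamily G}
    (hA : ∀ L ∈ F, DiskExt (fixedSet A L))
    (hC : ∀ i, ∀ L ∈ F.inter (N i), DiskExt (fixedSet (C i) L))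
    (hB : ∀ i, ∀ L ∈ F.inter (N i), DiskExt (fixedSet (B i) L)) {K : Subgroup G} (hK : K ∈ F) :
    DiskExt (fixedSet X K) := by
  have hf' := (GCWComplex.IsInclusion.sigma fun i => (hf i).induced (G := G)).isClosedEmbedding
  obtain ⟨Δ, hΔ, hΔK, hΔ0, hΔ1, hΔC⟩ := exists_strong_deformation F hf hC hB hK
  -- The deformation acts on the `B`-part and is stationary on `A`. Being only `K`-equivariant, it
  -- is glued as a function on the underlying sets.
  obtain ⟨D, hDb, hDa⟩ := h.symm.exists_function hf'.injective
    (fun p => (⟨b, h.continuous_right⟩ : C(_, X)).comp (Δ p))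
    (fun z => ContinuousMap.const I (a z)) (fun c => by
      refine ContinuousMap.ext fun t => ?_
      change b (Δ _ t) = a (i c)
      rw [hΔC _ (mem_range_self c), h.comm])
  have hD : Continuous D := by
    rw [h.continuous_iff]
    refine ⟨?_, ?_⟩
    · simp only [hDa]
      exact ContinuousMap.continuous_const'.comp h.continuous_left
    · simp only [hDb]
      exact (ContinuousMap.continuous_postcomp _).comp hΔ
  have hD0 : ∀ x, D x 0 = x := by
    intro x
    rcases h.surjective x with ⟨z, rfl⟩ | ⟨p, rfl⟩
    · rw [hDa]
      rfl
    · rw [hDb]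
      exact congrArg b (hΔ0 p)
  have hD1 : ∀ x, D x 1 ∈ range a := by
    intro x
    rcases h.surjective x with ⟨z, rfl⟩ | ⟨p, rfl⟩
    · rw [hDa]
      exact ⟨z, rfl⟩
    · obtain ⟨c, hc⟩ := hΔ1 p
      rw [hDb]
      exact ⟨i c, (h.comm c).trans (congrArg b hc)⟩
  have hDK : ∀ k ∈ K, ∀ x t, D (k • x) t = k • D x t := by
    intro k hk x t
    rcases h.surjective x with ⟨z, rfl⟩ | ⟨p, rfl⟩
    · rw [← map_smul, hDa, hDa]
      exact map_smul a k z
    · rw [← map_smul, hDb, hDb]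
      change b (Δ (k • p) t) = k • b (Δ p t)
      rw [hΔK k hk, ← map_smul]
      rfl
  have ha := h.symm.isClosedEmbedding_right hf' hi
  refine ⟨?_, fun n s hs hsT => ?_⟩
  · obtain ⟨x, hx⟩ := (hA K hK).1
    exact ⟨a x, fun k hk => by rw [← map_smul, hx k hk]⟩
  -- A sphere in `X^K` is deformed inside `X^K` into `A^K`, filled there, and the filling is carried
  -- back along the deformation.
  · have hfix : ∀ y ∈ sphere (0 : Fin n → ℝ) 1, ∀ t, D (s y) t ∈ fixedSet X K := by
      intro y hy t k hk
      rw [← hDK k hk, hsT hy k hk]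
    obtain ⟨z₀, -⟩ := (hA K hK).1
    have hz : ∀ y, ∃ z, y ∈ sphere (0 : Fin n → ℝ) 1 → a z = D (s y) 1 := fun y => by
      obtain ⟨z, hz⟩ := hD1 (s y)
      exact ⟨z, fun _ => hz⟩
    choose z hz using hz
    have hzc : ContinuousOn z (sphere 0 1) := by
      rw [ha.isEmbedding.continuousOn_iff]
      exact ((continuous_path_eval 1).comp_continuousOn (hD.comp_continuousOn hs)).congr hz
    obtain ⟨α, hα, hαT, hαz⟩ := (hA K hK).2 n z hzc fun y hy k hk => ha.injective (by
      rw [map_smul, hz y hy, hfix y hy 1 k hk])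
    obtain ⟨e, he, heT, hes⟩ := exists_disk_extension_of_homotopy (hD.comp_continuousOn hs) hfix
      (h.continuous_left.comp_continuousOn hα) (fun y hy k hk => by
        change k • a (α y) = a (α y)
        rw [← map_smul, hαT hy k hk])
      (fun y hy => by
        change D (s y) 1 = a (α y)
        rw [hαz hy, hz y hy])
    exact ⟨e, he, heT, fun y hy => (hes y hy).trans (hD0 _)⟩

end PushoutFixed

/-! ### The universal property of the pushout along inclusions `C H → B H` -/

section PushoutModel

variable {G : Type u} [Group G] {F 𝒢 : SubgroupFamily G} {E : CompatibleRel F 𝒢} {I : Set (Diff 𝒢 F)}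
  {A X : Type u} {B C : I → Type u}
  [TopologicalSpace A] [MulAction G A] [ContinuousConstSMul G A]
  [TopologicalSpace X] [MulAction G X]
  [∀ H, TopologicalSpace (B H)] [∀ H : I, MulAction (E.normalizer H.1) (B H)]
  [∀ H : I, ContinuousConstSMul (E.normalizer H.1) (B H)]
  [∀ H, TopologicalSpace (C H)] [∀ H : I, MulAction (E.normalizer H.1) (C H)]
  {SA : GCWComplex G A}
  {SB : ∀ H : I, GCWComplex (E.normalizer H.1) (B H)} {f : ∀ H : I, C H →[E.normalizer H.1] B H}
  {i : (Σ H : I, Induced (E.normalizer H.1) (C H)) →[G] A} {a : A →[G] X}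
  {b : (Σ H : I, Induced (E.normalizer H.1) (B H)) →[G] X}

/-- A point of the pushout whose isotropy group contains a group equivalent to `H` comes from
the slice of `B H`. -/
theorem IsGPushout.exists_slice (h : IsGPushout i (sigmaMap fun H : I => Induced.map (f H)) a b)
    (hI : E.IsCompleteSystem I) (hA : SA.IsModel F) (hB : ∀ H : I, (SB H).IsModel (E.family H.1))
    (hf : Function.Injective (sigmaMap fun H : I => Induced.map (f H)))
    {H : I} {K : Diff 𝒢 F} (hK : E.r K H.1) {x : X} (hx : K.1 ≤ MulAction.stabilizer G x) :
    ∃ z : B H, b (sliceMap H 1 z) = x ∧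
      MulAction.stabilizer (E.normalizer H.1) z ∉ F.inter (E.normalizer H.1) := by
  obtain ⟨ha, hba, hbb⟩ := h.symm.map_eq_of_injective hf
  -- Points of `A` keep their isotropy in the pushout, so `x` lies outside the image of `A` and
  -- comes from a single point of the coproduct with the same isotropy.
  have hxF : MulAction.stabilizer G x ∉ F := fun hF => K.2.2 (F.le_mem _ hF _ hx)
  have hxa : x ∉ range a := by
    rintro ⟨z, rfl⟩
    rw [stabilizer_eq_map fun z' hz' => ha hz'] at hxF
    exact hxF (hA.isotropy z)
  obtain ⟨p, rfl⟩ := (h.surjective x).resolve_left hxa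
  have hp : MulAction.stabilizer G (b p) = MulAction.stabilizer G p := by
    refine stabilizer_eq_map fun p' hp' => (hbb p p' hp').resolve_right ?_
    rintro ⟨c, rfl⟩
    exact hxa ⟨i c, h.comm c⟩
  obtain ⟨H', g, w, rfl⟩ := exists_sliceMap_eq p
  rw [hp] at hx hxF
  rw [stabilizer_sliceMap_mem] at hxF
  obtain ⟨K', hK', hr⟩ := E.exists_rel ((hB H').isotropy w) hxF
  rw [sliceMap, stabilizer_sigma_mk, Induced.stabilizer_mk, ← hK'] at hx
  -- The inclusion `K ≤ g K' g⁻¹` identifies the classes. Hence `H' = H` and `g` lies in `N_G[H]`,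
  -- so that it can be absorbed into `w`.
  have h1 : E.r K (g • K') := E.rel_of_le K (g • K') hx
  have h2 : E.r (g • H'.1) H.1 :=
    E.iseqv.trans (E.iseqv.symm ((E.rel_conj_iff g _ _).1 hr)) (E.iseqv.trans (E.iseqv.symm h1) hK)
  obtain rfl : H' = H := Subtype.ext (hI.eq_of_rel H'.2 H.2 h2)
  let m : E.normalizer H'.1 := ⟨g, E.mem_normalizer_iff.2 h2⟩
  refine ⟨m • w, ?_, ?_⟩
  · rw [sliceMap_smul, one_mul]
  · rwa [stabilizer_smul_mem_iff]

variable [ContinuousConstSMul G X] [∀ H : I, ContinuousConstSMul (E.normalizer H.1) (C H)]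
  {SC : ∀ H : I, GCWComplex (E.normalizer H.1) (C H)}

/-- Two `G`-maps into the pushout are homotopic on the points whose isotropy group is equivalent to
`H`. -/
theorem IsGPushout.exists_homotopy_piece
    (h : IsGPushout i (sigmaMap fun H : I => Induced.map (f H)) a b)
    (hI : E.IsCompleteSystem I) (hA : SA.IsModel F)
    (hC : ∀ H : I, (SC H).IsModel (F.inter (E.normalizer H.1)))
    (hB : ∀ H : I, (SB H).IsModel (E.family H.1)) (hf : ∀ H, (SC H).IsInclusion (SB H) (f H))
    {Y : Type u} [TopologicalSpace Y] [MulAction G Y] [ContinuousConstSMul G Y]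
    {T : GCWComplex G Y} (hT : ∀ y : Y, MulAction.stabilizer G y ∈ 𝒢) {f₀ f₁ : Y →[G] X}
    (hf₀ : Continuous f₀) (hf₁ : Continuous f₁) (H : I) :
    ∃ γ : E.piece Y H.1 → C(unitInterval, X), Continuous γ ∧
      (∀ (n : E.normalizer H.1) (y : E.piece Y H.1), γ (n • y) = (n : G) • γ y) ∧
      ∀ y : E.piece Y H.1, γ y 0 = f₀ y ∧ γ y 1 = f₁ y := by
  have hf' := (GCWComplex.IsInclusion.sigma fun H => (hf H).induced (G := G)).isClosedEmbedding
  obtain ⟨ha, hba, hbb⟩ := h.symm.map_eq_of_injective hf'.injective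
  -- `V` is closed in `B H` and disjoint from `C H`, whose isotropy lies in `F`; therefore `b`
  -- embeds it as a closed subset of `X`.
  let V : Set (B H) := {z | MulAction.stabilizer (E.normalizer H.1) z ∉ F.inter (E.normalizer H.1)}
  have hV : IsClosed V :=
    ((SB H).isSubcomplex_stabilizer_notMem (F.inter (E.normalizer H.1))).isClosed
  have hVr : Disjoint (sliceMap H 1 '' V) (range (sigmaMap fun H : I => Induced.map (f H))) := by
    rw [Set.disjoint_left]
    rintro _ ⟨z, hz, rfl⟩ ⟨p, hp⟩
    obtain ⟨H', g, c, rfl⟩ := exists_sliceMap_eq p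
    rw [sigmaMap_sliceMap, eq_comm] at hp
    replace hz := (not_congr
      (stabilizer_sliceMap_mem (N := fun H : I => E.normalizer H.1) F H 1)).2 hz
    rw [hp, stabilizer_sliceMap_mem,
      stabilizer_eq_map fun c' hc' => (hf H').isClosedEmbedding.injective hc'] at hz
    exact hz ((hC H').isotropy c)
  have hinj : ∀ z ∈ V, ∀ z', b (sliceMap H 1 z) = b (sliceMap H 1 z') → z = z' := by
    intro z hz z' e
    have := (hbb _ _ e).resolve_right fun hr =>
      Set.disjoint_left.1 hVr (mem_image_of_mem _ hz) hr
    exact (isClosedEmbedding_sliceMap H 1).injective this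
  -- Isotropy grows under `k`, so `k` maps the piece to the image of `V`. Injectivity of `b` on `V`
  -- makes the lift equivariant.
  have key : ∀ k : Y →[G] X, Continuous k → ∃ φ : E.piece Y H.1 →[E.normalizer H.1] B H,
      Continuous φ ∧ ∀ y, b (sliceMap H 1 (φ y)) = k y := by
    intro k hk
    have : ∀ y : E.piece Y H.1, ∃ z : B H, b (sliceMap H 1 z) = k y ∧ z ∈ V := by
      rintro ⟨y, K, hK, hr⟩
      exact h.exists_slice hI hA hB hf'.injective hr (hK.le.trans (stabilizer_le_map k y))
    choose φ hφ hφV using this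
    refine ⟨⟨φ, fun n y => ?_⟩, ?_, hφ⟩
    · refine hinj _ (hφV _) _ ?_
      have e : (sliceMap H (n : G) (φ y) : Σ H : I, Induced (E.normalizer H.1) (B H)) =
          (n : G) • sliceMap H 1 (φ y) := by
        rw [smul_sliceMap, mul_one]
      change b (sliceMap H 1 (φ (n • y))) = b (sliceMap H 1 (n • φ y))
      rw [hφ, sliceMap_smul, one_mul, e, map_smul, hφ, SubMulAction.val_smul, Subgroup.smul_def,
        map_smul]
    -- The lift takes values in `V`, so `S` may be replaced by `S ∩ V`, whose image in `X` is
    -- closed.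
    · refine continuous_iff_isClosed.2 fun S hS => ?_
      have hcl : IsClosed (b '' (sliceMap H 1 '' (S ∩ V))) :=
        h.symm.isClosed_image_left hf'.injective
          ((isClosedEmbedding_sliceMap H 1).isClosedMap _ (hS.inter hV))
          (hVr.mono_left (image_mono inter_subset_right))
      convert hcl.preimage (hk.comp (continuous_subtype_val (p := (· ∈ E.piece Y H.1)))) using 1
      ext y
      constructor
      · intro hy
        exact ⟨_, ⟨_, ⟨hy, hφV y⟩, rfl⟩, hφ y⟩
      · rintro ⟨_, ⟨z, hz, rfl⟩, e⟩
        have e' : b (sliceMap H 1 z) = b (sliceMap H 1 (φ y)) := e.trans (hφ y).symm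
        change φ y ∈ S
        rw [← hinj z hz.2 _ e']
        exact hz.1
  obtain ⟨φ₀, hφ₀, hb₀⟩ := key f₀ hf₀
  obtain ⟨φ₁, hφ₁, hb₁⟩ := key f₁ hf₁
  obtain ⟨k, hk, hk0, hk1⟩ := (hB H).homotopic _
    (T.restrict _ (E.piece Y H.1) (GCWComplex.isSubcomplex_piece hT))
    CompatibleRel.stabilizer_piece_mem φ₀ φ₁ hφ₀ hφ₁
  let κ : C(E.piece Y H.1 × unitInterval, X) := ⟨fun p => b (sliceMap H 1 (k p.2 p.1)),
    h.continuous_right.comp ((isClosedEmbedding_sliceMap H 1).continuous.comp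
      (hk.comp continuous_swap))⟩
  refine ⟨κ.curry, κ.curry.continuous, fun n y => ContinuousMap.ext fun t => ?_, fun y => ⟨?_, ?_⟩⟩
  · change b (sliceMap H 1 (k t (n • y))) = (n : G) • b (sliceMap H 1 (k t y))
    rw [map_smul, sliceMap_smul, one_mul, ← map_smul, smul_sliceMap, mul_one]
  · change b (sliceMap H 1 (k 0 y)) = _
    rw [hk0, hb₀]
  · change b (sliceMap H 1 (k 1 y)) = _
    rw [hk1, hb₁]

/-- The pushout of models along inclusions `C H → B H` is a model. -/
theorem IsGPushout.isModel (h : IsGPushout i (sigmaMap fun H : I => Induced.map (f H)) a b)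
    (hF𝒢 : F ≤ 𝒢) (hI : E.IsCompleteSystem I) (hA : SA.IsModel F)
    (hC : ∀ H : I, (SC H).IsModel (F.inter (E.normalizer H.1)))
    (hB : ∀ H : I, (SB H).IsModel (E.family H.1)) (hf : ∀ H, (SC H).IsInclusion (SB H) (f H))
    (hi : Continuous i) (S : GCWComplex G X) : S.IsModel 𝒢 := by
  have hf' := (GCWComplex.IsInclusion.sigma fun H => (hf H).induced (G := G)).isClosedEmbedding
  have hX : ∀ K ∈ F, DiskExt (fixedSet X K) := fun K hK =>
    h.diskExt_fixedSet hi hf (fun L hL => hA.diskExt hL) (fun H L hL => (hC H).diskExt hL)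
      (fun H L hL => (hB H).diskExt (Or.inr hL)) hK
  refine ⟨fun x => ?_, fun Y _ _ _ T hT => ?_, fun Y _ _ _ T hT f₀ f₁ hf₀ hf₁ => ?_⟩
  · obtain ⟨ha, -, hbb⟩ := h.symm.map_eq_of_injective hf'.injective
    by_cases hxa : x ∈ range a
    · obtain ⟨z, rfl⟩ := hxa
      rw [stabilizer_eq_map fun z' hz' => ha hz']
      exact hF𝒢 _ (hA.isotropy z)
    · obtain ⟨p, rfl⟩ := (h.surjective x).resolve_left hxa
      rw [stabilizer_eq_map fun p' hp' => (hbb p p' hp').resolve_right (by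
        rintro ⟨c, rfl⟩
        exact hxa ⟨i c, h.comm c⟩)]
      obtain ⟨H, g, z, rfl⟩ := exists_sliceMap_eq p
      rw [sliceMap, stabilizer_sigma_mk, Induced.stabilizer_mk, 𝒢.conj_mem_iff]
      exact E.map_mem_of_mem_family hF𝒢 ((hB H).isotropy z)
  · have hφ : ∀ H : I, ∃ φ : E.piece Y H.1 →[E.normalizer H.1] B H, Continuous φ := fun H =>
      (hB H).exists_map _ (T.restrict _ (E.piece Y H.1) (GCWComplex.isSubcomplex_piece hT))
        CompatibleRel.stabilizer_piece_mem
    choose φ hφ using hφ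
    obtain ⟨k, hk, hkG, -⟩ := T.exists_map_of_pieces hI hT
      (fun y hy => (hX _ hy).1.to_type) (fun H y => b (sliceMap H 1 (φ H y)))
      (fun H => h.continuous_right.comp ((isClosedEmbedding_sliceMap H 1).continuous.comp (hφ H)))
      (fun H n y => by
        rw [map_smul, sliceMap_smul, one_mul, ← map_smul, smul_sliceMap, mul_one])
    -- The cells that remain have isotropy in `F` and are filled in the fixed sets of `X`.
    obtain ⟨ψ, hψ, -⟩ := T.exists_equivariant_map (fun _ _ => True) (fun _ _ _ _ => trivial)
      {y | MulAction.stabilizer G y ∉ F} k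
      ⟨GCWComplex.isSubcomplex_stabilizer_notMem F,
        fun g y hy => by rwa [mem_ofPred_eq, stabilizer_smul_mem_iff], hk, fun g y hy => hkG g y hy,
        fun _ _ => trivial⟩ (fun n j hnot s hs _ hsf => by
      have hKF : T.stab n j ∈ F := by
        have := hnot 0 GCWComplex.zero_mem_unitBall
        rw [mem_ofPred_eq, not_not, GCWComplex.stabilizer_map j GCWComplex.zero_mem_unitBall] at this
        exact this
      obtain ⟨e, he, heK, hes⟩ := (hX _ hKF).2 n s hs fun y hy g hg => hsf g hg y hy
      exact ⟨e, he, fun _ _ => trivial, fun g hg y hy => heK hy g hg, hes⟩)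
    exact ⟨ψ, hψ⟩
  · choose γ hγ hγN hγ01 using
      h.exists_homotopy_piece (T := T) hI hA hC hB hf hT hf₀ hf₁
    -- The homotopies on the pieces are assembled as an equivariant map to the path space of `X`.
    obtain ⟨k, hk, hkG, hkγ⟩ := T.exists_map_of_pieces hI hT
      (fun y _ => ⟨ContinuousMap.const unitInterval (f₀ y)⟩) γ hγ hγN
    have hrel : ∀ y, MulAction.stabilizer G y ∉ F → k y 0 = f₀ y ∧ k y 1 = f₁ y := by
      intro y hy
      obtain ⟨H, ⟨hH, g, hg⟩, -⟩ := hI ⟨_, hT y, hy⟩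
      have hgy : g • y ∈ E.piece Y H := by
        refine ⟨_, ?_, hg⟩
        rw [MulAction.stabilizer_smul_eq_stabilizer_map_conj]
        rfl
      have := hγ01 ⟨H, hH⟩ ⟨g • y, hgy⟩
      rw [← hkγ, hkG g y hy, ContinuousMap.smul_apply, ContinuousMap.smul_apply, map_smul, map_smul,
        smul_left_cancel_iff, smul_left_cancel_iff] at this
      exact this
    -- Extension over the cells with isotropy in `F`, the endpoints of the paths being prescribed by
    -- `f₀` and `f₁`.
    obtain ⟨Γ, hΓ, -, hΓR⟩ := T.exists_equivariant_map
      (fun y (w : C(unitInterval, X)) => w 0 = f₀ y ∧ w 1 = f₁ y) (fun g y w hw => by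
        rw [ContinuousMap.smul_apply, ContinuousMap.smul_apply, hw.1, hw.2, map_smul, map_smul]
        exact ⟨rfl, rfl⟩)
      {y | MulAction.stabilizer G y ∉ F} k
      ⟨GCWComplex.isSubcomplex_stabilizer_notMem F,
        fun g y hy => by rwa [mem_ofPred_eq, stabilizer_smul_mem_iff], hk, fun g y hy => hkG g y hy,
        hrel⟩ (fun n j hnot s hs hsR hsf => by
      have hKF : T.stab n j ∈ F := by
        have := hnot 0 GCWComplex.zero_mem_unitBall
        rw [mem_ofPred_eq, not_not, GCWComplex.stabilizer_map j GCWComplex.zero_mem_unitBall] at this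
        exact this
      obtain ⟨e, he, hes, he0, he1, heK⟩ := (hX _ hKF).exists_homotopy
        (hf₀.comp_continuousOn (T.continuousOn n j)) (hf₁.comp_continuousOn (T.continuousOn n j))
        (fun y hy g hg => by
          change g • f₀ (T.map n j y) = f₀ (T.map n j y)
          rw [← map_smul, T.smul_map n j g hg y hy])
        (fun y hy g hg => by
          change g • f₁ (T.map n j y) = f₁ (T.map n j y)
          rw [← map_smul, T.smul_map n j g hg y hy])
        hs (fun y hy t g hg => congrArg (fun w : C(unitInterval, X) => w t) (hsf g hg y hy))
        (fun y hy => (hsR y hy).1) (fun y hy => (hsR y hy).2)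
      exact ⟨e, he, fun y hy => ⟨he0 y hy, he1 y hy⟩,
        fun g hg y hy => ContinuousMap.ext fun t => heK y hy t g hg, hes⟩)
    refine ⟨fun t => ⟨fun y => Γ y t, fun g y => by rw [map_smul]; rfl⟩, ?_, ?_, ?_⟩
    · exact ContinuousEval.continuous_eval.comp
        ((hΓ.comp continuous_snd).prodMk continuous_fst)
    · exact MulActionHom.ext fun y => (hΓR y).1
    · exact MulActionHom.ext fun y => (hΓR y).2

end PushoutModel

/-! ### Homotopy invariance of models -/

section Domination

open unitInterval

variable {G : Type u} [Group G] {X Y : Type u} [TopologicalSpace X] [MulAction G X]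
  [TopologicalSpace Y] [MulAction G Y]

theorem GHomotopic.symm {f₀ f₁ : Y →[G] X} (h : GHomotopic f₀ f₁) : GHomotopic f₁ f₀ := by
  obtain ⟨k, hk, hk0, hk1⟩ := h
  refine ⟨fun t => k (unitInterval.symm t), ?_, ?_, ?_⟩
  · exact hk.comp ((unitInterval.continuous_symm.comp continuous_fst).prodMk continuous_snd)
  · exact (congrArg k unitInterval.symm_zero).trans hk1
  · exact (congrArg k unitInterval.symm_one).trans hk0

theorem GHomotopic.trans {f₀ f₁ f₂ : Y →[G] X} (h : GHomotopic f₀ f₁) (h' : GHomotopic f₁ f₂) :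
    GHomotopic f₀ f₂ := by
  obtain ⟨k, hk, rfl, rfl⟩ := h
  obtain ⟨k', hk', hk'0, rfl⟩ := h'
  have c : ∀ {κ : I → Y →[G] X}, Continuous (fun p : I × Y => κ p.1 p.2) → ∀ t,
      Continuous (κ t) := fun hκ t => hκ.comp (continuous_const.prodMk continuous_id)
  let H : ContinuousMap.Homotopy (⟨k 0, c hk 0⟩ : C(Y, X)) ⟨k 1, c hk 1⟩ :=
    ⟨⟨fun p => k p.1 p.2, hk⟩, fun _ => rfl, fun _ => rfl⟩
  let H' : ContinuousMap.Homotopy (⟨k 1, c hk 1⟩ : C(Y, X)) ⟨k' 1, c hk' 1⟩ :=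
    ⟨⟨fun p => k' p.1 p.2, hk'⟩, fun y => congrArg (fun f : Y →[G] X => f y) hk'0, fun _ => rfl⟩
  refine ⟨fun t => ⟨fun y => (H.trans H') (t, y), fun g y => ?_⟩, (H.trans H').continuous,
    MulActionHom.ext fun y => (H.trans H').apply_zero y,
    MulActionHom.ext fun y => (H.trans H').apply_one y⟩
  rw [ContinuousMap.Homotopy.trans_apply, ContinuousMap.Homotopy.trans_apply]
  split_ifs
  · exact map_smul (k _) g y
  · exact map_smul (k' _) g y

theorem GHomotopic.comp_left {Z : Type u} [TopologicalSpace Z] [MulAction G Z] {f₀ f₁ : Y →[G] X}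
    (h : GHomotopic f₀ f₁) {p : X →[G] Z} (hp : Continuous p) :
    GHomotopic (p.comp f₀) (p.comp f₁) := by
  obtain ⟨k, hk, rfl, rfl⟩ := h
  exact ⟨fun t => p.comp (k t), hp.comp hk, rfl, rfl⟩

variable [ContinuousConstSMul G X] [ContinuousConstSMul G Y]

/-- A `G`-CW-complex that is dominated by a model is a model. -/
theorem GCWComplex.IsModel.of_domination {F : SubgroupFamily G} {SY : GCWComplex G Y}
    (hY : SY.IsModel F) (S : GCWComplex G X) {u : X →[G] Y} {p : Y →[G] X} (hu : Continuous u)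
    (hp : Continuous p) {D : X →[G] C(I, X)} (hD : Continuous D) (hD0 : ∀ x, D x 0 = x)
    (hD1 : ∀ x, D x 1 = p (u x)) : S.IsModel F := by
  refine ⟨fun x => F.le_mem _ (hY.isotropy (u x)) _ (stabilizer_le_map u x),
    fun Z _ _ _ T hT => ?_, fun Z _ _ _ T hT f₀ f₁ hf₀ hf₁ => ?_⟩
  · obtain ⟨f, hf⟩ := hY.exists_map Z T hT
    exact ⟨p.comp f, hp.comp hf⟩
  · have key : ∀ f : Z →[G] X, Continuous f → GHomotopic f (p.comp (u.comp f)) := by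
      intro f hf
      refine ⟨fun t => ⟨fun z => D (f z) t, fun g z => ?_⟩, ?_, ?_, ?_⟩
      · rw [map_smul, map_smul]
        rfl
      · exact ContinuousEval.continuous_eval.comp
          (((hD.comp hf).comp continuous_snd).prodMk continuous_fst)
      · exact MulActionHom.ext fun z => hD0 _
      · exact MulActionHom.ext fun z => hD1 _
    exact (key f₀ hf₀).trans (((hY.homotopic Z T hT _ _ (hu.comp hf₀) (hu.comp hf₁)).comp_left
      hp).trans (key f₁ hf₁).symm)

/-- The mapping cylinder of a cellular map to a model is a model. -/
theorem MapCyl.isModel {F : SubgroupFamily G} {f : X →[G] Y} {SX : GCWComplex G X}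
    {SY : GCWComplex G Y} (hY : SY.IsModel F) (hf : SX.IsCellular SY f) :
    (MapCyl.gcw hf).IsModel F := by
  obtain ⟨ρ, hρ, hρc, hρt⟩ := MapCyl.exists_retraction hf.continuous
  obtain ⟨D, hD, hD0, hDc, hDt⟩ := MapCyl.exists_deformation (f := f)
  refine hY.of_domination _ hρ (MapCyl.isGPushout f).continuous_right hD hD0 fun x => ?_
  rcases (MapCyl.isGPushout f).surjective x with ⟨⟨c, t⟩, rfl⟩ | ⟨y, rfl⟩
  · exact (hDc c t).trans (congrArg _ (hρc (c, t)).symm)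
  · rw [hDt, hρt]

end Domination

/-! ### Comparison with the pushout along a mapping cylinder -/

section CylinderPushout

open unitInterval

variable {G : Type u} [Group G] {A B C M X X' : Type u}
  [TopologicalSpace A] [MulAction G A] [ContinuousConstSMul G A]
  [TopologicalSpace B] [MulAction G B]
  [TopologicalSpace C] [MulAction G C] [ContinuousConstSMul G C]
  [TopologicalSpace M] [MulAction G M] [ContinuousConstSMul G M]
  [TopologicalSpace X] [MulAction G X] [ContinuousConstSMul G X]
  [TopologicalSpace X'] [MulAction G X'] [ContinuousConstSMul G X']

/-- The homotopy extension property of a subcomplex. -/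
theorem GCWComplex.IsInclusion.exists_homotopy_extension {SA : GCWComplex G A} {SC : GCWComplex G C}
    {i : C →[G] A} (hi : SC.IsInclusion SA i) {k : A →[G] X} (hk : Continuous k)
    {γ : C →[G] C(I, X)} (hγ : Continuous γ) (h0 : ∀ c, γ c 0 = k (i c)) :
    ∃ η : A →[G] C(I, X), Continuous η ∧ (∀ z, η z 0 = k z) ∧ ∀ c, η (i c) = γ c := by
  have hinj := hi.isClosedEmbedding.injective
  let η₀ : A → C(I, X) := Function.extend i γ fun z => ContinuousMap.const I (k z)
  have hη₀ : ∀ c, η₀ (i c) = γ c := fun c => hinj.extend_apply _ _ c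
  obtain ⟨η, hη, hηD, hηR⟩ := SA.exists_equivariant_map (fun z (w : C(I, X)) => w 0 = k z)
    (fun g z w hw => by rw [ContinuousMap.smul_apply, hw, map_smul]) (range i) η₀
    ⟨hi.isSubcomplex_range, by
      rintro g _ ⟨c, rfl⟩
      exact ⟨g • c, map_smul i g c⟩, by
      -- Continuity on the range is checked on `C`, to which the range is homeomorphic.
      let e := hi.isClosedEmbedding.isEmbedding.toHomeomorph
      rw [continuousOn_iff_continuous_domRestrict, ← e.symm.symm.comp_continuous_iff']
      exact hγ.congr fun c => (hη₀ c).symm, by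
      rintro g _ ⟨c, rfl⟩
      rw [← map_smul, hη₀, hη₀, map_smul], by
      rintro _ ⟨c, rfl⟩
      rw [hη₀, h0]⟩ (fun n j _ s hs hsR hsf => by
    obtain ⟨Γ, hΓ, hΓs, hΓ0, hΓm⟩ := exists_disk_homotopy_extension
      (hk.comp_continuousOn (SA.continuousOn n j)) hs hsR
    refine ⟨Γ, hΓ, hΓ0, fun g hg y hy => ContinuousMap.ext fun t => ?_, hΓs⟩
    rw [ContinuousMap.smul_apply]
    rcases hΓm y hy t with ⟨z, hz, e⟩ | ⟨z, hz, t', e⟩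
    · rw [e, Function.comp, ← map_smul, SA.smul_map n j g hg z hz]
    · rw [e, ← ContinuousMap.smul_apply, hsf g hg z hz])
  refine ⟨η, hη, hηR, fun c => ?_⟩
  rw [hηD (mem_range_self c), hη₀]

/-- The pushout of an inclusion `i` and a map `f` is a model if the pushout of `i` and the
inclusion of the source of a mapping cylinder of `f` is one. -/
theorem IsGPushout.isModel_of_cylinder {i : C →[G] A} {f : C →[G] B} {a : A →[G] X} {b : B →[G] X}
    (h : IsGPushout i f a b) {j : C →[G] M} {a' : A →[G] X'} {b' : M →[G] X'}
    (h' : IsGPushout i j a' b') {SA : GCWComplex G A} {SC : GCWComplex G C}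
    (hi : SC.IsInclusion SA i) {ρ : M →[G] B} (hρ : Continuous ρ) {τ : B →[G] M} (hτ : Continuous τ)
    {γ : C →[G] C(I, M)} (hγ : Continuous γ) (hγ0 : ∀ c, γ c 0 = j c)
    (hγ1 : ∀ c, γ c 1 = τ (f c)) (hργ : ∀ c t, ρ (γ c t) = f c) (hρτ : ∀ y, ρ (τ y) = y)
    {F : SubgroupFamily G} {S' : GCWComplex G X'} (hS' : S'.IsModel F) (S : GCWComplex G X) :
    S.IsModel F := by
  -- `p : X' → X` collapses the cylinder by `ρ`.
  obtain ⟨p, ⟨hp, hpa, hpb⟩, -⟩ := h'.universal X a (b.comp ρ) h.continuous_left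
    (h.continuous_right.comp hρ) (fun c => by
      rw [h.comm, MulActionHom.comp_apply, ← hγ0, hργ])
  let bγ : C →[G] C(I, X') := ⟨fun c => (⟨b', h'.continuous_right⟩ : C(M, X')).comp (γ c),
    fun g c => ContinuousMap.ext fun t => by
      change b' (γ (g • c) t) = g • b' (γ c t)
      rw [map_smul γ, ContinuousMap.smul_apply, map_smul]⟩
  -- On `C` the paths `γ` run through the cylinder from source to target; homotopy extension along
  -- `i` continues them to all of `A`.
  obtain ⟨η, hη, hη0, hηi⟩ := hi.exists_homotopy_extension h'.continuous_left (γ := bγ)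
    ((ContinuousMap.continuous_postcomp _).comp hγ) (fun c => by
      change b' (γ c 0) = _
      rw [hγ0, h'.comm])
  have hηt : ∀ c t, η (i c) t = b' (γ c t) := fun c t =>
    congrArg (fun w : C(I, X') => w t) (hηi c)
  -- At time `1` the homotopy has reached the target on `C`, so it glues with `τ` to a map `u : X →
  -- X'`.
  obtain ⟨u, ⟨hu, hua, hub⟩, -⟩ := h.universal X' ⟨fun z => η z 1, fun g z => by
      rw [map_smul]
      rfl⟩ (b'.comp τ) ((continuous_path_eval 1).comp hη) (h'.continuous_right.comp hτ) (fun c => by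
      change η (i c) 1 = b' (τ (f c))
      rw [hηt, hγ1])
  -- The image of `η` under `p`, stationary on `B`, deforms the identity of `X` to `p ∘ u`.
  obtain ⟨D, ⟨hD, hDa, hDb⟩, -⟩ := h.universal C(I, X)
    ⟨fun z => (⟨p, hp⟩ : C(X', X)).comp (η z), fun g z => ContinuousMap.ext fun t => by
      change p (η (g • z) t) = g • p (η z t)
      rw [map_smul η, ContinuousMap.smul_apply, map_smul]⟩
    ⟨fun y => ContinuousMap.const I (b y), fun g y => ContinuousMap.ext fun t => map_smul b g y⟩
    ((ContinuousMap.continuous_postcomp _).comp hη)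
    (ContinuousMap.continuous_const'.comp h.continuous_right) (fun c => ContinuousMap.ext fun t => by
      change p (η (i c) t) = b (f c)
      rw [hηt, hpb, MulActionHom.comp_apply, hργ])
  refine hS'.of_domination S hu hp hD (fun x => ?_) fun x => ?_
  · rcases h.surjective x with ⟨z, rfl⟩ | ⟨y, rfl⟩
    · rw [hDa]
      change p (η z 0) = a z
      rw [hη0, hpa]
    · rw [hDb]
      rfl
  · rcases h.surjective x with ⟨z, rfl⟩ | ⟨y, rfl⟩
    · rw [hDa, hua]
      rfl
    · rw [hDb, hub, MulActionHom.comp_apply, hpb, MulActionHom.comp_apply, hρτ]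
      rfl

end CylinderPushout

/-! ### The pushout of models -/

section PushoutOfModels

open unitInterval in
-- Assembles the paths through the individual cylinders into one `G`-map, the input `γ` of
-- `IsGPushout.isModel_of_cylinder`.
theorem exists_induced_path {G : Type u} [Group G] {ι : Type u} {N : ι → Subgroup G}
    {B C : ι → Type u} [∀ i, TopologicalSpace (B i)] [∀ i, MulAction (N i) (B i)]
    [∀ i, ContinuousConstSMul (N i) (B i)] [∀ i, TopologicalSpace (C i)]
    [∀ i, MulAction (N i) (C i)] [∀ i, ContinuousConstSMul (N i) (C i)]
    {γ : ∀ i, C i →[N i] C(I, B i)} (hγ : ∀ i, Continuous (γ i)) :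
    ∃ γ' : (Σ i, Induced (N i) (C i)) →[G] C(I, Σ i, Induced (N i) (B i)), Continuous γ' ∧
      ∀ i g c t, γ' (sliceMap i g c) t = sliceMap i g (γ i c t) := by
  let φ : ∀ i, C i →[N i] C(I, Σ i, Induced (N i) (B i)) := fun i =>
    ⟨fun c => (⟨sliceMap i 1, (isClosedEmbedding_sliceMap i 1).continuous⟩ :
      C(B i, Σ i, Induced (N i) (B i))).comp (γ i c), fun n c => ContinuousMap.ext fun t => by
        change (sliceMap i 1 (γ i (n • c) t) : Σ i, Induced (N i) (B i)) =
          (n : G) • sliceMap i 1 (γ i c t)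
        rw [map_smul, ContinuousMap.smul_apply, sliceMap_smul, smul_sliceMap, one_mul, mul_one]⟩
  refine ⟨sigmaLift fun i => Induced.lift (φ i), continuous_sigmaLift fun i =>
    Induced.continuous_lift ((ContinuousMap.continuous_postcomp _).comp (hγ i)), fun i g c t => ?_⟩
  change g • (sliceMap i 1 (γ i c t) : Σ i, Induced (N i) (B i)) = _
  rw [smul_sliceMap, mul_one]

variable {G : Type u} [Group G] {F 𝒢 : SubgroupFamily G} {E : CompatibleRel F 𝒢} {I : Set (Diff 𝒢 F)}
  {A X : Type u} {B C : I → Type u}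
  [TopologicalSpace A] [MulAction G A] [ContinuousConstSMul G A]
  [TopologicalSpace X] [MulAction G X] [ContinuousConstSMul G X]
  [∀ H, TopologicalSpace (B H)] [∀ H : I, MulAction (E.normalizer H.1) (B H)]
  [∀ H : I, ContinuousConstSMul (E.normalizer H.1) (B H)]
  [∀ H, TopologicalSpace (C H)] [∀ H : I, MulAction (E.normalizer H.1) (C H)]
  [∀ H : I, ContinuousConstSMul (E.normalizer H.1) (C H)]
  {SA : GCWComplex G A} {SC : ∀ H : I, GCWComplex (E.normalizer H.1) (C H)}
  {SB : ∀ H : I, GCWComplex (E.normalizer H.1) (B H)} {f : ∀ H : I, C H →[E.normalizer H.1] B H}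
  {i : (Σ H : I, Induced (E.normalizer H.1) (C H)) →[G] A} {a : A →[G] X}
  {b : (Σ H : I, Induced (E.normalizer H.1) (B H)) →[G] X}

/-- The pushout of models along an inclusion of `∐ G ×_N C H` into `A` is a model. -/
theorem IsGPushout.isModel_of_isInclusion
    (h : IsGPushout i (sigmaMap fun H : I => Induced.map (f H)) a b)
    (hF𝒢 : F ≤ 𝒢) (hI : E.IsCompleteSystem I) (hA : SA.IsModel F)
    (hC : ∀ H : I, (SC H).IsModel (F.inter (E.normalizer H.1)))
    (hB : ∀ H : I, (SB H).IsModel (E.family H.1)) (hf : ∀ H, (SC H).IsCellular (SB H) (f H))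
    (hi : (GCWComplex.sigma fun H : I => (SC H).induced).IsInclusion SA i) (S : GCWComplex G X) :
    S.IsModel 𝒢 := by
  -- The comparison pushout, with each `B H` replaced by the mapping cylinder of `f H`, falls under
  -- the case of inclusions.
  have h' := GPushout.isGPushout i
    (sigmaMap fun H : I => Induced.map (G := G) (MapCyl.source (f H)))
  have hs := fun H => MapCyl.isInclusion_source (hf H)
  have hs' := GCWComplex.IsInclusion.sigma fun H => (hs H).induced (G := G)
  have hX' := h'.isModel hF𝒢 hI hA hC (fun H => MapCyl.isModel (hB H) (hf H)) hs
    hi.isClosedEmbedding.continuous (h'.symm.gcw hs' hi.isCellular)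
  choose ρ hρ hρc hρt using fun H => MapCyl.exists_retraction (hf H).continuous
  choose γ hγ hγc using fun H => MapCyl.exists_path (f := f H)
  obtain ⟨γ', hγ', hγs⟩ := exists_induced_path hγ
  refine h.isModel_of_cylinder h' hi (ρ := sigmaMap fun H => Induced.map (ρ H))
    (continuous_sigma fun H => continuous_sigmaMk.comp (Induced.continuous_map (hρ H)))
    (τ := sigmaMap fun H => Induced.map (MapCyl.target (f H)))
    (continuous_sigma fun H => continuous_sigmaMk.comp
      (Induced.continuous_map (MapCyl.isGPushout (f H)).continuous_right))
    hγ' (fun p => ?_) (fun p => ?_) (fun p t => ?_) (fun p => ?_) hX' S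
  all_goals obtain ⟨H, g, c, rfl⟩ := exists_sliceMap_eq p
  · rw [hγs, hγc]
    rfl
  · rw [hγs, hγc, MapCyl.cyl_one]
    rfl
  · rw [hγs, hγc, sigmaMap_sliceMap, sigmaMap_sliceMap]
    exact congrArg _ (hρc H (c, t))
  · rw [sigmaMap_sliceMap, sigmaMap_sliceMap, hρt]

/-- The pushout of models is a model. -/
theorem IsGPushout.exists_gcw_isModel
    (h : IsGPushout i (sigmaMap fun H : I => Induced.map (f H)) a b)
    (hF𝒢 : F ≤ 𝒢) (hI : E.IsCompleteSystem I) (hA : SA.IsModel F)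
    (hC : ∀ H : I, (SC H).IsModel (F.inter (E.normalizer H.1)))
    (hB : ∀ H : I, (SB H).IsModel (E.family H.1))
    (hfi : ((∀ H : I, (SC H).IsCellular (SB H) (f H)) ∧
        (GCWComplex.sigma fun H : I => (SC H).induced).IsInclusion SA i) ∨
      ((∀ H : I, (SC H).IsInclusion (SB H) (f H)) ∧
        (GCWComplex.sigma fun H : I => (SC H).induced).IsCellular SA i)) :
    ∃ S : GCWComplex G X,
      (∀ n, S.skeleton n = a '' SA.skeleton n ∪
        b '' (GCWComplex.sigma fun H : I => (SB H).induced).skeleton n) ∧ S.IsModel 𝒢 := by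
  rcases hfi with ⟨hf, hi⟩ | ⟨hf, hi⟩
  · have hf' := GCWComplex.IsCellular.sigma fun H => (hf H).induced (G := G)
    exact ⟨h.gcw hi hf', fun n => h.skeleton_gcw hi hf' n,
      h.isModel_of_isInclusion hF𝒢 hI hA hC hB hf hi _⟩
  · have hf' := GCWComplex.IsInclusion.sigma fun H => (hf H).induced (G := G)
    exact ⟨h.symm.gcw hf' hi, fun n => (h.symm.skeleton_gcw hf' hi n).trans (union_comm _ _),
      h.isModel hF𝒢 hI hA hC hB hf hi.continuous _⟩

end PushoutOfModels

/-! ### Cellular approximation -/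

section Approximation

variable {n m : ℕ}

/-- A continuous map from a compact set to a space of larger dimension can be approximated by maps
without zeros. -/
theorem exists_approx_ne_zero (hnm : n < m) {K : Set (Fin n → ℝ)} (hK : IsCompact K)
    {φ : (Fin n → ℝ) → Fin m → ℝ} (hφ : ContinuousOn φ K) {δ : ℝ} (hδ : 0 < δ) :
    ∃ ψ : (Fin n → ℝ) → Fin m → ℝ, Continuous ψ ∧ (∀ y, ψ y ≠ 0) ∧ ∀ y ∈ K, ‖ψ y - φ y‖ < δ := by
  -- After a Tietze extension, `φ` is approximated on `K` by a smooth map. The range of a smooth map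
  -- to a space of larger dimension has dense complement, so subtracting a small vector outside the
  -- range removes all zeros.
  obtain ⟨f, hf⟩ := ContinuousMap.exists_restrict_eq hK.isClosed
    (⟨K.domRestrict φ, continuousOn_iff_continuous_domRestrict.1 hφ⟩ : C(K, Fin m → ℝ))
  have hfφ : ∀ y ∈ K, f y = φ y := fun y hy =>
    congrArg (fun k : C(K, Fin m → ℝ) => k ⟨y, hy⟩) hf
  have hd := ContinuousMap.dense_setOfPred_contDiff (E := Fin n → ℝ) (F := Fin m → ℝ) f
  rw [mem_closure_iff_nhds_basis (nhds_basis_uniformity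
    uniformity_basis_dist.compactConvergenceUniformity)] at hd
  obtain ⟨g, hg, hgf⟩ := hd ⟨K, δ / 2⟩ ⟨hK, half_pos hδ⟩
  have hg' : ContDiff ℝ ((⊤ : ℕ∞) : WithTop ℕ∞) g := hg
  have hdense := ContDiff.dense_compl_range_of_finrank_lt_finrank
    (hg'.of_le (by exact_mod_cast le_top)) (by simpa using hnm)
  obtain ⟨v, hv, hvδ⟩ := hdense.exists_dist_lt 0 (half_pos hδ)
  rw [dist_zero_left] at hvδ
  refine ⟨fun y => g y - v, g.continuous.sub continuous_const, fun y hy => hv ⟨y, ?_⟩,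
    fun y hy => ?_⟩
  · exact sub_eq_zero.1 hy
  · have h1 : ‖g y - f y‖ < δ / 2 := by
      rw [← dist_eq_norm]
      exact hgf y hy
    rw [← hfφ y hy, sub_right_comm]
    exact (norm_sub_le _ _).trans_lt (by linarith)

/-- A map from a compact set to a ball of larger dimension can be changed in the interior of the
ball such that it avoids a neighbourhood of the centre. -/
theorem exists_perturbation (hnm : n < m) {K : Set (Fin n → ℝ)} (hK : IsCompact K)
    {φ : (Fin n → ℝ) → Fin m → ℝ} (hφ : ContinuousOn φ K) (hφK : ∀ y ∈ K, ‖φ y‖ ≤ 2 / 3) :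
    ∃ φ' : (Fin n → ℝ) → Fin m → ℝ, ContinuousOn φ' K ∧ (∀ y ∈ K, ‖φ y‖ = 2 / 3 → φ' y = φ y) ∧
      (∀ y ∈ K, ‖φ' y‖ < 1) ∧ ∃ ε > 0, ε ≤ 2 / 3 ∧ ∀ y ∈ K, ε ≤ ‖φ' y‖ := by
  obtain ⟨ψ, hψ, hψ0, hψφ⟩ := exists_approx_ne_zero hnm hK hφ (δ := 1 / 3) (by norm_num)
  -- The cutoff is `1` for `r ≤ 1/3`, where the zero-free `ψ` takes over, and `0` for `r ≥ 2/3`.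
  -- Where `‖φ y‖ ≥ 1/3` a change of norm less than `1/3` cannot create a zero.
  let l : ℝ → ℝ := fun r => max 0 (min 1 (2 - 3 * r))
  have hl0 : ∀ r, 0 ≤ l r := fun r => le_max_left _ _
  have hl1 : ∀ r, l r ≤ 1 := fun r => max_le zero_le_one (min_le_left _ _)
  let φ' : (Fin n → ℝ) → Fin m → ℝ := fun y => φ y + l ‖φ y‖ • (ψ y - φ y)
  have hc : ContinuousOn φ' K := by
    have h1 : ContinuousOn (fun y => l ‖φ y‖) K :=
      (by fun_prop : Continuous l).comp_continuousOn hφ.norm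
    exact hφ.add (h1.smul (hψ.continuousOn.sub hφ))
  have hb : ∀ y ∈ K, ‖l ‖φ y‖ • (ψ y - φ y)‖ < 1 / 3 := by
    intro y hy
    rw [norm_smul, Real.norm_of_nonneg (hl0 _)]
    exact (mul_le_of_le_one_left (norm_nonneg _) (hl1 _)).trans_lt (hψφ y hy)
  have hne : ∀ y ∈ K, φ' y ≠ 0 := by
    intro y hy h
    rcases le_total ‖φ y‖ (1 / 3) with h' | h'
    · have e : l ‖φ y‖ = 1 := by
        simp only [l]
        rw [min_eq_left (by linarith), max_eq_right zero_le_one]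
      simp only [φ', e, one_smul, add_sub_cancel] at h
      exact hψ0 y h
    · have h1 := hb y hy
      rw [← neg_eq_of_add_eq_zero_right h, norm_neg] at h1
      linarith
  refine ⟨φ', hc, fun y hy h => ?_, fun y hy => ?_, ?_⟩
  · have e : l ‖φ y‖ = 0 := by
      simp only [l, h]
      norm_num
    simp only [φ', e, zero_smul, add_zero]
  · exact (norm_add_le _ _).trans_lt (by linarith [hφK y hy, hb y hy])
  · rcases K.eq_empty_or_nonempty with rfl | hKne
    · exact ⟨2 / 3, by norm_num, le_rfl, fun y hy => absurd hy (notMem_empty _)⟩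
    · obtain ⟨y₀, hy₀, hmin⟩ := hK.exists_isMinOn hKne hc.norm
      exact ⟨min ‖φ' y₀‖ (2 / 3), lt_min (norm_pos_iff.2 (hne y₀ hy₀)) (by norm_num),
        min_le_right _ _, fun y hy => (min_le_left _ _).trans (hmin hy)⟩

/-- The radial map of the closed unit ball to itself that maps the complement of the ball of
radius `ε` to the sphere. -/
noncomputable def radialPush (ε : ℝ) (z : Fin m → ℝ) : Fin m → ℝ := (max ε ‖z‖)⁻¹ • z

theorem continuous_radialPush {ε : ℝ} (hε : 0 < ε) :
    Continuous (radialPush ε : (Fin m → ℝ) → Fin m → ℝ) :=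
  ((continuous_const.max continuous_norm).inv₀ fun _ => (lt_max_of_lt_left hε).ne').smul
    continuous_id

theorem norm_radialPush_le {ε : ℝ} (hε : 0 < ε) (z : Fin m → ℝ) : ‖radialPush ε z‖ ≤ 1 := by
  have h : 0 < max ε ‖z‖ := lt_max_of_lt_left hε
  rw [radialPush, norm_smul, norm_inv, Real.norm_of_nonneg h.le, inv_mul_le_one₀ h]
  exact le_max_right _ _

theorem norm_radialPush_eq {ε : ℝ} (hε : 0 < ε) {z : Fin m → ℝ} (hz : ε ≤ ‖z‖) :
    ‖radialPush ε z‖ = 1 := by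
  rw [radialPush, max_eq_right hz, norm_smul, norm_inv, norm_norm,
    inv_mul_cancel₀ (hε.trans_le hz).ne']

theorem radialPush_of_norm_eq_one {ε : ℝ} (hε : ε ≤ 1) {z : Fin m → ℝ} (hz : ‖z‖ = 1) :
    radialPush ε z = z := by
  rw [radialPush, hz, max_eq_right hε, inv_one, one_smul]

end Approximation

/-! ### Pushing disks off cells of larger dimension -/

namespace GCWComplex

variable {G : Type u} [Group G] {X : Type u} [TopologicalSpace X] [MulAction G X]
  [ContinuousConstSMul G X] {S : GCWComplex G X}

/-- Closed cells of dimension at most `m` are disjoint from a given open `m`-cell unless they are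
its closure. -/
theorem smul_map_notMem_image_ball {m : ℕ} (j : S.cell m) (g : G) {k : ℕ} (hk : k ≤ m) (l : S.cell k)
    (h : G) : (∀ y ∈ closedBall (0 : Fin k → ℝ) 1,
      h • S.map k l y ∉ (fun z => g • S.map m j z) '' ball 0 1) ∨
      ((⟨k, l⟩ : Σ k, S.cell k) = ⟨m, j⟩ ∧ ∃ a ∈ S.stab m j, h = g * a) := by
  by_cases H : ∃ y ∈ ball (0 : Fin k → ℝ) 1, h • S.map k l y ∈ (fun z => g • S.map m j z) '' ball 0 1
  · obtain ⟨y, hy, z, hz, e⟩ := H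
    have h0 : (⟨k, l⟩ : Σ k, S.cell k) = ⟨m, j⟩ :=
      openCell_eq_of_mem ⟨h, y, hy, rfl⟩ ⟨g, z, hz, e⟩
    cases h0
    exact Or.inr ⟨rfl, _, ((smul_map_eq_iff hy hz).1 e.symm).1, (mul_inv_cancel_left g h).symm⟩
  · refine Or.inl fun y hy => ?_
    rcases sphere_union_ball hy with hb | hs
    · exact fun hm => H ⟨y, hb, hm⟩
    · rintro ⟨z, hz, e⟩
      obtain ⟨q, hq, hx⟩ := mem_skeleton_sphere k l h hs
      rw [← e] at hx
      have := (smul_map_mem_skeleton_iff hz).1 hx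
      omega

/-- Pushing the complement of a neighbourhood of the centre of a cell to the boundary of the
cell. -/
theorem exists_push {m : ℕ} (j : S.cell m) (g : G) {ε : ℝ} (hε : 0 < ε) (hε1 : ε ≤ 1) :
    ∃ Θ : X → X, ContinuousOn Θ (S.skeleton m) ∧
      (∀ x, x ∉ (fun z => g • S.map m j z) '' ball 0 1 → Θ x = x) ∧
      ∀ z ∈ ball (0 : Fin m → ℝ) 1, Θ (g • S.map m j z) = g • S.map m j (radialPush ε z) := by
  classical
  let Θ : X → X := fun x => if h : ∃ z ∈ ball (0 : Fin m → ℝ) 1, g • S.map m j z = x then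
    g • S.map m j (radialPush ε h.choose) else x
  have h1 : ∀ x, x ∉ (fun z => g • S.map m j z) '' ball 0 1 → Θ x = x := fun x hx => dif_neg hx
  have h2 : ∀ z ∈ ball (0 : Fin m → ℝ) 1, Θ (g • S.map m j z) = g • S.map m j (radialPush ε z) := by
    intro z hz
    have h : ∃ z' ∈ ball (0 : Fin m → ℝ) 1, g • S.map m j z' = g • S.map m j z := ⟨z, hz, rfl⟩
    have e : h.choose = z := ((smul_map_eq_iff h.choose_spec.1 hz).1 h.choose_spec.2).2
    have : Θ (g • S.map m j z) = g • S.map m j (radialPush ε h.choose) := dif_pos h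
    rw [this, e]
  have h3 : ∀ z ∈ closedBall (0 : Fin m → ℝ) 1,
      Θ (g • S.map m j z) = g • S.map m j (radialPush ε z) := by
    intro z hz
    rcases sphere_union_ball hz with hb | hs
    · exact h2 z hb
    · rw [radialPush_of_norm_eq_one hε1 (mem_sphere_zero_iff_norm.1 hs), h1]
      rintro ⟨z', hz', e⟩
      obtain ⟨q, hq, hx⟩ := mem_skeleton_sphere m j g hs
      rw [← e] at hx
      have := (smul_map_mem_skeleton_iff hz').1 hx
      omega
  refine ⟨Θ, (isSubcomplex_skeleton m).continuousOn fun k l h hm => ?_, h1, h2⟩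
  have hk : k ≤ m := (smul_map_mem_skeleton_iff zero_mem_unitBall).1
    (hm 0 (ball_subset_closedBall zero_mem_unitBall))
  rcases smul_map_notMem_image_ball j g hk l h with hn | ⟨e, a, has, ha⟩
  · exact (S.continuousOn_smul_map k l h).congr fun y hy => h1 _ (hn y hy)
  · cases e
    have hmap : ∀ y ∈ closedBall (0 : Fin m → ℝ) 1, h • S.map m j y = g • S.map m j y := by
      intro y hy
      rw [ha, mul_smul, S.smul_map m j a has y hy]
    refine ((S.continuousOn_smul_map m j g).comp (continuous_radialPush hε).continuousOn
      fun y _ => mem_closedBall_zero_iff.2 (norm_radialPush_le hε y)).congr fun y hy => ?_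
    rw [hmap y hy, h3 y hy]
    rfl

/-- Among the closed cells of dimension at most `m` only the given one meets the removed set, and
its trace is the closed ball without an open ball. -/
theorem isClosed_skeleton_diff {m : ℕ} (j : S.cell m) (g : G) {r : ℝ} (hr : r ≤ 1) :
    IsClosed (S.skeleton m \ (fun z => g • S.map m j z) '' ball 0 r) := by
  refine (isSubcomplex_skeleton m).isClosed_of_subset sdiff_subset fun k l h hm => ?_
  have hk : k ≤ m := (smul_map_mem_skeleton_iff zero_mem_unitBall).1
    (hm 0 (ball_subset_closedBall zero_mem_unitBall))
  rcases smul_map_notMem_image_ball j g hk l h with hn | ⟨e, a, has, ha⟩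
  · have e : {y | y ∈ closedBall (0 : Fin k → ℝ) 1 ∧ h • S.map k l y ∈
        S.skeleton m \ (fun z => g • S.map m j z) '' ball 0 r} = closedBall 0 1 :=
      Set.ext fun y => ⟨fun hy => hy.1, fun hy => ⟨hy, hm y hy, fun hy' =>
        hn y hy (image_mono (ball_subset_ball hr) hy')⟩⟩
    rw [e]
    exact isClosed_closedBall
  · cases e
    have hmap : ∀ y ∈ closedBall (0 : Fin m → ℝ) 1, h • S.map m j y = g • S.map m j y := by
      intro y hy
      rw [ha, mul_smul, S.smul_map m j a has y hy]
    have e : {y | y ∈ closedBall (0 : Fin m → ℝ) 1 ∧ h • S.map m j y ∈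
        S.skeleton m \ (fun z => g • S.map m j z) '' ball 0 r} = closedBall 0 1 ∩ (ball 0 r)ᶜ := by
      refine Set.ext fun y => ⟨fun hy => ⟨hy.1, fun hyr => hy.2.2 ⟨y, hyr, (hmap y hy.1).symm⟩⟩,
        fun hy => ⟨hy.1, hm y hy.1, ?_⟩⟩
      rintro ⟨z, hz, e⟩
      have hz1 := ball_subset_ball hr hz
      change g • S.map m j z = h • S.map m j y at e
      rw [hmap y hy.1] at e
      rcases sphere_union_ball hy.1 with hb | hs
      · rw [((smul_map_eq_iff hz1 hb).1 e).2] at hz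
        exact hy.2 hz
      · obtain ⟨q, hq, hx⟩ := mem_skeleton_sphere m j g hs
        rw [← e] at hx
        have := (smul_map_mem_skeleton_iff hz1).1 hx
        omega
    rw [e]
    exact isClosed_closedBall.inter isOpen_ball.isClosed_compl

/-- A map from a disk to the `m`-skeleton, where `m` is larger than the dimension of the disk, can
be pushed off an open `m`-cell. -/
theorem exists_push_off {n m : ℕ} (hnm : n < m) (j : S.cell m) (g : G) {e : (Fin n → ℝ) → X}
    (he : ContinuousOn e (closedBall 0 1)) (hem : MapsTo e (closedBall 0 1) (S.skeleton m)) :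
    ∃ e' : (Fin n → ℝ) → X, ContinuousOn e' (closedBall 0 1) ∧ ∀ y ∈ closedBall (0 : Fin n → ℝ) 1,
      (e y ∉ (fun z => g • S.map m j z) '' ball 0 1 ∧ e' y = e y) ∨
      (e y ∈ (fun z => g • S.map m j z) '' ball 0 1 ∧
        ∃ w ∈ sphere (0 : Fin m → ℝ) 1, e' y = g • S.map m j w) := by
  classical
  have := S.t2
  let κ : closedBall (0 : Fin m → ℝ) (2 / 3) → X := fun z => g • S.map m j z
  have h23 : closedBall (0 : Fin m → ℝ) (2 / 3) ⊆ ball 0 1 := closedBall_subset_ball (by norm_num)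
  have hκc : Continuous κ := continuousOn_iff_continuous_domRestrict.1
    ((S.continuousOn_smul_map m j g).mono (h23.trans ball_subset_closedBall))
  have hκ : IsClosedEmbedding κ := hκc.isClosedEmbedding fun z z' h =>
    Subtype.ext ((smul_map_eq_iff (h23 z.2) (h23 z'.2)).1 h).2
  -- `K₁` is mapped to the concentric closed ball of radius `2/3` in the cell, `K₂` to the
  -- complement of the open one. The perturbation on `K₁` leaves points of radius `2/3` unchanged,
  -- so it glues with `e` on `K₂`.
  let K₁ : Set (Fin n → ℝ) := closedBall 0 1 ∩ e ⁻¹' range κ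
  let K₂ : Set (Fin n → ℝ) := closedBall 0 1 ∩
    e ⁻¹' (S.skeleton m \ (fun z => g • S.map m j z) '' ball 0 (2 / 3))
  have hK₁ : IsClosed K₁ := he.preimage_isClosed_of_isClosed isClosed_closedBall hκ.isClosed_range
  have hK₂ : IsClosed K₂ := he.preimage_isClosed_of_isClosed isClosed_closedBall
    (isClosed_skeleton_diff j g (by norm_num))
  have hK : closedBall 0 1 ⊆ K₁ ∪ K₂ := by
    intro y hy
    by_cases h : e y ∈ (fun z => g • S.map m j z) '' ball 0 (2 / 3)
    · obtain ⟨z, hz, h⟩ := h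
      exact Or.inl ⟨hy, ⟨z, ball_subset_closedBall hz⟩, h⟩
    · exact Or.inr ⟨hy, hem hy, h⟩
  have hφ : ∀ y, ∃ z : closedBall (0 : Fin m → ℝ) (2 / 3), y ∈ K₁ → κ z = e y := by
    intro y
    by_cases h : y ∈ K₁
    · obtain ⟨z, hz⟩ := h.2
      exact ⟨z, fun _ => hz⟩
    · exact ⟨⟨0, mem_closedBall_self (by norm_num)⟩, fun h' => absurd h' h⟩
  choose φ hφ using hφ
  have hφc : ContinuousOn φ K₁ := by
    rw [hκ.isEmbedding.continuousOn_iff]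
    exact (he.mono inter_subset_left).congr fun y hy => hφ y hy
  obtain ⟨φ', hφ', hφφ', hφ1, ε, hε, hε1, hφε⟩ := exists_perturbation hnm
    ((isCompact_closedBall _ _).of_isClosed_subset hK₁ inter_subset_left)
    (continuous_subtype_val.comp_continuousOn hφc)
    fun y _ => mem_closedBall_zero_iff.1 (φ y).2
  let e₁ : (Fin n → ℝ) → X := fun y => if y ∈ K₁ then g • S.map m j (φ' y) else e y
  have e₁K₁ : ∀ y ∈ K₁, e₁ y = g • S.map m j (φ' y) := fun y hy => if_pos hy
  have e₁K₂ : ∀ y ∈ K₂, e₁ y = e y := by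
    intro y hy
    by_cases h : y ∈ K₁
    · have h2 : ‖(φ y : Fin m → ℝ)‖ = 2 / 3 := by
        refine le_antisymm (mem_closedBall_zero_iff.1 (φ y).2) (not_lt.1 fun hlt => ?_)
        exact hy.2.2 ⟨φ y, mem_ball_zero_iff.2 hlt, hφ y h⟩
      rw [e₁K₁ y h, hφφ' y h h2, ← hφ y h]
      rfl
    · exact if_neg h
  have hball : ∀ y ∈ K₁, φ' y ∈ ball (0 : Fin m → ℝ) 1 := fun y hy =>
    mem_ball_zero_iff.2 (hφ1 y hy)
  have he₁ : ContinuousOn e₁ (closedBall 0 1) := by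
    refine (ContinuousOn.union_of_isClosed ?_ ?_ hK₁ hK₂).mono hK
    · exact ((S.continuousOn_smul_map m j g).comp hφ' fun y hy =>
        ball_subset_closedBall (hball y hy)).congr e₁K₁
    · exact (he.mono inter_subset_left).congr e₁K₂
  have hcases : ∀ y ∈ closedBall (0 : Fin n → ℝ) 1,
      (e y ∉ (fun z => g • S.map m j z) '' ball 0 1 ∧ e₁ y = e y) ∨
      (e y ∈ (fun z => g • S.map m j z) '' ball 0 1 ∧
        ∃ w ∈ ball (0 : Fin m → ℝ) 1, ε ≤ ‖w‖ ∧ e₁ y = g • S.map m j w) := by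
    intro y hy
    by_cases h : y ∈ K₁
    · exact Or.inr ⟨⟨φ y, h23 (φ y).2, hφ y h⟩, φ' y, hball y h, hφε y h, e₁K₁ y h⟩
    · have h2 : e₁ y = e y := if_neg h
      by_cases hU : e y ∈ (fun z => g • S.map m j z) '' ball 0 1
      · obtain ⟨z, hz, hzy⟩ := id hU
        refine Or.inr ⟨hU, z, hz, hε1.trans (not_lt.1 fun hlt => h ⟨hy, ⟨z, ?_⟩, hzy⟩), ?_⟩
        · exact mem_closedBall_zero_iff.2 hlt.le
        · rw [h2, ← hzy]
      · exact Or.inl ⟨hU, h2⟩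
  -- The perturbed disk avoids the ball of radius `ε` about the centre, so the radial push moves its
  -- part in the open cell to the boundary of the cell.
  obtain ⟨Θ, hΘ, hΘ1, hΘ2⟩ := exists_push j g hε (by linarith)
  refine ⟨fun y => Θ (e₁ y), hΘ.comp he₁ fun y hy => ?_, fun y hy => ?_⟩
  · rcases hcases y hy with ⟨-, h⟩ | ⟨-, w, hw, -, h⟩
    · rw [h]
      exact hem hy
    · rw [h]
      exact mem_skeleton_closedCell m j g (ball_subset_closedBall hw)
  · rcases hcases y hy with ⟨hU, h⟩ | ⟨hU, w, hw, hwε, h⟩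
    · refine Or.inl ⟨hU, ?_⟩
      change Θ (e₁ y) = e y
      rw [h, hΘ1 _ hU]
    · refine Or.inr ⟨hU, radialPush ε w, mem_sphere_zero_iff_norm.2 (norm_radialPush_eq hε hwε), ?_⟩
      change Θ (e₁ y) = _
      rw [h, hΘ2 w hw]

end GCWComplex

namespace GCWComplex

variable {G : Type u} [Group G] {X : Type u} [TopologicalSpace X] [MulAction G X]
  [ContinuousConstSMul G X] {S : GCWComplex G X}

/-- Removes the open cells of dimension `k + 1` one at a time. Fixed sets are respected because
isotropy grows towards the boundary of a cell. The boundary values do not move, since they lie in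
the `n`-skeleton and `n ≤ k`. -/
theorem exists_push_off_finset {n k : ℕ} (hnk : n ≤ k) {L : Subgroup G}
    (T : Finset (G × Σ m, S.cell m)) : ∀ e : (Fin n → ℝ) → X, ContinuousOn e (closedBall 0 1) →
      MapsTo e (closedBall 0 1) (S.skeleton (k + 1)) → MapsTo e (closedBall 0 1) (fixedSet X L) →
      (∀ y ∈ closedBall (0 : Fin n → ℝ) 1, e y ∈ S.skeleton k ∨
        ∃ c ∈ T, ∃ z ∈ ball (0 : Fin c.2.1 → ℝ) 1, e y = c.1 • S.map c.2.1 c.2.2 z) →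
      MapsTo e (sphere 0 1) (S.skeleton n) →
      ∃ e' : (Fin n → ℝ) → X, ContinuousOn e' (closedBall 0 1) ∧
        MapsTo e' (closedBall 0 1) (S.skeleton k) ∧ MapsTo e' (closedBall 0 1) (fixedSet X L) ∧
        EqOn e' e (sphere 0 1) := by
  classical
  induction T using Finset.induction_on with
  | empty =>
    intro e he _ heL heT _
    exact ⟨e, he, fun y hy => (heT y hy).resolve_right (by simp), heL, fun _ _ => rfl⟩
  | insert c T _ ih =>
    intro e he hek heL heT hes
    obtain ⟨g, m, j⟩ := c
    by_cases hm : m = k + 1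
    · subst hm
      obtain ⟨e', he', h⟩ := exists_push_off (Nat.lt_succ_of_le hnk) j g he hek
      have hes' : EqOn e' e (sphere 0 1) := by
        intro y hy
        rcases h y (sphere_subset_closedBall hy) with ⟨-, h⟩ | ⟨⟨z, hz, h⟩, -⟩
        · exact h
        · have h1 := hes hy
          rw [← h] at h1
          have := (smul_map_mem_skeleton_iff hz).1 h1
          omega
      have hsk : ∀ w ∈ sphere (0 : Fin (k + 1) → ℝ) 1, g • S.map (k + 1) j w ∈ S.skeleton k := by
        intro w hw
        obtain ⟨q, hq, hx⟩ := mem_skeleton_sphere (k + 1) j g hw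
        exact skeleton_mono (Nat.le_of_lt_succ hq) hx
      have h1 : MapsTo e' (closedBall 0 1) (S.skeleton (k + 1)) := by
        intro y hy
        rcases h y hy with ⟨-, h⟩ | ⟨-, w, hw, h⟩
        · rw [h]
          exact hek hy
        · rw [h]
          exact skeleton_mono k.le_succ (hsk w hw)
      have h2 : MapsTo e' (closedBall 0 1) (fixedSet X L) := by
        intro y hy
        rcases h y hy with ⟨-, h⟩ | ⟨⟨z, hz, hzy⟩, w, hw, h⟩
        · rw [h]
          exact heL hy
        · rw [h, mem_fixedSet_iff_le]
          refine le_trans ?_ (stabilizer_smul_map_le j g hz (sphere_subset_closedBall hw))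
          change L ≤ MulAction.stabilizer G ((fun z => g • S.map (k + 1) j z) z)
          rw [hzy]
          exact heL hy
      have h3 : ∀ y ∈ closedBall (0 : Fin n → ℝ) 1, e' y ∈ S.skeleton k ∨
          ∃ c ∈ T, ∃ z ∈ ball (0 : Fin c.2.1 → ℝ) 1, e' y = c.1 • S.map c.2.1 c.2.2 z := by
        intro y hy
        rcases h y hy with ⟨hn, h⟩ | ⟨-, w, hw, h⟩
        · rw [h]
          refine (heT y hy).imp_right ?_
          rintro ⟨c, hc, z, hz, hzy⟩
          rcases Finset.mem_insert.1 hc with rfl | hc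
          · exact absurd ⟨z, hz, hzy.symm⟩ hn
          · exact ⟨c, hc, z, hz, hzy⟩
        · rw [h]
          exact Or.inl (hsk w hw)
      obtain ⟨e'', k1, k2, k3, k4⟩ := ih e' he' h1 h2 h3 fun y hy => by rw [hes' hy]; exact hes hy
      exact ⟨e'', k1, k2, k3, k4.trans hes'⟩
    · refine ih e he hek heL (fun y hy => ?_) hes
      rcases heT y hy with h | ⟨c, hc, z, hz, hzy⟩
      · exact Or.inl h
      · rcases Finset.mem_insert.1 hc with rfl | hc
        · have h1 := hek hy
          rw [hzy] at h1 ⊢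
          have := (smul_map_mem_skeleton_iff hz).1 h1
          exact Or.inl ((smul_map_mem_skeleton_iff hz).2 (Nat.le_of_lt_succ (this.lt_of_ne hm)))
        · exact Or.inr ⟨c, hc, z, hz, hzy⟩

/-- A disk whose boundary lies in the skeleton of its dimension can be pushed into this
skeleton. -/
theorem exists_push_to_skeleton {n : ℕ} {L : Subgroup G} {e : (Fin n → ℝ) → X}
    (he : ContinuousOn e (closedBall 0 1)) (heL : MapsTo e (closedBall 0 1) (fixedSet X L))
    (hes : MapsTo e (sphere 0 1) (S.skeleton n)) :
    ∃ e' : (Fin n → ℝ) → X, ContinuousOn e' (closedBall 0 1) ∧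
      MapsTo e' (closedBall 0 1) (S.skeleton n) ∧ MapsTo e' (closedBall 0 1) (fixedSet X L) ∧
      EqOn e' e (sphere 0 1) := by
  -- By compactness the disk lies in some skeleton; descend from there one dimension at a time.
  have key : ∀ d, ∀ e : (Fin n → ℝ) → X, ContinuousOn e (closedBall 0 1) →
      MapsTo e (closedBall 0 1) (fixedSet X L) → MapsTo e (sphere 0 1) (S.skeleton n) →
      MapsTo e (closedBall 0 1) (S.skeleton (n + d)) →
      ∃ e' : (Fin n → ℝ) → X, ContinuousOn e' (closedBall 0 1) ∧
        MapsTo e' (closedBall 0 1) (S.skeleton n) ∧ MapsTo e' (closedBall 0 1) (fixedSet X L) ∧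
        EqOn e' e (sphere 0 1) := by
    intro d
    induction d with
    | zero => exact fun e he heL _ hed => ⟨e, he, hed, heL, fun _ _ => rfl⟩
    | succ d ih =>
      intro e he heL hes hed
      obtain ⟨T, hT⟩ := S.finite_of_isCompact ((isCompact_closedBall _ _).image_of_continuousOn he)
      obtain ⟨e', h1, h2, h3, h4⟩ := exists_push_off_finset (Nat.le_add_right n d) T e he hed heL
        (fun y hy => Or.inr (hT _ (mem_image_of_mem e hy))) hes
      obtain ⟨e'', h5, h6, h7, h8⟩ := ih e' h1 h3 (fun y hy => by rw [h4 hy]; exact hes hy) h2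
      exact ⟨e'', h5, h6, h7, h8.trans h4⟩
  obtain ⟨T, hT⟩ := S.finite_of_isCompact ((isCompact_closedBall _ _).image_of_continuousOn he)
  refine key (T.sup fun c => c.2.1) e he heL hes fun y hy => ?_
  obtain ⟨c, hc, z, hz, h⟩ := hT _ (mem_image_of_mem e hy)
  rw [h, smul_map_mem_skeleton_iff hz]
  exact (Finset.le_sup (f := fun c : G × Σ m, S.cell m => c.2.1) hc).trans (Nat.le_add_left _ _)

/-- Every `G`-CW-complex with isotropy in `F` has a cellular `G`-map to a model for `E_F(G)`. -/
theorem IsModel.exists_isCellular {F : SubgroupFamily G} (hS : S.IsModel F) {Y : Type u}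
    [TopologicalSpace Y] [MulAction G Y] [ContinuousConstSMul G Y] (T : GCWComplex G Y)
    (hT : ∀ y : Y, MulAction.stabilizer G y ∈ F) : ∃ φ : Y →[G] X, T.IsCellular S φ := by
  -- A nonempty `Y` provides a group in `F`, hence a point of `X`, which serves as default value for
  -- the empty partial map.
  by_cases hne : Nonempty Y
  · obtain ⟨y₀⟩ := hne
    obtain ⟨x₀, -⟩ := (hS.diskExt (hT y₀)).1
    -- Cellularity, stated for all skeleta at once, is a pointwise condition that can be imposed
    -- during the construction.
    obtain ⟨φ, hφ, -, hφR⟩ := T.exists_equivariant_map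
      (fun y x => ∀ k, y ∈ T.skeleton k → x ∈ S.skeleton k)
      (fun g y x h k hk => smul_mem_skeleton g (h k (by
        simpa only [inv_smul_smul] using smul_mem_skeleton g⁻¹ hk)))
      ∅ (fun _ => x₀) (T.isPartialMap_empty _ _) (fun n j _ s hs hsR hsf => by
        have hL : T.stab n j ∈ F := by
          rw [← stabilizer_map j zero_mem_unitBall]
          exact hT _
        have hss : MapsTo s (sphere 0 1) (S.skeleton n) := by
          intro y hy
          have := mem_skeleton_closedCell n j 1 (sphere_subset_closedBall hy)
          rw [one_smul] at this
          exact hsR y hy n this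
        obtain ⟨e, he, heL, hes⟩ := (hS.diskExt hL).2 n s hs fun y hy g hg => hsf g hg y hy
        obtain ⟨e', he', hen, heL', hes'⟩ := exists_push_to_skeleton he heL
          (hss.congr hes.symm)
        refine ⟨e', he', fun y hy k hk => ?_, fun g hg y hy => heL' hy g hg, hes'.trans hes⟩
        rcases sphere_union_ball hy with hb | hb
        · rw [← one_smul G (T.map n j y), smul_map_mem_skeleton_iff hb] at hk
          exact skeleton_mono hk (hen hy)
        · rw [hes' hb, hes hb]
          exact hsR y hb k hk)
    exact ⟨φ, hφ, fun k y hy => hφR y k hy⟩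
  · rw [not_nonempty_iff] at hne
    exact ⟨⟨fun y => isEmptyElim y, fun _ y => isEmptyElim y⟩,
      continuous_of_discreteTopology, fun _ y => isEmptyElim y⟩

end GCWComplex

/-! ### The dimension of the pushout -/

namespace GCWComplex

variable {G : Type u} [Group G] {X : Type u} [TopologicalSpace X] [MulAction G X]
  [ContinuousConstSMul G X] {S : GCWComplex G X}

/-- For a natural number `n` the value `n - 1 ≥ -1` is admissible in the definition, so minimality
of `n` amounts to the existence of an `n`-cell. -/
theorem dimEq_iff {n : ℕ} : S.DimEq n ↔ S.DimLE n ∧ Nonempty (S.cell n) := by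
  constructor
  · rintro ⟨⟨-, h⟩, hl⟩
    refine ⟨h, ?_⟩
    by_contra hn
    rw [not_nonempty_iff] at hn
    have : (n : ℤ) ≤ n - 1 := hl ⟨by omega, fun k hk => by
      rcases (show n ≤ k by omega).eq_or_lt with rfl | hk'
      · exact hn
      · exact h k (by exact_mod_cast hk')⟩
    omega
  · rintro ⟨h, ⟨c⟩⟩
    refine ⟨⟨by omega, h⟩, fun d hd => ?_⟩
    by_contra hlt
    exact (hd.2 n (not_le.1 hlt)).false c

end GCWComplex

section Dimension

variable {G : Type u} [Group G] {F 𝒢 : SubgroupFamily G} {E : CompatibleRel F 𝒢} {I : Set (Diff 𝒢 F)}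
  {A : Type u} {B C : I → Type u} [TopologicalSpace A] [MulAction G A] [ContinuousConstSMul G A]
  [∀ H, TopologicalSpace (B H)] [∀ H : I, MulAction (E.normalizer H.1) (B H)]
  [∀ H : I, ContinuousConstSMul (E.normalizer H.1) (B H)]
  [∀ H, TopologicalSpace (C H)] [∀ H : I, MulAction (E.normalizer H.1) (C H)]
  [∀ H : I, ContinuousConstSMul (E.normalizer H.1) (C H)]
  {SA : GCWComplex G A} {SC : ∀ H : I, GCWComplex (E.normalizer H.1) (C H)}
  {SB : ∀ H : I, GCWComplex (E.normalizer H.1) (B H)}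

/-- A model for `E_𝒢(G)` built from models of controlled dimension. -/
theorem exists_isModel_dimLE (hF𝒢 : F ≤ 𝒢) (hI : E.IsCompleteSystem I) (hA : SA.IsModel F)
    (hC : ∀ H : I, (SC H).IsModel (F.inter (E.normalizer H.1)))
    (hB : ∀ H : I, (SB H).IsModel (E.family H.1)) {n : ℤ} (hAn : SA.DimLE n)
    (hCn : ∀ H, (SC H).DimLE (n - 1)) (hBn : ∀ H, (SB H).DimLE n) :
    ∃ (X : Type u) (_ : TopologicalSpace X) (_ : MulAction G X) (_ : ContinuousConstSMul G X)
      (S : GCWComplex G X), S.IsModel 𝒢 ∧ S.DimLE n ∧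
        ∀ m, Nonempty (SA.cell m) → Nonempty (S.cell m) := by
  -- The isotropy of `C H` lies in `F ∩ N_G[H] ⊆ 𝒢[H]`, and that of the induced spaces lies in `F`,
  -- so both families of maps exist and can be taken cellular.
  choose f hf using fun H => (hB H).exists_isCellular (SC H) fun c => Or.inr ((hC H).isotropy c)
  obtain ⟨i, hi⟩ := hA.exists_isCellular (GCWComplex.sigma fun H => (SC H).induced) fun p => by
    obtain ⟨H, g, c, rfl⟩ := exists_sliceMap_eq p
    rw [stabilizer_sliceMap_mem]
    exact (hC H).isotropy c
  have h := GPushout.isGPushout i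
    (sigmaMap fun H : I => Induced.map (G := G) (MapCyl.source (f H)))
  have hs := fun H => MapCyl.isInclusion_source (hf H)
  have hs' := GCWComplex.IsInclusion.sigma fun H => (hs H).induced (G := G)
  -- In this structure all cells of `A` remain cells of the pushout, so an `n`-cell of `A` gives one
  -- of the new model and the dimension is not less than `n`.
  exact ⟨_, _, _, _, h.symm.gcw hs' hi,
    h.isModel hF𝒢 hI hA hC (fun H => MapCyl.isModel (hB H) (hf H)) hs hi.continuous _,
    h.symm.dimLE_gcw hs' hi (GCWComplex.dimLE_sigma fun H => GCWComplex.dimLE_induced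
      (MapCyl.dimLE_gcw (hf H) (hCn H) (hBn H))) hAn, fun m ⟨c⟩ => ⟨Sum.inl c⟩⟩

end Dimension

/-! ### The theorem -/

theorem mainTheorem3 {G : Type u} [Group G] (F 𝒢 : SubgroupFamily G) (hF𝒢 : F ≤ 𝒢)
    (E : CompatibleRel F 𝒢) (I : Set (SubgroupFamily.Diff 𝒢 F)) (hI : E.IsCompleteSystem I) :
    -- the pushout of arbitrary models is a model
    (∀ (A : Type u) [TopologicalSpace A] [MulAction G A] [ContinuousConstSMul G A]
      (C : I → Type u) [∀ H, TopologicalSpace (C H)] [∀ H : I, MulAction (E.normalizer H.1) (C H)]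
      [∀ H : I, ContinuousConstSMul (E.normalizer H.1) (C H)]
      (B : I → Type u) [∀ H, TopologicalSpace (B H)] [∀ H : I, MulAction (E.normalizer H.1) (B H)]
      [∀ H : I, ContinuousConstSMul (E.normalizer H.1) (B H)]
      (SA : GCWComplex G A) (SC : ∀ H : I, GCWComplex (E.normalizer H.1) (C H))
      (SB : ∀ H : I, GCWComplex (E.normalizer H.1) (B H)),
      SA.IsModel F → (∀ H : I, (SC H).IsModel (F.inter (E.normalizer H.1))) →
      (∀ H : I, (SB H).IsModel (E.family H.1)) →
      ∀ (f : ∀ H : I, C H →[E.normalizer H.1] B H)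
        (i : (Σ H : I, Induced (E.normalizer H.1) (C H)) →[G] A),
        (((∀ H : I, (SC H).IsCellular (SB H) (f H)) ∧
            (GCWComplex.sigma fun H : I => (SC H).induced).IsInclusion SA i) ∨
          ((∀ H : I, (SC H).IsInclusion (SB H) (f H)) ∧
            (GCWComplex.sigma fun H : I => (SC H).induced).IsCellular SA i)) →
        ∀ (X : Type u) [TopologicalSpace X] [MulAction G X] [ContinuousConstSMul G X]
          (a : A →[G] X) (b : (Σ H : I, Induced (E.normalizer H.1) (B H)) →[G] X),
          IsGPushout i (sigmaMap fun H : I => Induced.map (f H)) a b →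
          ∃ S : GCWComplex G X,
            (∀ n, S.skeleton n = a '' SA.skeleton n ∪
              b '' (GCWComplex.sigma fun H : I => (SB H).induced).skeleton n) ∧
            S.IsModel 𝒢) ∧
    -- existence of an `n`-dimensional model, dimension meaning exact dimension
    (∀ n : ℕ, HasModelDimEq F n →
      (∀ H ∈ I, HasModelDimEq (F.inter (E.normalizer H)) ((n : ℤ) - 1)) →
      (∀ H ∈ I, HasModelDimEq (E.family H) n) → HasModelDimEq 𝒢 n) ∧
    -- the same with upper bounds for the dimensions
    (∀ n : ℕ, HasModelDimLE F n →
      (∀ H ∈ I, HasModelDimLE (F.inter (E.normalizer H)) ((n : ℤ) - 1)) →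
      (∀ H ∈ I, HasModelDimLE (E.family H) n) → HasModelDimLE 𝒢 n) := by
  refine ⟨?_, ?_, ?_⟩
  · intro A _ _ _ C _ _ _ B _ _ _ SA SC SB hA hC hB f i hfi X _ _ _ a b h
    exact h.exists_gcw_isModel hF𝒢 hI hA hC hB hfi
  · rintro n ⟨A, _, _, _, SA, hA, hAn⟩ hC hB
    choose C tC aC cC SC hC hCn using fun H : I => hC H.1 H.2
    choose B tB aB cB SB hB hBn using fun H : I => hB H.1 H.2
    rw [GCWComplex.dimEq_iff] at hAn
    obtain ⟨X, _, _, _, S, hS, hSn, hSc⟩ := exists_isModel_dimLE hF𝒢 hI hA hC hB hAn.1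
      (fun H => (hCn H).1.2) fun H => (hBn H).1.2
    exact ⟨X, _, _, _, S, hS, GCWComplex.dimEq_iff.2 ⟨hSn, hSc n hAn.2⟩⟩
  · rintro n ⟨A, _, _, _, SA, hA, hAn⟩ hC hB
    choose C tC aC cC SC hC hCn using fun H : I => hC H.1 H.2
    choose B tB aB cB SB hB hBn using fun H : I => hB H.1 H.2
    obtain ⟨X, _, _, _, S, hS, hSn, -⟩ := exists_isModel_dimLE hF𝒢 hI hA hC hB hAn hCn hBn
    exact ⟨X, _, _, _, S, hS, hSn⟩
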